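/- **Model.** There are $M\ge 1$ agents and $K>M$ arms. In each round $t=0,1,\dots,T-1$ every agent $m$ pulls an arm $k_m(t)$, observes whether it collides (another agent pulls the same arm), and receives the reward $X_{m,k_m(t)}(t)$ if it does not collide and $0$ otherwise. It may also query a hint for one further arm $k$ and then observes $X_{m,k}(t)$. The reward matrices $X(0),X(1),\dots$ are independent, and $X_{m,k}(t)$ is Bernoulli with mean $\mu_{m,k}\in[0,1]$. For a map $G$ from agents to arms let $U(G)=\sum_m \mu_{m,G(m)}\mathbf 1\{G(m')\ne G(m)\ \forall m'\neq m\}$. Assume that $U$ has a unique maximizer $G^*$, and let $\Delta=\Delta^{\mathrm{match}}_{\min}=\min_{G\neq G^*}\big(U(G^*)-U(G)\big)$, which is known to the agents, as are $M,K,T$ and the agents' own indices. Put $$T_0=\frac{9M^2K\log(2MT)}{\Delta^2}.$$ **Algorithm HD-ETC.** The agents share a matrix $\tilde\mu^\rho$ of quantized statistics, $\tilde\mu^0=0$, and $G^\rho$ is a matching of maximum weight for $\tilde\mu^\rho$ (Hungarian algorithm with a fixed tie-breaking rule). As long as fewer than $T_0$ exploration rounds have been played, epoch $\rho=0,1,2,\dots$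 consists of two phases. * *Exploration*: for $K$ rounds agent $m$ pulls $G^\rho(m)$ and in round $t$ queries a hint for arm $(m+t)\bmod K$ (agents and arms numbered from $0$); $\hat\mu_{m,k}$ is the empirical mean of all observations, by pull or by hint, of arm $k$ by agent $m$ in exploration rounds. * *Communication* (absent if $M=1$): each agent $m$ rounds $\hat\mu_{m,k}$ up to $\lceil 1+\frac12\log_2(\rho+1)\rceil$ binary digits, which gives $\tilde\mu^{\rho+1}_{m,k}$. For each arm $k$, each sender $s$ and each receiver $r\ne s$, in this nested order, $s$ sends to $r$ the difference $\tilde\mu^{\rho+1}_{s,k}-\tilde\mu^{\rho}_{s,k}$ in units of the last digit, one bit per round, as the string: a start bit $1$; then the sign and the binary digits without leading zeros, each preceded by a continuation bit $1$; then an end bit $0$. To send a $1$ the sender pulls $G^\rho(r)$, causing a collision, and to send a $0$ it pulls $G^\rho(s)$; all other agents $m$ pull $G^\rho(m)$. Each agent acts on its own observations only: a receiver decodes its collisions, and waits while the others receive. After the last epoch, with final index $\rho$, every agent $m$ pulls $G^\rho(m)$ in all remaining rounds, with no further hints or communication. The whole process is cut off after $T$ rounds. Let $R_{\exp}(T)$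 and $R_{\mathrm{com}}(T)$ be the expected sums of $U(G^*)-U(G(t))$, where $G(t)$ is the graph pulled in round $t$, over the rounds $t<T$ outside and inside the communication phases, respectively, and let $L(T)$ be the expected total number of hint queries of all agents in the $T$ rounds. **Theorem.** There is an absolute constant $C$ such that for all $M,K,T\ge1$ with $M<K$ and all reward distributions as above 1. (exploration regret) $R_{\exp}(T)\le C\,\dfrac{M^3K^2}{\Delta^2}$, that is, $O(M^3K^2)$ for fixed $\Delta$, independently of $T$; 2. (hint complexity) $L(T)\le C\,M\,T_0$; 3. (communication regret) $R_{\mathrm{com}}(T)\le C\,M^2\,T_0$. -/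

import Mathlib

open MeasureTheory ProbabilityTheory
open scoped Classical

noncomputable section

namespace HMA2B

variable {M K : ℕ}

/-! ### The bandit model

Agents are `Fin M`, arms are `Fin K`.  An arm-pulling graph is a map `g : Fin M → Fin K`
(every agent is joined to exactly one arm); it may have collisions. -/

/-- Agent `m` collides in the arm-pulling graph `g`. -/
def Collides (g : Fin M → Fin K) (m : Fin M) : Prop := ∃ m', m' ≠ m ∧ g m' = g m

/-- Expected utility of an arm-pulling graph: a colliding agent earns nothing. -/
def utility (μ : Fin M → Fin K → ℝ) (g : Fin M → Fin K) : ℝ :=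
  ∑ m, if Collides g m then 0 else μ m (g m)

/-- `gs` is the unique graph of highest expected utility. -/
def IsUniqueOptimal (μ : Fin M → Fin K → ℝ) (gs : Fin M → Fin K) : Prop :=
  ∀ g, g ≠ gs → utility μ g < utility μ gs

/-- The minimum gap: the least utility difference between `gs` and another graph. -/
def minGap (μ : Fin M → Fin K → ℝ) (gs : Fin M → Fin K) : ℝ :=
  sInf ((fun g => utility μ gs - utility μ g) '' {g | g ≠ gs})

/-- The number of exploration rounds, `T₀ = 9 M² K log (2MT) / Δ²`. -/
def stopTime (M K T : ℕ) (Δ : ℝ) : ℝ :=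
  9 * (M : ℝ) ^ 2 * K * Real.log (2 * M * T) / Δ ^ 2

/-! ### Maximum-weight matchings -/

theorem exists_maxMatching (hMK : M < K) (w : Fin M → Fin K → ℚ) :
    ∃ G : Fin M ↪ Fin K, ∀ G' : Fin M ↪ Fin K, ∑ m, w m (G' m) ≤ ∑ m, w m (G m) := by
  have : Nonempty (Fin M ↪ Fin K) := ⟨Fin.castLEEmb hMK.le⟩
  exact Finite.exists_max fun G : Fin M ↪ Fin K => ∑ m, w m (G m)

/-- The output of the Hungarian algorithm: a matching of maximum total weight
(ties are broken by a fixed rule, the same for all agents). -/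
def hungarian (hMK : M < K) (w : Fin M → Fin K → ℚ) : Fin M ↪ Fin K :=
  (exists_maxMatching hMK w).choose

/-- The arm of agent `m` in the covering matching that is hinted in round `t`
(round robin over the `K` covering matchings). -/
def coveringArm (hMK : M < K) (m : Fin M) (t : ℕ) : Fin K :=
  ⟨(m.val + t % K) % K, Nat.mod_lt _ (Nat.zero_lt_of_lt hMK)⟩

/-! ### Quantization and the bit strings sent by collisions -/

/-- Number of fractional binary digits of the statistics shared for epoch `ρ`. -/
def quantBits (ρ : ℕ) : ℕ := ⌈1 + Real.logb 2 ρ / 2⌉₊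

/-- Rounding up to `b` fractional binary digits. -/
def quantize (b : ℕ) (x : ℚ) : ℚ := (⌈x * 2 ^ b⌉ : ℤ) / 2 ^ b

/-- The bit string of an integer `d`: a start bit `1`; then the sign of `d` and the binary digits
of `|d|` without leading zeros, most significant first, each preceded by a continuation bit `1`;
then an end bit `0`. -/
def bitString (d : ℤ) : List Bool :=
  true :: ((decide (d < 0) :: d.natAbs.bits.reverse).flatMap (fun b => [true, b]) ++ [false])

/-- The integer with a given bit string, if the string is complete. -/
def decode (l : List Bool) : Option ℤ :=
  if h : ∃ d, bitString d = l then some h.choose else none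

/-! ### HD-ETC, run locally by each agent -/

/-- What an agent is doing. -/
inductive Phase (M K : ℕ) : Type
  /-- exploration phase, `j` of its `K` rounds being over -/
  | explore (j : ℕ) : Phase M K
  /-- communication: sending the statistic of arm `k`; still to be sent are the bits in `queue`,
  each with its receiver -/
  | send (k : Fin K) (queue : List (Fin M × Bool)) : Phase M K
  /-- communication: listening to agent `s`, who sends its statistic of arm `k`; `buf` holds the
  bits received so far -/
  | receive (k : Fin K) (s : Fin M) (buf : List Bool) : Phase M K
  /-- communication: waiting for `left` rounds while `s` sends its statistic of arm `k` to the
  remaining receivers -/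
  | idle (k : Fin K) (s : Fin M) (left : ℕ) : Phase M K
  /-- exploitation phase -/
  | exploit : Phase M K

/-- The phases `send`, `receive` and `idle` are those of communication. -/
def Phase.IsComm : Phase M K → Prop
  | .explore _ => False
  | .send _ _ => True
  | .receive _ _ _ => True
  | .idle _ _ _ => True
  | .exploit => False

/-- The local memory of an agent. -/
structure Memory (M K : ℕ) : Type where
  /-- index `ρ` of the epoch -/
  epoch : ℕ
  /-- the matching `G^ρ` -/
  G : Fin M ↪ Fin K
  /-- number of observations (by pull or by hint) of each arm -/
  N : Fin K → ℕ
  /-- number of those that were equal to `1` -/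
  S : Fin K → ℕ
  /-- the agent's copy of the quantized statistics of all agents -/
  tilde : Fin M → Fin K → ℚ
  /-- the differences that the agent sends, in units of the last digit -/
  delta : Fin K → ℤ
  phase : Phase M K

/-- What an agent observes in a round: its reward, whether it collided, and the answer to its
hint query, if any. -/
structure Observation : Type where
  reward : Bool
  collision : Bool
  hint : Option Bool

/-- The empirical mean of arm `k`. -/
def Memory.mean (s : Memory M K) (k : Fin K) : ℚ := (s.S k : ℚ) / (s.N k : ℚ)

/-- Initial memory of every agent. -/
def Memory.init (hMK : M < K) : Memory M K where
  epoch := 0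
  G := hungarian hMK 0
  N := 0
  S := 0
  tilde := 0
  delta := 0
  phase := .explore 0

/-- The arm pulled by agent `m`.  A sender pulls the receiver's arm for a bit `1`; otherwise an
agent pulls its own arm in the current matching. -/
def Memory.pull (m : Fin M) (s : Memory M K) : Fin K :=
  match s.phase with
  | .send _ ((r, true) :: _) => s.G r
  | _ => s.G m

/-- The arm for which agent `m` queries a hint in round `t`, if any. -/
def Memory.hintArm (hMK : M < K) (m : Fin M) (t : ℕ) (s : Memory M K) : Option (Fin K) :=
  match s.phase with
  | .explore _ => some (coveringArm hMK m t)
  | _ => none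

/-- Update of the statistics by the observations of an exploration round. -/
def Memory.record (hMK : M < K) (m : Fin M) (t : ℕ) (s : Memory M K) (o : Observation) :
    Memory M K :=
  { s with
    N := fun k => s.N k + (if k = s.pull m then 1 else 0)
      + (if s.hintArm hMK m t = some k then 1 else 0)
    S := fun k => s.S k + (if k = s.pull m ∧ o.reward = true then 1 else 0)
      + (if s.hintArm hMK m t = some k ∧ o.hint = some true then 1 else 0) }

/-- Start of the next epoch, which is one of exploration if fewer than `T₀` exploration rounds
are over, and exploitation otherwise. -/
def Memory.nextEpoch (hMK : M < K) (T₀ : ℝ) (s : Memory M K) : Memory M K :=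
  { s with
    epoch := s.epoch + 1
    G := hungarian hMK s.tilde
    phase := if (((s.epoch + 1) * K : ℕ) : ℝ) < T₀ then .explore 0 else .exploit }

/-- Agent `m` enters the part of the communication phase in which agent `s'` sends its statistic
of arm `k` to the other agents, one after the other. -/
def Memory.startTurn (m : Fin M) (k : Fin K) (s' : Fin M) (s : Memory M K) : Memory M K :=
  { s with
    phase :=
      if s' = m then
        .send k (((List.finRange M).filter (fun r => r ≠ m)).flatMap
          fun r => (bitString (s.delta k)).map fun b => (r, b))
      else .receive k s' [] }

/-- End of the part of the communication phase in which `s'` sends its statistic of arm `k`. -/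
def Memory.endTurn (hMK : M < K) (T₀ : ℝ) (m : Fin M) (k : Fin K) (s' : Fin M)
    (s : Memory M K) : Memory M K :=
  if h : s'.val + 1 < M then s.startTurn m k ⟨s'.val + 1, h⟩
  else if h : k.val + 1 < K then s.startTurn m ⟨k.val + 1, h⟩ ⟨0, m.pos⟩
  else s.nextEpoch hMK T₀

/-- Start of the communication phase: agent `m` quantizes its empirical means and computes the
differences to the values shared before (integers in units of the last digit).  A single agent
has nobody to communicate with. -/
def Memory.beginComm (hMK : M < K) (T₀ : ℝ) (m : Fin M) (s : Memory M K) : Memory M K :=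
  let b := quantBits (s.epoch + 1)
  let s' : Memory M K :=
    { s with
      delta := fun k => ⌊(quantize b (s.mean k) - s.tilde m k) * 2 ^ b⌋
      tilde := Function.update s.tilde m fun k => quantize b (s.mean k) }
  if M = 1 then s'.nextEpoch hMK T₀
  else s'.startTurn m ⟨0, Nat.zero_lt_of_lt hMK⟩ ⟨0, m.pos⟩

/-- Agent `m` has received the difference `d` for arm `k` of agent `s'`. -/
def Memory.learn (s' : Fin M) (k : Fin K) (d : ℤ) (s : Memory M K) : Memory M K :=
  { s with
    tilde := Function.update s.tilde s' (Function.update (s.tilde s') k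
      (s.tilde s' k + (d : ℚ) / 2 ^ quantBits (s.epoch + 1))) }

/-- The local transition of agent `m` at the end of round `t`, from its memory and its own
observation `o` in that round. -/
def Memory.step (hMK : M < K) (T₀ : ℝ) (m : Fin M) (t : ℕ) (s : Memory M K)
    (o : Observation) : Memory M K :=
  match s.phase with
  | .explore j =>
    if j + 1 < K then { s.record hMK m t o with phase := .explore (j + 1) }
    else (s.record hMK m t o).beginComm hMK T₀ m
  | .send k queue =>
    if queue.tail = [] then s.endTurn hMK T₀ m k m
    else { s with phase := .send k queue.tail }
  | .receive k s' buf =>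
    if buf = [] ∧ o.collision = false then s
    else
      match decode (buf ++ [o.collision]) with
      | none => { s with phase := .receive k s' (buf ++ [o.collision]) }
      | some d =>
        let left := (Finset.univ.filter fun r : Fin M => m < r ∧ r ≠ s').card * (buf.length + 1)
        if left = 0 then (s.learn s' k d).endTurn hMK T₀ m k s'
        else { s.learn s' k d with phase := .idle k s' left }
  | .idle k s' left =>
    if left ≤ 1 then s.endTurn hMK T₀ m k s' else { s with phase := .idle k s' (left - 1) }
  | .exploit => s

/-! ### The joint run and its costs -/

/-- The graph pulled when the agents' memories are `σ`. -/
def pulls (σ : Fin M → Memory M K) : Fin M → Fin K := fun m => (σ m).pull m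

/-- The observation of agent `m` in round `t` when the rewards of that round are `x`. -/
def observe (hMK : M < K) (σ : Fin M → Memory M K) (t : ℕ) (x : Fin M → Fin K → Bool)
    (m : Fin M) : Observation where
  reward := x m (pulls σ m) && !decide (Collides (pulls σ) m)
  collision := decide (Collides (pulls σ) m)
  hint := ((σ m).hintArm hMK m t).map (x m)

/-- The memories of all agents at the start of round `t = 0, 1, 2, …`, for the reward realization
`x`. -/
def run (hMK : M < K) (T₀ : ℝ) (x : ℕ → Fin M → Fin K → Bool) : ℕ → Fin M → Memory M K
  | 0 => fun _ => Memory.init hMK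
  | t + 1 => fun m =>
      (run hMK T₀ x t m).step hMK T₀ m t (observe hMK (run hMK T₀ x t) t (x t) m)

/-- A round of communication. -/
def IsCommRound (σ : Fin M → Memory M K) : Prop := ∃ m, (σ m).phase.IsComm

/-- Rewards that are independent from round to round, the reward of agent `m` for arm `k` being
Bernoulli with mean `μ m k`. -/
structure IsRewardProcess {Ω : Type*} [MeasurableSpace Ω] (P : Measure Ω)
    (μ : Fin M → Fin K → ℝ) (X : ℕ → Ω → Fin M → Fin K → Bool) : Prop where
  measurable : ∀ t, Measurable (X t)
  indep : iIndepFun X P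
  law : ∀ t m k, P.real {ω | X t ω m k = true} = μ m k

section Costs

variable {Ω : Type*} [MeasurableSpace Ω] (P : Measure Ω) (hMK : M < K) (T₀ : ℝ) (T : ℕ)
  (μ : Fin M → Fin K → ℝ) (gs : Fin M → Fin K) (X : ℕ → Ω → Fin M → Fin K → Bool)

/-- Expected regret of the exploration and exploitation rounds among the first `T` rounds. -/
def explorationRegret : ℝ :=
  ∫ ω, ∑ t ∈ Finset.range T,
    (if IsCommRound (run hMK T₀ (fun i => X i ω) t) then 0
      else utility μ gs - utility μ (pulls (run hMK T₀ (fun i => X i ω) t))) ∂P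

/-- Expected regret of the communication rounds among the first `T` rounds. -/
def communicationRegret : ℝ :=
  ∫ ω, ∑ t ∈ Finset.range T,
    (if IsCommRound (run hMK T₀ (fun i => X i ω) t) then
      utility μ gs - utility μ (pulls (run hMK T₀ (fun i => X i ω) t)) else 0) ∂P

/-- Expected number of hint queries of all agents in the first `T` rounds. -/
def hintComplexity : ℝ :=
  ∫ ω, ∑ t ∈ Finset.range T, ∑ m : Fin M,
    (if ((run hMK T₀ (fun i => X i ω) t m).hintArm hMK m t).isSome = true then (1 : ℝ) else 0) ∂P

end Costs

end HMA2B

end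

namespace HMA2B

/-! ### Bit strings -/

/-! The argument has a deterministic part, valid for every reward realization, and a probabilistic
part.

Deterministic part. The bit strings form a prefix-free code and only the current receiver can see a
collision caused by the sender. Hence the local state machines stay synchronized through every turn
(`turnState_step`, `run_comm`, `run_epoch`), and all agents hold the same matrix and the same
matching at the start of each epoch. With `T₀ = A K` there are `E = ⌈A⌉` exploring epochs, each with
`K` exploration rounds; the number of hints follows at once. Matchings are injective, so exploration
has no collisions and every observation is a genuine sample. The round-robin hints give every agent
at least `ρ` observations of every arm after `ρ` epochs, and each agent has `2 K ρ` observations in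
total.

Concentration. For the random counts `N` and successes `S` of one agent and arm, `exp (l (S - μ N) -
l² N / 4)` is a supermartingale: Hoeffding's lemma gives `l² w² / 8` for a reward observed `w` times
in a round, and `w ≤ 2`. A maximal inequality then bounds by `2 M K exp (-ε² r)` the probability
that some empirical mean based on at least `r` observations is ever off by more than `ε`
(`measure_deviation_le`). Outside this event the matching of epoch `ρ` has regret at most `M / (2
√ρ) + 2 M ε` (`regret_shared_le`), the two terms coming from rounding and from estimation.

Exploration regret. Take `ε = Δ / (3 M)` and `a = ε²`. Once `ρ > 1 / (4 a)` the bound is below the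
gap, so the matching is optimal outside the deviation event. The epochs with `ρ < 2 K / a` cost at
most `M` per round, which gives `M³ K² / Δ²`; later ones fail with probability at most `4 exp (-a ρ
/ 2)`, a geometric series. In exploitation the failure probability is at most `K / T`, which cancels
the horizon.

Communication regret. A communication round costs at most `2` more than the current matching. An arm
that is only hinted changes its mean by `O(1 / ρ)`, and its string has length `O(1)`. A matched arm
gets `K + 1` new observations and may change more, but the resulting excess lengths are controlled
by increments of `√N`, which telescope, and the Cauchy-Schwarz inequality bounds the sum of the
final `√N` (`sum_length_le`, `sum_comm_le`). It remains to see that the regrets of the matchings add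
up to `O(E)` in expectation, which follows from concentration with deviations of order `√(log (2 M²
K) / ρ)`. -/

theorem flatMap_prefix_inj : ∀ l₁ l₂ : List Bool,
    (l₁.flatMap (fun b => [true, b]) ++ [false]) <+: (l₂.flatMap (fun b => [true, b]) ++ [false]) →
      l₁ = l₂
  | [], [], _ => rfl
  | [], b :: l₂, h => by simp at h
  | b :: l₁, [], h => by simp at h
  | b :: l₁, c :: l₂, h => by
    simp only [List.flatMap_cons, List.cons_append, List.nil_append,
      List.cons_prefix_cons, true_and] at h
    rw [h.1, flatMap_prefix_inj l₁ l₂ h.2]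

/-- The end bit `0` stands where a longer string would have a continuation bit `1`, so no string is
a proper prefix of another; sign and binary digits then determine the integer. -/
theorem bitString_prefix_inj {d e : ℤ} (h : bitString d <+: bitString e) : d = e := by
  unfold bitString at h
  rw [List.cons_prefix_cons] at h
  have h2 := flatMap_prefix_inj _ _ h.2
  rw [List.cons.injEq] at h2
  obtain ⟨hs, hb⟩ := h2
  have hb' : d.natAbs = e.natAbs := by
    have := List.reverse_injective hb
    have h3 : Nat.digits 2 d.natAbs = Nat.digits 2 e.natAbs := by
      rw [Nat.digits_two_eq_bits, Nat.digits_two_eq_bits, this]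
    exact Nat.digits_inj_iff.1 h3
  have hs' : d < 0 ↔ e < 0 := by simpa using hs
  omega

theorem decode_bitString (d : ℤ) : decode (bitString d) = some d := by
  have h : ∃ e, bitString e = bitString d := ⟨d, rfl⟩
  unfold decode
  rw [dif_pos h]
  congr 1
  exact bitString_prefix_inj (h.choose_spec.symm ▸ List.prefix_refl (bitString d))

/-- With `decode_bitString`, this makes a receiver stop exactly after the end bit, without knowing
the length in advance. -/
theorem decode_take (d : ℤ) {p : ℕ} (hp : p < (bitString d).length) :
    decode ((bitString d).take p) = none := by
  unfold decode
  rw [dif_neg]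
  rintro ⟨e, he⟩
  have h1 : bitString e <+: bitString d := he ▸ List.take_prefix _ _
  have h2 := bitString_prefix_inj h1
  subst h2
  have := congrArg List.length he
  simp at this
  omega

/-- Start and end bit, and two bits each for the sign and every digit. -/
theorem length_bitString (d : ℤ) : (bitString d).length = 4 + 2 * d.natAbs.size := by
  unfold bitString
  simp [List.length_flatMap, Nat.size_eq_bits_len]
  ring

/-! ### One turn of the communication phase -/

variable {M K : ℕ}

theorem endTurn_phase (hMK : M < K) (T₀ : ℝ) (m : Fin M) (k : Fin K) (s' : Fin M)
    (s : Memory M K) (ph : Phase M K) :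
    ({ s with phase := ph } : Memory M K).endTurn hMK T₀ m k s' = s.endTurn hMK T₀ m k s' := by
  unfold Memory.endTurn
  split_ifs <;> rfl

theorem learn_phase (s' : Fin M) (k : Fin K) (d : ℤ) (s : Memory M K) (ph : Phase M K) :
    ({ s with phase := ph } : Memory M K).learn s' k d = { s.learn s' k d with phase := ph } := rfl

/-- What a sender has still to send, if `p` bits of `l` have been sent to `r` already, and the
receivers `rest` are still to come. -/
def sendQueue (l : List Bool) (r : Fin M) (rest : List (Fin M)) (p : ℕ) : List (Fin M × Bool) :=
  (l.drop p).map (fun b => (r, b)) ++ rest.flatMap fun r' => l.map fun b => (r', b)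

theorem length_sendQueue (l : List Bool) (r : Fin M) (rest : List (Fin M)) (p : ℕ) :
    (sendQueue l r rest p).length = (l.length - p) + rest.length * l.length := by
  simp [sendQueue, List.length_flatMap]

theorem sendQueue_cons (l : List Bool) (r : Fin M) (rest : List (Fin M)) {p : ℕ}
    (hp : p < l.length) :
    sendQueue l r rest p = (r, l[p]) :: sendQueue l r rest (p + 1) := by
  unfold sendQueue
  rw [List.drop_eq_getElem_cons hp, List.map_cons, List.cons_append]

/-- The end of the transmission to `r` and the beginning of that to `r'` are the same state of the
queue. -/
theorem sendQueue_length (l : List Bool) (r r' : Fin M) (rest : List (Fin M)) :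
    sendQueue l r (r' :: rest) l.length = sendQueue l r' rest 0 := by
  unfold sendQueue
  rw [List.drop_length, List.drop_zero, List.flatMap_cons, List.map_nil, List.nil_append]

/-- The memories during the turn `(k, s)`, when `p` bits have been sent to `r` and the
receivers `rest` are still to come; `c` are the memories at the start of the turn. -/
noncomputable def turnState (c : Fin M → Memory M K) (k : Fin K) (s r : Fin M) (rest : List (Fin M)) (p : ℕ)
    (m : Fin M) : Memory M K :=
  let l := bitString ((c s).delta k)
  if m = s then { c m with phase := .send k (sendQueue l r rest p) }
  else if m = r then { c m with phase := .receive k s (l.take p) }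
  else if m ∈ rest then { c m with phase := .receive k s [] }
  else { (c m).learn s k ((c s).delta k) with phase := .idle k s (sendQueue l r rest p).length }

/-- The memories after the turn `(k, s)`. -/
noncomputable def afterTurn (c : Fin M → Memory M K) (k : Fin K) (s : Fin M) (m : Fin M) : Memory M K :=
  if m = s then c m else (c m).learn s k ((c s).delta k)

/-- A communication round in the matching `G`: all agents but one pull their arm of `G`, and the
remaining one pulls some arm of `G`. -/
structure IsSync (G : Fin M ↪ Fin K) (σ : Fin M → Memory M K) : Prop where
  comm : ∀ m, (σ m).phase.IsComm
  pulls_eq : ∃ s r, (∀ m, m ≠ s → pulls σ m = G m) ∧ pulls σ s = G r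

section Turn

variable {c : Fin M → Memory M K} {G : Fin M ↪ Fin K} {k : Fin K} {s r : Fin M}
  {rest : List (Fin M)} {p : ℕ}

theorem turnState_pull (hG : ∀ m, (c m).G = G) (hp : p < (bitString ((c s).delta k)).length)
    (m : Fin M) : pulls (turnState c k s r rest p) m =
      if m = s ∧ (bitString ((c s).delta k))[p] = true then G r else G m := by
  unfold pulls Memory.pull turnState
  by_cases h : m = s
  · subst h
    simp only [if_true, sendQueue_cons _ r rest hp, true_and]
    cases (bitString ((c m).delta k))[p] <;> simp [hG]
  · simp only [h, if_false, false_and]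
    split_ifs <;> simp [hG, Memory.learn]

theorem turnState_isSync (hG : ∀ m, (c m).G = G) (hp : p < (bitString ((c s).delta k)).length) :
    IsSync G (turnState c k s r rest p) := by
  refine ⟨fun m => ?_, s, if (bitString ((c s).delta k))[p] = true then r else s, ?_, ?_⟩
  · unfold turnState
    split_ifs <;> trivial
  · intro m hm
    rw [turnState_pull hG hp, if_neg (fun h => hm h.1)]
  · rw [turnState_pull hG hp]
    split_ifs <;> simp_all

/-- As `G` is injective, the sender can only hit the receiver. So the receiver reads each bit off
its own collisions, and all other listeners see silence. -/
theorem turnState_collides (hG : ∀ m, (c m).G = G) (hr : r ≠ s)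
    (hp : p < (bitString ((c s).delta k)).length) {m : Fin M} (hm : m ≠ s) :
    Collides (pulls (turnState c k s r rest p)) m ↔
      m = r ∧ (bitString ((c s).delta k))[p] = true := by
  unfold Collides
  simp only [turnState_pull hG hp, hm, false_and, if_false]
  constructor
  · rintro ⟨m', h1, h2⟩
    split_ifs at h2 with h3
    · exact ⟨(G.injective h2).symm, h3.2⟩
    · exact absurd (G.injective h2) h1
  · rintro ⟨rfl, h⟩
    exact ⟨s, hm.symm, by simp [h]⟩

variable (hMK : M < K) (T₀ : ℝ)

/-- The remaining receivers are listed in increasing order, and none is left out. -/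
structure IsReceiverList (s : Fin M) (rs : List (Fin M)) : Prop where
  sorted : rs.Pairwise (· < ·)
  ne : ∀ r ∈ rs, r ≠ s
  upper : ∀ r ∈ rs, ∀ r', r < r' → r' ≠ s → r' ∈ rs

theorem IsReceiverList.tail {s r : Fin M} {rs : List (Fin M)} (h : IsReceiverList s (r :: rs)) :
    IsReceiverList s rs := by
  have h1 := List.pairwise_cons.1 h.sorted
  refine ⟨h1.2, fun r' hr' => h.ne _ (List.mem_cons_of_mem _ hr'), fun a ha b hab hb => ?_⟩
  rcases List.mem_cons.1 (h.upper a (List.mem_cons_of_mem _ ha) b hab hb) with h2 | h2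
  · subst h2
    exact absurd (h1.1 a ha) (not_lt.2 hab.le)
  · exact h2

/-- Receivers are served in increasing order, so an agent that has just been served can compute from
indices alone how many are still to come, and hence how long to wait. -/
theorem IsReceiverList.card {s r : Fin M} {rs : List (Fin M)} (h : IsReceiverList s (r :: rs)) :
    (Finset.univ.filter fun r' : Fin M => r < r' ∧ r' ≠ s).card = rs.length := by
  have h1 := List.pairwise_cons.1 h.sorted
  have hnd : rs.Nodup := h1.2.imp (fun h => ne_of_lt h)
  rw [← List.toFinset_card_of_nodup hnd]
  congr 1
  ext r'
  simp only [Finset.mem_filter, Finset.mem_univ, true_and, List.mem_toFinset]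
  constructor
  · rintro ⟨h2, h3⟩
    rcases List.mem_cons.1 (h.upper r List.mem_cons_self r' h2 h3) with h4 | h4
    · exact absurd h4 h2.ne'
    · exact h4
  · exact fun h2 => ⟨h1.1 _ h2, h.ne _ (List.mem_cons_of_mem _ h2)⟩

theorem IsReceiverList.notMem {s r : Fin M} {rs : List (Fin M)} (h : IsReceiverList s (r :: rs)) :
    r ∉ rs := fun h2 => lt_irrefl r ((List.pairwise_cons.1 h.sorted).1 r h2)

/-- The memories one round after `turnState c k s r rest p`. -/
noncomputable def nextTurnState (c : Fin M → Memory M K) (k : Fin K) (s r : Fin M)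
    (rest : List (Fin M)) (p : ℕ) (m : Fin M) : Memory M K :=
  if p + 1 < (bitString ((c s).delta k)).length then turnState c k s r rest (p + 1) m
  else match rest with
    | [] => (afterTurn c k s m).endTurn hMK T₀ m k s
    | r' :: rest' => turnState c k s r' rest' 0 m

/-- One round of a turn. -/
theorem turnState_step (hG : ∀ m, (c m).G = G) (hrs : IsReceiverList s (r :: rest))
    (hp : p < (bitString ((c s).delta k)).length) (t : ℕ) (x : Fin M → Fin K → Bool) (m : Fin M) :
    (turnState c k s r rest p m).step hMK T₀ m t
        (observe hMK (turnState c k s r rest p) t x m) =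
      nextTurnState hMK T₀ c k s r rest p m := by
  unfold nextTurnState
  have hr : r ≠ s := hrs.ne r List.mem_cons_self
  set o := observe hMK (turnState c k s r rest p) t x m with ho
  have hcol : m ≠ s → o.collision = decide (m = r ∧ (bitString ((c s).delta k))[p] = true) := by
    intro hm
    rw [ho]
    simp only [observe, turnState_collides hG hr hp hm]
  have hqlen : (sendQueue (bitString ((c s).delta k)) r rest (p + 1)).length =
      ((bitString ((c s).delta k)).length - (p + 1)) +
        rest.length * (bitString ((c s).delta k)).length := length_sendQueue _ _ _ _
  have hend : ∀ r' rest', p + 1 = (bitString ((c s).delta k)).length →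
      sendQueue (bitString ((c s).delta k)) r (r' :: rest') (p + 1) =
        sendQueue (bitString ((c s).delta k)) r' rest' 0 := by
    intro r' rest' h
    rw [h, sendQueue_length]
  have hpos : ∀ r' rest', rest = r' :: rest' →
      0 < rest.length * (bitString ((c s).delta k)).length := by
    intro r' rest' h
    rw [h]
    exact Nat.mul_pos (Nat.succ_pos _) (by omega)
  have hcons := sendQueue_cons (bitString ((c s).delta k)) r rest hp
  generalize hl : bitString ((c s).delta k) = l at *
  by_cases hms : m = s
  · subst hms
    have e1 : turnState c k m r rest p m = { c m with phase := .send k (sendQueue l r rest p) } := by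
      simp [turnState, hl]
    rw [e1]
    simp only [Memory.step, hcons, List.tail_cons]
    by_cases h1 : p + 1 < l.length
    · rw [if_pos h1, if_neg]
      · simp [turnState, hl]
      · intro h; rw [h] at hqlen; simp at hqlen; omega
    · rw [if_neg h1]
      cases rest with
      | nil =>
        rw [if_pos]
        · rw [endTurn_phase]; simp [afterTurn]
        · apply List.eq_nil_of_length_eq_zero; rw [hqlen]; simp; omega
      | cons r' rest' =>
        rw [if_neg]
        · rw [hend r' rest' (by omega)]; simp [turnState, hl]
        · intro h; rw [h] at hqlen; have := hpos _ _ rfl; simp only [List.length_nil] at hqlen; omega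
  · have hcol := hcol hms
    by_cases hmr : m = r
    · subst hmr
      have e1 : turnState c k s m rest p m = { c m with phase := .receive k s (l.take p) } := by
        simp [turnState, hl, hms]
      have htake : l.take p ++ [o.collision] = l.take (p + 1) := by
        rw [List.take_add_one, List.getElem?_eq_getElem hp, hcol]
        simp
      rw [e1]
      -- An empty buffer means that the start bit is being sent; it is `1`, so the receiver sees a
      -- collision and does not mistake this round for waiting.
      have hnot : ¬ (l.take p = [] ∧ o.collision = false) := by
        rintro ⟨h1, h2⟩
        have hp0 : p = 0 := by
          have := congrArg List.length h1
          simp at this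
          rcases this with h | h
          · exact h
          · subst h; simp at hp
        subst hp0
        have h3 : l[0] = true := by subst hl; rfl
        rw [hcol, h3] at h2
        simp at h2
      simp only [Memory.step]
      rw [if_neg hnot, htake]
      by_cases h1 : p + 1 < l.length
      · have h2 : decode (l.take (p + 1)) = none := by
          subst hl; exact decode_take _ h1
        rw [if_pos h1, h2]
        simp [turnState, hl, hms]
      · have h2 : decode (l.take (p + 1)) = some ((c s).delta k) := by
          rw [List.take_of_length_le (by omega), ← hl]; exact decode_bitString _
        have hlen : (l.take p).length + 1 = l.length := by
          rw [List.length_take]; omega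
        rw [if_neg h1, h2]
        simp only [hlen, hrs.card]
        cases rest with
        | nil =>
          simp only [List.length_nil, zero_mul, if_true]
          rw [learn_phase, endTurn_phase]; simp [afterTurn, hms]
        | cons r' rest' =>
          have hne : m ≠ r' ∧ m ∉ rest' := by simpa using hrs.notMem
          rw [if_neg]
          -- The waiting time computed by the receiver equals the length of the sender's remaining
          -- queue.
          · simp only [turnState, hl, hms, hne.1, hne.2, if_false]
            rw [← hend r' rest' (by omega), hqlen]
            simp only [learn_phase]
            congr 2
            omega
          · simp; intro h; subst h; simp at hp
    · have hcol' : o.collision = false := by rw [hcol]; simp [hmr]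
      by_cases hmem : m ∈ rest
      · have e1 : turnState c k s r rest p m = { c m with phase := .receive k s [] } := by
          simp [turnState, hms, hmr, hmem]
        rw [e1]
        simp only [Memory.step, hcol']
        by_cases h1 : p + 1 < l.length
        · simp [h1, turnState, hms, hmr, hmem]
        · cases rest with
          | nil => simp at hmem
          | cons r' rest' =>
            by_cases h2 : m = r'
            · subst h2
              simp [h1, turnState, hms]
            · have h3 : m ∈ rest' := by simpa [h2] using hmem
              simp [h1, turnState, hms, h2, h3]
      · have e1 : turnState c k s r rest p m = { (c m).learn s k ((c s).delta k) with
            phase := .idle k s (sendQueue l r rest p).length } := by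
          simp [turnState, hms, hmr, hmem, hl]
        rw [e1]
        simp only [Memory.step, hcons, List.length_cons]
        by_cases h1 : p + 1 < l.length
        · rw [if_pos h1, if_neg (by omega)]
          simp [turnState, hms, hmr, hmem, hl]
        · rw [if_neg h1]
          cases rest with
          | nil =>
            rw [if_pos (by rw [hqlen, List.length_nil]; omega), endTurn_phase]
            simp [afterTurn, hms]
          | cons r' rest' =>
            have hne : m ≠ r' ∧ m ∉ rest' := by simpa using hmem
            rw [if_neg (by have := hpos _ _ rfl; omega), hend r' rest' (by omega)]
            simp [turnState, hms, hne.1, hne.2, hl]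

theorem run_succ (x : ℕ → Fin M → Fin K → Bool) (t : ℕ) (m : Fin M) :
    run hMK T₀ x (t + 1) m = (run hMK T₀ x t m).step hMK T₀ m t
      (observe hMK (run hMK T₀ x t) t (x t) m) := rfl

/-- Induction on `n`, the number of bits still queued, each of which takes one round. -/
theorem run_turnState (x : ℕ → Fin M → Fin K → Bool) (hG : ∀ m, (c m).G = G) (n : ℕ) :
    ∀ (t : ℕ) (r : Fin M) (rest : List (Fin M)) (p : ℕ), IsReceiverList s (r :: rest) →
      p < (bitString ((c s).delta k)).length →
      (sendQueue (bitString ((c s).delta k)) r rest p).length = n →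
      run hMK T₀ x t = turnState c k s r rest p →
      (∀ i < n, IsSync G (run hMK T₀ x (t + i))) ∧
        run hMK T₀ x (t + n) = fun m => (afterTurn c k s m).endTurn hMK T₀ m k s := by
  induction n with
  | zero =>
    intro t r rest p _ hp hn _
    rw [sendQueue_cons _ _ _ hp] at hn
    simp at hn
  | succ n ih =>
    intro t r rest p hrs hp hn hrun
    have hsync : IsSync G (run hMK T₀ x t) := hrun ▸ turnState_isSync hG hp
    have hstep : run hMK T₀ x (t + 1) = nextTurnState hMK T₀ c k s r rest p := by
      funext m
      rw [run_succ, hrun, turnState_step hMK T₀ hG hrs hp]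
    have key : (∀ i < n, IsSync G (run hMK T₀ x (t + 1 + i))) ∧
        run hMK T₀ x (t + 1 + n) = fun m => (afterTurn c k s m).endTurn hMK T₀ m k s := by
      have hq := hn
      rw [sendQueue_cons _ _ _ hp, List.length_cons] at hn
      have hn' : (sendQueue (bitString ((c s).delta k)) r rest (p + 1)).length = n := by omega
      by_cases h1 : p + 1 < (bitString ((c s).delta k)).length
      · refine ih (t + 1) r rest (p + 1) hrs h1 hn' ?_
        rw [hstep]; funext m; exact if_pos h1
      · cases rest with
        | nil =>
          rw [length_sendQueue] at hn'
          have : n = 0 := by simp at hn'; omega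
          subst this
          refine ⟨fun i hi => absurd hi (Nat.not_lt_zero _), ?_⟩
          rw [add_zero, hstep]; funext m; exact if_neg h1
        | cons r' rest' =>
          refine ih (t + 1) r' rest' 0 hrs.tail (by omega) ?_ ?_
          · rw [← hn', ← sendQueue_length _ r]
            congr 2; omega
          · rw [hstep]; funext m; exact if_neg h1
    refine ⟨fun i hi => ?_, ?_⟩
    · rcases Nat.eq_zero_or_pos i with h | h
      · subst h; exact hsync
      · have := key.1 (i - 1) (by omega)
        rwa [show t + 1 + (i - 1) = t + i by omega] at this
    · rw [← key.2]; congr 1; omega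

/-- A full turn of the communication phase. -/
theorem run_startTurn (x : ℕ → Fin M → Fin K → Bool) (hG : ∀ m, (c m).G = G) (hM : 2 ≤ M) (t : ℕ)
    (hrun : run hMK T₀ x t = fun m => (c m).startTurn m k s) :
    (∀ i < (M - 1) * (bitString ((c s).delta k)).length, IsSync G (run hMK T₀ x (t + i))) ∧
      run hMK T₀ x (t + (M - 1) * (bitString ((c s).delta k)).length) =
        fun m => (afterTurn c k s m).endTurn hMK T₀ m k s := by
  have hmem : ∀ r, r ∈ (List.finRange M).filter (fun r => r ≠ s) ↔ r ≠ s := by simp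
  have hlist : IsReceiverList s ((List.finRange M).filter (fun r => r ≠ s)) :=
    ⟨(List.pairwise_lt_finRange M).filter _, fun r hr => (hmem r).1 hr,
      fun r _ r' _ h => (hmem r').2 h⟩
  have hlen : ((List.finRange M).filter (fun r => r ≠ s)).length = M - 1 := by
    have hnd : ((List.finRange M).filter (fun r => r ≠ s)).Nodup := (List.nodup_finRange M).filter _
    rw [← List.toFinset_card_of_nodup hnd]
    have : ((List.finRange M).filter (fun r => r ≠ s)).toFinset = Finset.univ.erase s := by
      ext r; simp
    rw [this, Finset.card_erase_of_mem (Finset.mem_univ _)]; simp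
  cases hrs : (List.finRange M).filter (fun r => r ≠ s) with
  | nil => rw [hrs] at hlen; simp at hlen; omega
  | cons r rest =>
    rw [hrs] at hlist hmem hlen
    have hp : 0 < (bitString ((c s).delta k)).length := by rw [length_bitString]; omega
    refine run_turnState hMK T₀ x hG _ t r rest 0 hlist hp ?_ ?_
    · rw [length_sendQueue, ← hlen, List.length_cons]; simp; ring
    · rw [hrun]
      funext m
      unfold Memory.startTurn turnState
      by_cases hms : s = m
      · subst hms
        have : (List.finRange M).filter (fun r => decide (r ≠ s)) = r :: rest := hrs
        simp only [if_true, this]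
        simp [sendQueue]
      · have h := (hmem m).2 (fun h => hms h.symm)
        by_cases h2 : m = r
        · rw [if_neg hms, if_neg (Ne.symm hms), if_pos h2]; rfl
        · have h3 : m ∈ rest := by simpa [h2] using h
          rw [if_neg hms, if_neg (Ne.symm hms), if_neg h2, if_pos h3]

end Turn

end HMA2B

namespace HMA2B

variable {M K : ℕ} (hMK : M < K) (T₀ : ℝ)

/-! ### The whole communication phase -/

/-- The memories `c` after the first `i` turns of a communication phase that began with the
memories `c₀`, when `W` are the old and `V` the new shared statistics. -/
structure IsCommState (c₀ : Fin M → Memory M K) (W V : Fin M → Fin K → ℚ) (i : ℕ)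
    (c : Fin M → Memory M K) : Prop where
  epoch : ∀ m, (c m).epoch = (c₀ m).epoch
  G : ∀ m, (c m).G = (c₀ m).G
  delta : ∀ m, (c m).delta = (c₀ m).delta
  tilde : ∀ m s k, (c m).tilde s k = if s = m ∨ k.val * M + s.val < i then V s k else W s k

/-- The turn of arm `k` and sender `s` has number `k * M + s` in the nested order. -/
theorem turn_index_inj {k k' : Fin K} {s s' : Fin M}
    (h : k.val * M + s.val = k'.val * M + s'.val) : k = k' ∧ s = s' := by
  have hM := s.pos
  have h1 := congrArg (· / M) h
  have h2 := congrArg (· % M) h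
  simp only [Nat.mul_add_mod_self_right, Nat.mod_eq_of_lt s.isLt, Nat.mod_eq_of_lt s'.isLt] at h2
  simp only [add_comm _ s.val, add_comm _ s'.val, Nat.add_mul_div_right _ _ hM,
    Nat.div_eq_of_lt s.isLt, Nat.div_eq_of_lt s'.isLt, zero_add] at h1
  exact ⟨Fin.ext h1, Fin.ext h2⟩

/-- A turn changes only the entry `(s, k)` of the listeners' copies. The sender's own row was
updated before the first turn, whence the alternative `s = m` in the invariant. The hypothesis `hδ`
says that the old value plus the transmitted difference is exactly the new value. -/
theorem IsCommState.afterTurn {c₀ c : Fin M → Memory M K} {W V : Fin M → Fin K → ℚ} {i ρ : ℕ}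
    (h : IsCommState c₀ W V i c) (hρ : ∀ m, (c₀ m).epoch = ρ)
    (hδ : ∀ s k, W s k + ((c₀ s).delta k : ℚ) / 2 ^ quantBits (ρ + 1) = V s k)
    {k : Fin K} {s : Fin M} (hi : k.val * M + s.val = i) :
    IsCommState c₀ W V (i + 1) (afterTurn c k s) := by
  constructor
  · intro m; unfold HMA2B.afterTurn; split_ifs
    · exact h.epoch m
    · exact h.epoch m
  · intro m; unfold HMA2B.afterTurn; split_ifs
    · exact h.G m
    · exact h.G m
  · intro m; unfold HMA2B.afterTurn; split_ifs
    · exact h.delta m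
    · exact h.delta m
  · intro m s' k'
    have hold := h.tilde m s' k'
    by_cases heq : s' = s ∧ k' = k
    · obtain ⟨rfl, rfl⟩ := heq
      rw [if_pos (Or.inr (by omega))]
      unfold HMA2B.afterTurn
      split_ifs with hm
      · rw [hold, if_pos (Or.inl hm.symm)]
      · rw [if_neg (by rintro (h1 | h1); exacts [hm h1.symm, by omega])] at hold
        simp only [Memory.learn, Function.update_self, hold, h.delta, h.epoch, hρ, hδ]
    · have hne : k'.val * M + s'.val ≠ i := fun h1 => heq
        ⟨(turn_index_inj (h1.trans hi.symm)).2, (turn_index_inj (h1.trans hi.symm)).1⟩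
      have hlt : (k'.val * M + s'.val < i + 1) ↔ (k'.val * M + s'.val < i) := by omega
      simp only [hlt]
      rw [← hold]
      unfold HMA2B.afterTurn
      split_ifs with hm
      · rfl
      · simp only [Memory.learn]
        by_cases hs : s' = s
        · subst hs
          rw [Function.update_self, Function.update_of_ne (fun h1 => heq ⟨rfl, h1⟩)]
        · rw [Function.update_of_ne hs]

theorem endTurn_of_lt (m : Fin M) (s : Memory M K) {i : ℕ} (hi : i < K * M)
    (hi' : i + 1 < K * M) :
    s.endTurn hMK T₀ m (Fin.divNat ⟨i, hi⟩) (Fin.modNat ⟨i, hi⟩) =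
      s.startTurn m (Fin.divNat ⟨i + 1, hi'⟩) (Fin.modNat ⟨i + 1, hi'⟩) := by
  have hM := m.pos
  have hdm := Nat.div_add_mod i M
  have hml := Nat.mod_lt i hM
  unfold Memory.endTurn
  by_cases h : i % M + 1 < M
  · have h1 : (i + 1) / M = i / M := by
      rw [Nat.div_eq_iff hM]
      rw [mul_comm] at hdm; constructor <;> omega
    have h2 : (i + 1) % M = i % M + 1 := by
      have := Nat.div_add_mod (i + 1) M
      rw [h1] at this; omega
    rw [dif_pos (show (Fin.modNat ⟨i, hi⟩ : Fin M).val + 1 < M from h)]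
    congr 1
    · exact Fin.ext h1.symm
    · exact Fin.ext h2.symm
  · have h0 : i + 1 = M * (i / M + 1) := by rw [mul_add]; omega
    have h1 : (i + 1) / M = i / M + 1 := by rw [h0, Nat.mul_div_cancel_left _ hM]
    have h2 : (i + 1) % M = 0 := by rw [h0, Nat.mul_mod_right]
    have h3 : i / M + 1 < K := by
      rw [← h1, Nat.div_lt_iff_lt_mul hM]; exact hi'
    rw [dif_neg (show ¬ (Fin.modNat ⟨i, hi⟩ : Fin M).val + 1 < M from h),
      dif_pos (show (Fin.divNat ⟨i, hi⟩ : Fin K).val + 1 < K from h3)]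
    congr 1
    · exact Fin.ext h1.symm
    · exact Fin.ext h2.symm

theorem endTurn_of_eq (m : Fin M) (s : Memory M K) {i : ℕ} (hi : i < K * M)
    (hi' : i + 1 = K * M) :
    s.endTurn hMK T₀ m (Fin.divNat ⟨i, hi⟩) (Fin.modNat ⟨i, hi⟩) = s.nextEpoch hMK T₀ := by
  have hM := m.pos
  have hdm := Nat.div_add_mod i M
  have hml := Nat.mod_lt i hM
  have h1 : (i + 1) / M = K := by rw [hi', Nat.mul_div_cancel _ hM]
  have h2 : ¬ i % M + 1 < M := by
    intro h
    have h3 : (i + 1) / M = i / M := by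
      rw [Nat.div_eq_iff hM]
      rw [mul_comm] at hdm; constructor <;> omega
    have h4 : i / M < K := by rw [Nat.div_lt_iff_lt_mul hM]; exact hi
    omega
  have h0 : i + 1 = M * (i / M + 1) := by rw [mul_add]; omega
  have h3 : ¬ i / M + 1 < K := by
    rw [h0, Nat.mul_div_cancel_left _ hM] at h1; omega
  unfold Memory.endTurn
  rw [dif_neg (show ¬ (Fin.modNat ⟨i, hi⟩ : Fin M).val + 1 < M from h2),
    dif_neg (show ¬ (Fin.divNat ⟨i, hi⟩ : Fin K).val + 1 < K from h3)]

/-- The `K * M` turns are concatenated, the invariant `IsCommState` being carried from one to the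
next. The rounds of a turn depend on the content sent, so turn `i` starts after the sum of the
earlier lengths. -/
theorem run_comm (x : ℕ → Fin M → Fin K → Bool) (hM : 2 ≤ M) {c₀ : Fin M → Memory M K}
    {W V : Fin M → Fin K → ℚ} {G : Fin M ↪ Fin K} {ρ t : ℕ} (hρ : ∀ m, (c₀ m).epoch = ρ)
    (hG : ∀ m, (c₀ m).G = G)
    (hδ : ∀ s k, W s k + ((c₀ s).delta k : ℚ) / 2 ^ quantBits (ρ + 1) = V s k)
    (htilde : ∀ m s k, (c₀ m).tilde s k = if s = m then V s k else W s k)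
    (hrun : run hMK T₀ x t = fun m =>
      (c₀ m).startTurn m ⟨0, Nat.zero_lt_of_lt hMK⟩ ⟨0, m.pos⟩) :
    (∀ j < (M - 1) * ∑ s, ∑ k, (bitString ((c₀ s).delta k)).length,
        IsSync G (run hMK T₀ x (t + j))) ∧
      ∃ c : Fin M → Memory M K, (∀ m, (c m).epoch = ρ) ∧ (∀ m, (c m).tilde = V) ∧
        run hMK T₀ x (t + (M - 1) * ∑ s, ∑ k, (bitString ((c₀ s).delta k)).length) =
          fun m => (c m).nextEpoch hMK T₀ := by
  set len : Fin (K * M) → ℕ := fun i =>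
    (M - 1) * (bitString ((c₀ i.modNat).delta i.divNat)).length with hlen
  have hsum : (M - 1) * ∑ s, ∑ k, (bitString ((c₀ s).delta k)).length = ∑ i, len i := by
    rw [Finset.sum_comm, ← Fintype.sum_prod_type', Finset.mul_sum]
    refine Fintype.sum_equiv finProdFinEquiv _ _ fun p => ?_
    rw [hlen]
    have h1 := finProdFinEquiv.symm_apply_apply p
    have h2 : (finProdFinEquiv p).divNat = p.1 := congrArg Prod.fst h1
    have h3 : (finProdFinEquiv p).modNat = p.2 := congrArg Prod.snd h1
    simp only [h2, h3]
  have hKM : 0 < K * M := Nat.mul_pos (by omega) (by omega)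
  set len' : ℕ → ℕ := fun i => if h : i < K * M then len ⟨i, h⟩ else 0 with hlen'
  have hsum' : ∑ i, len i = ∑ i ∈ Finset.range (K * M), len' i := by
    rw [Finset.sum_range]
    exact Finset.sum_congr rfl fun i _ => by simp [hlen']
  have key : ∀ i (hi : i ≤ K * M), ∃ c, IsCommState c₀ W V i c ∧
      (∀ j < ∑ i' ∈ Finset.range i, len' i', IsSync G (run hMK T₀ x (t + j))) ∧
      run hMK T₀ x (t + ∑ i' ∈ Finset.range i, len' i') = fun m =>
        if h : i < K * M then (c m).startTurn m (Fin.divNat ⟨i, h⟩) (Fin.modNat ⟨i, h⟩)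
        else (c m).nextEpoch hMK T₀ := by
    intro i
    induction i with
    | zero =>
      intro _
      refine ⟨c₀, ⟨fun _ => rfl, fun _ => rfl, fun _ => rfl, fun m s k => by simp [htilde]⟩,
        fun j hj => by simp at hj, ?_⟩
      rw [Finset.sum_range_zero, add_zero, hrun]
      funext m
      rw [dif_pos hKM]
      congr 1
      exact Fin.ext (by simp [Fin.divNat])
    | succ i ih =>
      intro hi
      obtain ⟨c, hc, hs, hr⟩ := ih (by omega)
      have hi' : i < K * M := by omega
      have hr' : run hMK T₀ x (t + ∑ i' ∈ Finset.range i, len' i') = fun m =>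
          (c m).startTurn m (Fin.divNat ⟨i, hi'⟩) (Fin.modNat ⟨i, hi'⟩) := by
        rw [hr]; funext m; rw [dif_pos hi']
      have hcG : ∀ m, (c m).G = G := fun m => by rw [hc.G, hG]
      obtain ⟨h1, h2⟩ := run_startTurn hMK T₀ x hcG hM _ hr'
      have hl : (M - 1) * (bitString ((c (Fin.modNat ⟨i, hi'⟩)).delta
          (Fin.divNat ⟨i, hi'⟩))).length = len' i := by
        simp only [hlen', hlen, dif_pos hi', hc.delta]
      rw [hl] at h1 h2
      have hidx : (Fin.divNat ⟨i, hi'⟩ : Fin K).val * M + (Fin.modNat ⟨i, hi'⟩ : Fin M).val = i :=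
        Nat.div_add_mod' i M
      refine ⟨_, hc.afterTurn hρ hδ hidx, fun j hj => ?_, ?_⟩
      · rw [Finset.sum_range_succ] at hj
        by_cases hj' : j < ∑ i' ∈ Finset.range i, len' i'
        · exact hs j hj'
        · have := h1 (j - ∑ i' ∈ Finset.range i, len' i') (by omega)
          rwa [show t + ∑ i' ∈ Finset.range i, len' i' + (j - ∑ i' ∈ Finset.range i, len' i') =
            t + j by omega] at this
      · rw [Finset.sum_range_succ, ← add_assoc, h2]
        funext m
        split_ifs with h
        · exact endTurn_of_lt hMK T₀ m _ hi' h
        · exact endTurn_of_eq hMK T₀ m _ hi' (by omega)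
  obtain ⟨c, hc, hs, hr⟩ := key (K * M) le_rfl
  rw [hsum, hsum']
  refine ⟨hs, c, fun m => by rw [hc.epoch, hρ], fun m => ?_, ?_⟩
  · funext s k
    rw [hc.tilde, if_pos]
    right
    calc k.val * M + s.val < k.val * M + M := by omega
      _ = (k.val + 1) * M := by ring
      _ ≤ K * M := Nat.mul_le_mul_right _ k.isLt
  · rw [hr]; funext m; rw [dif_neg (lt_irrefl _)]

/-! ### Statistics -/

/-- The number of observations of arm `k` that an agent with memory `s` makes in round `t`. -/
noncomputable def weight (m : Fin M) (t : ℕ) (k : Fin K) (s : Memory M K) : ℕ :=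
  match s.phase with
  | .explore _ => (if k = s.G m then 1 else 0) + (if coveringArm hMK m t = k then 1 else 0)
  | _ => 0

theorem weight_le_two (m : Fin M) (t : ℕ) (k : Fin K) (s : Memory M K) :
    weight hMK m t k s ≤ 2 := by
  unfold weight
  split
  · split_ifs <;> omega
  · omega

theorem weight_of_isComm {m : Fin M} {t : ℕ} {k : Fin K} {s : Memory M K} (h : s.phase.IsComm) :
    weight hMK m t k s = 0 := by
  unfold weight
  split
  · rename_i h2; rw [h2] at h; exact h.elim
  · rfl

theorem endTurn_NS (m : Fin M) (k : Fin K) (s' : Fin M) (s : Memory M K) :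
    (s.endTurn hMK T₀ m k s').N = s.N ∧ (s.endTurn hMK T₀ m k s').S = s.S := by
  unfold Memory.endTurn
  split_ifs <;> exact ⟨rfl, rfl⟩

theorem beginComm_NS (m : Fin M) (s : Memory M K) :
    (s.beginComm hMK T₀ m).N = s.N ∧ (s.beginComm hMK T₀ m).S = s.S := by
  unfold Memory.beginComm
  split_ifs <;> exact ⟨rfl, rfl⟩

theorem step_explore_NS (m : Fin M) (t : ℕ) (s : Memory M K) (o : Observation) {j : ℕ}
    (h : s.phase = .explore j) :
    (s.step hMK T₀ m t o).N = (s.record hMK m t o).N ∧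
      (s.step hMK T₀ m t o).S = (s.record hMK m t o).S := by
  unfold Memory.step
  simp only [h]
  split_ifs
  · exact ⟨rfl, rfl⟩
  · exact beginComm_NS hMK T₀ m _

theorem step_other_NS (m : Fin M) (t : ℕ) (s : Memory M K) (o : Observation)
    (h : ∀ j, s.phase ≠ .explore j) :
    (s.step hMK T₀ m t o).N = s.N ∧ (s.step hMK T₀ m t o).S = s.S := by
  unfold Memory.step
  split
  · rename_i h2; exact absurd h2 (h _)
  · split_ifs
    · exact endTurn_NS hMK T₀ m _ _ _
    · exact ⟨rfl, rfl⟩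
  · split_ifs
    · exact ⟨rfl, rfl⟩
    · split
      · exact ⟨rfl, rfl⟩
      · simp only []
        split_ifs
        · exact endTurn_NS hMK T₀ m _ _ (s.learn _ _ _)
        · exact ⟨rfl, rfl⟩
  · split_ifs
    · exact endTurn_NS hMK T₀ m _ _ _
    · exact ⟨rfl, rfl⟩
  · exact ⟨rfl, rfl⟩

theorem pull_of_explore {m : Fin M} {s : Memory M K} {j : ℕ} (h : s.phase = .explore j) :
    s.pull m = s.G m := by
  unfold Memory.pull; simp only [h]

theorem hintArm_of_explore {m : Fin M} {t : ℕ} {s : Memory M K} {j : ℕ}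
    (h : s.phase = .explore j) : s.hintArm hMK m t = some (coveringArm hMK m t) := by
  unfold Memory.hintArm; simp only [h]

theorem weight_of_not_explore {m : Fin M} {t : ℕ} {k : Fin K} {s : Memory M K}
    (h : ∀ j, s.phase ≠ .explore j) : weight hMK m t k s = 0 := by
  unfold weight
  split
  · rename_i h2; exact absurd h2 (h _)
  · rfl

/-- Evolution of the number of observations. -/
theorem run_succ_N (x : ℕ → Fin M → Fin K → Bool) (t : ℕ) (m : Fin M) (k : Fin K) :
    (run hMK T₀ x (t + 1) m).N k =
      (run hMK T₀ x t m).N k + weight hMK m t k (run hMK T₀ x t m) := by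
  rw [run_succ]
  by_cases h : ∃ j, (run hMK T₀ x t m).phase = .explore j
  · obtain ⟨j, hj⟩ := h
    rw [(step_explore_NS hMK T₀ m t _ _ hj).1]
    simp only [Memory.record, pull_of_explore hj, hintArm_of_explore hMK hj, weight, hj,
      Option.some.injEq, add_assoc]
  · push Not at h
    rw [(step_other_NS hMK T₀ m t _ _ h).1, weight_of_not_explore hMK h, add_zero]

/-- Evolution of the number of successes, in the absence of collisions during exploration. -/
theorem run_succ_S (x : ℕ → Fin M → Fin K → Bool) (t : ℕ) (m : Fin M) (k : Fin K)
    (hcol : ∀ j, (run hMK T₀ x t m).phase = .explore j → ¬ Collides (pulls (run hMK T₀ x t)) m) :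
    (run hMK T₀ x (t + 1) m).S k = (run hMK T₀ x t m).S k +
      weight hMK m t k (run hMK T₀ x t m) * (if x t m k = true then 1 else 0) := by
  rw [run_succ]
  by_cases h : ∃ j, (run hMK T₀ x t m).phase = .explore j
  · obtain ⟨j, hj⟩ := h
    rw [(step_explore_NS hMK T₀ m t _ _ hj).2]
    have hp : pulls (run hMK T₀ x t) m = (run hMK T₀ x t m).G m := pull_of_explore hj
    simp only [Memory.record, pull_of_explore hj, hintArm_of_explore hMK hj, weight, hj,
      Option.some.injEq, observe, hp, hcol j hj, Option.map_some, decide_false, Bool.not_false,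
      Bool.and_true, add_mul, add_assoc]
    -- A pull and a hint of the same arm in one round read the same reward `x t m k`, so both
    -- contributions are multiples of it.
    congr 2
    · by_cases h1 : k = (run hMK T₀ x t m).G m
      · subst h1; simp
      · simp [h1]
    · by_cases h1 : coveringArm hMK m t = k
      · subst h1; simp
      · simp [h1]
  · push Not at h
    rw [(step_other_NS hMK T₀ m t _ _ h).2, weight_of_not_explore hMK h, zero_mul, add_zero]

/-! ### Exploration phases -/

/-- All agents are in epoch `ρ`, share the statistics `W`, and pull the matching computed
from them. -/
structure IsEpoch (ρ : ℕ) (W : Fin M → Fin K → ℚ) (σ : Fin M → Memory M K) : Prop where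
  epoch : ∀ m, (σ m).epoch = ρ
  G : ∀ m, (σ m).G = hungarian hMK W
  tilde : ∀ m, (σ m).tilde = W

theorem run_explore (x : ℕ → Fin M → Fin K → Bool) {ρ t : ℕ} {W : Fin M → Fin K → ℚ}
    (h : IsEpoch hMK ρ W (run hMK T₀ x t)) (h0 : ∀ m, (run hMK T₀ x t m).phase = .explore 0)
    (j : ℕ) (hj : j < K) : IsEpoch hMK ρ W (run hMK T₀ x (t + j)) ∧
      ∀ m, (run hMK T₀ x (t + j) m).phase = .explore j := by
  induction j with
  | zero => exact ⟨h, h0⟩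
  | succ j ih =>
    obtain ⟨ih1, ih2⟩ := ih (by omega)
    have hs : ∀ m, run hMK T₀ x (t + (j + 1)) m = { (run hMK T₀ x (t + j) m).record hMK m (t + j)
        (observe hMK (run hMK T₀ x (t + j)) (t + j) (x (t + j)) m) with
          phase := .explore (j + 1) } := by
      intro m
      rw [← add_assoc, run_succ]
      conv_lhs => unfold Memory.step
      simp only [ih2 m, if_pos hj]
    refine ⟨⟨fun m => ?_, fun m => ?_, fun m => ?_⟩, fun m => ?_⟩
    · rw [hs]; exact ih1.epoch m
    · rw [hs]; exact ih1.G m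
    · rw [hs]; exact ih1.tilde m
    · rw [hs]

/-- A number on a coarse binary grid also lies on every finer one, so differences of statistics of
successive epochs are integers in the finer unit. -/
theorem quantize_mul (b : ℕ) (q : ℚ) {b' : ℕ} (h : b ≤ b') :
    ∃ z : ℤ, quantize b q * 2 ^ b' = z := by
  obtain ⟨e, rfl⟩ := Nat.exists_eq_add_of_le h
  refine ⟨⌈q * 2 ^ b⌉ * 2 ^ e, ?_⟩
  unfold quantize
  push_cast
  rw [pow_add]
  field_simp

/-- One epoch: exploration, then communication. -/
theorem run_epoch (x : ℕ → Fin M → Fin K → Bool) (hM : 1 ≤ M) {ρ t : ℕ} {W V : Fin M → Fin K → ℚ}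
    {D : ℕ}
    (h : IsEpoch hMK ρ W (run hMK T₀ x t)) (h0 : ∀ m, (run hMK T₀ x t m).phase = .explore 0)
    (hW : ∀ m k, ∃ z : ℤ, W m k * 2 ^ quantBits (ρ + 1) = z)
    (hV : V = fun m k => quantize (quantBits (ρ + 1)) ((run hMK T₀ x (t + K) m).mean k))
    (hD : D = (M - 1) * ∑ s, ∑ k, (bitString ((run hMK T₀ x (t + K) s).delta k)).length) :
    (∀ s k, (run hMK T₀ x (t + K) s).delta k =
      ⌊(V s k - W s k) * 2 ^ quantBits (ρ + 1)⌋) ∧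
    (∀ j < D, IsSync (hungarian hMK W) (run hMK T₀ x (t + K + j))) ∧
    IsEpoch hMK (ρ + 1) V (run hMK T₀ x (t + K + D)) ∧
    ∀ m, (run hMK T₀ x (t + K + D) m).phase =
      if (((ρ + 1) * K : ℕ) : ℝ) < T₀ then .explore 0 else .exploit := by
  obtain ⟨h1, h2⟩ := run_explore hMK T₀ x h h0 (K - 1) (by omega)
  have htK : t + K = t + (K - 1) + 1 := by omega
  set r : Fin M → Memory M K := fun m => (run hMK T₀ x (t + (K - 1)) m).record hMK m (t + (K - 1))
        (observe hMK (run hMK T₀ x (t + (K - 1))) (t + (K - 1)) (x (t + (K - 1))) m) with hr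
  have hs : ∀ m, run hMK T₀ x (t + K) m = (r m).beginComm hMK T₀ m := by
    intro m
    rw [htK, run_succ]
    conv_lhs => unfold Memory.step
    simp only [h2 m, if_neg (show ¬ K - 1 + 1 < K by omega), hr]
  have hmean : ∀ m k, (run hMK T₀ x (t + K) m).mean k = (r m).mean k := by
    intro m k
    rw [hs]
    unfold Memory.mean
    rw [(beginComm_NS hMK T₀ m (r m)).1, (beginComm_NS hMK T₀ m (r m)).2]
  have hre : ∀ m, (r m).epoch = ρ := fun m => h1.epoch m
  have hrG : ∀ m, (r m).G = hungarian hMK W := fun m => h1.G m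
  have hrt : ∀ m, (r m).tilde = W := fun m => h1.tilde m
  simp only [hmean] at hV
  set c₀ : Fin M → Memory M K := fun m => { r m with
      delta := fun k => ⌊(V m k - W m k) * 2 ^ quantBits (ρ + 1)⌋
      tilde := Function.update W m (V m) } with hc₀
  have hbegin : ∀ m, run hMK T₀ x (t + K) m = if M = 1 then (c₀ m).nextEpoch hMK T₀
      else (c₀ m).startTurn m ⟨0, Nat.zero_lt_of_lt hMK⟩ ⟨0, m.pos⟩ := by
    intro m
    rw [hs]
    simp only [Memory.beginComm, hre, hrt, hc₀, hV]
  have hdelta : ∀ m, (run hMK T₀ x (t + K) m).delta = (c₀ m).delta := by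
    intro m
    rw [hbegin]
    split_ifs <;> rfl
  -- Both statistics lie on the new grid, so the floor in `delta` loses nothing.
  have hWV : ∀ s k, W s k + ((c₀ s).delta k : ℚ) / 2 ^ quantBits (ρ + 1) = V s k := by
    intro s k
    obtain ⟨z, hz⟩ := hW s k
    obtain ⟨z', hz'⟩ := quantize_mul (quantBits (ρ + 1)) ((r s).mean k) le_rfl
    have hz'' : V s k * 2 ^ quantBits (ρ + 1) = z' := by rw [hV]; exact hz'
    have : (c₀ s).delta k = z' - z := by
      simp only [hc₀]
      rw [sub_mul, hz, hz'', ← Int.cast_sub, Int.floor_intCast]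
    rw [this]
    push_cast
    rw [← hz, ← hz'']
    field_simp
    ring
  have htilde : ∀ m s k, (c₀ m).tilde s k = if s = m then V s k else W s k := by
    intro m s k
    simp only [hc₀]
    split_ifs with hsm
    · subst hsm; rw [Function.update_self]
    · rw [Function.update_of_ne hsm]
  have hfin : (∀ j < D, IsSync (hungarian hMK W) (run hMK T₀ x (t + K + j))) ∧
      ∃ c : Fin M → Memory M K, (∀ m, (c m).epoch = ρ) ∧ (∀ m, (c m).tilde = V) ∧
        run hMK T₀ x (t + K + D) = fun m => (c m).nextEpoch hMK T₀ := by
    by_cases hM1 : M = 1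
    · have hD0 : D = 0 := by rw [hD, Nat.sub_eq_zero_of_le hM1.le, zero_mul]
      refine ⟨fun j hj => by omega, c₀, hre, fun m => ?_, ?_⟩
      · funext s k
        -- A single agent's own row is the whole matrix.
        rw [htilde, if_pos]
        subst hM1
        exact Subsingleton.elim _ _
      · rw [hD0, add_zero]; funext m; rw [hbegin, if_pos hM1]
    · simp only [hdelta] at hD
      rw [hD]
      refine run_comm hMK T₀ x (by omega) hre hrG hWV htilde ?_
      funext m
      rw [hbegin, if_neg hM1]
  refine ⟨fun s k => by rw [hdelta], hfin.1, ?_, ?_⟩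
  · obtain ⟨c, hc1, hc2, hc3⟩ := hfin.2
    rw [hc3]
    exact ⟨fun m => by simp [Memory.nextEpoch, hc1], fun m => by simp [Memory.nextEpoch, hc2],
      fun m => by simp [Memory.nextEpoch, hc2]⟩
  · obtain ⟨c, hc1, hc2, hc3⟩ := hfin.2
    intro m
    rw [hc3]
    simp only [Memory.nextEpoch, hc1]

end HMA2B

namespace HMA2B

variable {M K : ℕ} (hMK : M < K) (T₀ : ℝ) (x : ℕ → Fin M → Fin K → Bool)

/-! ### The schedule of the joint run -/

/-- The number of communication rounds after an exploration phase that begins in round `t`. -/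
noncomputable def commLength (t : ℕ) : ℕ :=
  (M - 1) * ∑ s, ∑ k, (bitString ((run hMK T₀ x (t + K) s).delta k)).length

/-- The first round of epoch `ρ`. -/
noncomputable def epochStart : ℕ → ℕ
  | 0 => 0
  | ρ + 1 => epochStart ρ + K + commLength hMK T₀ x (epochStart ρ)

/-- The quantized statistics shared in epoch `ρ`. -/
noncomputable def shared : ℕ → Fin M → Fin K → ℚ
  | 0 => 0
  | ρ + 1 => fun m k => quantize (quantBits (ρ + 1))
      ((run hMK T₀ x (epochStart hMK T₀ x ρ + K) m).mean k)

/-- There are exactly `E` epochs with exploration. -/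
def IsEpochCount (K : ℕ) (T₀ : ℝ) (E : ℕ) : Prop :=
  0 < E ∧ ∀ ρ : ℕ, (((ρ + 1) * K : ℕ) : ℝ) < T₀ ↔ ρ + 1 < E

theorem quantBits_mono {a b : ℕ} (ha : 1 ≤ a) (hab : a ≤ b) : quantBits a ≤ quantBits b := by
  unfold quantBits
  apply Nat.ceil_mono
  have ha' : (0 : ℝ) < a := by exact_mod_cast ha
  have : Real.logb 2 a ≤ Real.logb 2 b :=
    Real.logb_le_logb_of_le (by norm_num) ha' (by exact_mod_cast hab)
  linarith

theorem shared_mul_pow (ρ : ℕ) (m : Fin M) (k : Fin K) :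
    ∃ z : ℤ, shared hMK T₀ x ρ m k * 2 ^ quantBits (ρ + 1) = z := by
  cases ρ with
  | zero => exact ⟨0, by simp [shared]⟩
  | succ ρ => exact quantize_mul _ _ (quantBits_mono (by omega) (by omega))

variable {T₀} {E : ℕ}

theorem isEpoch_epochStart (hM : 1 ≤ M) (hE : IsEpochCount K T₀ E) (ρ : ℕ) (hρ : ρ ≤ E) :
    IsEpoch hMK ρ (shared hMK T₀ x ρ) (run hMK T₀ x (epochStart hMK T₀ x ρ)) ∧
      ∀ m, (run hMK T₀ x (epochStart hMK T₀ x ρ) m).phase =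
        if ρ < E then .explore 0 else .exploit := by
  induction ρ with
  | zero =>
    refine ⟨⟨fun m => rfl, fun m => rfl, fun m => rfl⟩, fun m => ?_⟩
    rw [if_pos hE.1]; rfl
  | succ ρ ih =>
    obtain ⟨h1, h2⟩ := ih (by omega)
    simp only [if_pos (show ρ < E by omega)] at h2
    have := run_epoch hMK T₀ x hM h1 h2 (shared_mul_pow hMK T₀ x ρ) (V := shared hMK T₀ x (ρ + 1))
      rfl rfl
    simp only [hE.2 ρ] at this
    exact this.2.2

section Epochs

variable (hM : 1 ≤ M) (hE : IsEpochCount K T₀ E)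
include hM hE

theorem epoch_explore {ρ : ℕ} (hρ : ρ < E) {j : ℕ} (hj : j < K) :
    IsEpoch hMK ρ (shared hMK T₀ x ρ) (run hMK T₀ x (epochStart hMK T₀ x ρ + j)) ∧
      ∀ m, (run hMK T₀ x (epochStart hMK T₀ x ρ + j) m).phase = .explore j := by
  obtain ⟨h1, h2⟩ := isEpoch_epochStart hMK x hM hE ρ hρ.le
  simp only [if_pos hρ] at h2
  exact run_explore hMK T₀ x h1 h2 j hj

theorem epoch_comm {ρ : ℕ} (hρ : ρ < E) {j : ℕ}
    (hj : j < commLength hMK T₀ x (epochStart hMK T₀ x ρ)) :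
    IsSync (hungarian hMK (shared hMK T₀ x ρ))
      (run hMK T₀ x (epochStart hMK T₀ x ρ + K + j)) := by
  obtain ⟨h1, h2⟩ := isEpoch_epochStart hMK x hM hE ρ hρ.le
  simp only [if_pos hρ] at h2
  exact (run_epoch hMK T₀ x hM h1 h2 (shared_mul_pow hMK T₀ x ρ) (V := shared hMK T₀ x (ρ + 1))
    rfl rfl).2.1 j hj

theorem epoch_delta {ρ : ℕ} (hρ : ρ < E) (s : Fin M) (k : Fin K) :
    (run hMK T₀ x (epochStart hMK T₀ x ρ + K) s).delta k =
      ⌊(shared hMK T₀ x (ρ + 1) s k - shared hMK T₀ x ρ s k) * 2 ^ quantBits (ρ + 1)⌋ := by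
  obtain ⟨h1, h2⟩ := isEpoch_epochStart hMK x hM hE ρ hρ.le
  simp only [if_pos hρ] at h2
  exact (run_epoch hMK T₀ x hM h1 h2 (shared_mul_pow hMK T₀ x ρ) (V := shared hMK T₀ x (ρ + 1))
    rfl rfl).1 s k

theorem run_exploit (j : ℕ) :
    IsEpoch hMK E (shared hMK T₀ x E) (run hMK T₀ x (epochStart hMK T₀ x E + j)) ∧
      ∀ m, (run hMK T₀ x (epochStart hMK T₀ x E + j) m).phase = .exploit := by
  induction j with
  | zero =>
    obtain ⟨h1, h2⟩ := isEpoch_epochStart hMK x hM hE E le_rfl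
    simp only [lt_irrefl, if_false] at h2
    exact ⟨h1, h2⟩
  | succ j ih =>
    have : run hMK T₀ x (epochStart hMK T₀ x E + (j + 1)) =
        run hMK T₀ x (epochStart hMK T₀ x E + j) := by
      funext m
      rw [← add_assoc, run_succ]
      conv_lhs => unfold Memory.step
      simp only [ih.2 m]
    rw [this]; exact ih

end Epochs

/-- Every round belongs to an exploration phase, a communication phase or exploitation. -/
theorem round_cases (E t : ℕ) :
    (∃ ρ < E, ∃ j < K, t = epochStart hMK T₀ x ρ + j) ∨
    (∃ ρ < E, ∃ j < commLength hMK T₀ x (epochStart hMK T₀ x ρ),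
      t = epochStart hMK T₀ x ρ + K + j) ∨ ∃ j, t = epochStart hMK T₀ x E + j := by
  induction E with
  | zero => exact Or.inr (Or.inr ⟨t, by simp [epochStart]⟩)
  | succ E ih =>
    rcases ih with ⟨ρ, h1, j, h2⟩ | ⟨ρ, h1, j, h2⟩ | ⟨j, hj⟩
    · exact Or.inl ⟨ρ, by omega, j, h2⟩
    · exact Or.inr (Or.inl ⟨ρ, by omega, j, h2⟩)
    · by_cases h1 : j < K
      · exact Or.inl ⟨E, by omega, j, h1, hj⟩
      · by_cases h2 : j - K < commLength hMK T₀ x (epochStart hMK T₀ x E)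
        · exact Or.inr (Or.inl ⟨E, by omega, j - K, h2, by omega⟩)
        · refine Or.inr (Or.inr ⟨j - K - commLength hMK T₀ x (epochStart hMK T₀ x E), ?_⟩)
          simp only [epochStart]
          omega

/-- Splitting a sum over rounds along the schedule. -/
theorem sum_rounds_le (f : ℕ → ℝ) (hf : ∀ t, 0 ≤ f t) (E T : ℕ) :
    ∑ t ∈ Finset.range T, f t ≤
      (∑ ρ ∈ Finset.range E, (∑ j ∈ Finset.range K, f (epochStart hMK T₀ x ρ + j) +
        ∑ j ∈ Finset.range (commLength hMK T₀ x (epochStart hMK T₀ x ρ)),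
          f (epochStart hMK T₀ x ρ + K + j))) +
      ∑ j ∈ Finset.range T, f (epochStart hMK T₀ x E + j) := by
  have h1 : ∀ E, ∑ ρ ∈ Finset.range E, (∑ j ∈ Finset.range K, f (epochStart hMK T₀ x ρ + j) +
        ∑ j ∈ Finset.range (commLength hMK T₀ x (epochStart hMK T₀ x ρ)),
          f (epochStart hMK T₀ x ρ + K + j)) =
      ∑ t ∈ Finset.range (epochStart hMK T₀ x E), f t := by
    intro E
    induction E with
    | zero => simp [epochStart]
    | succ E ih =>
      rw [Finset.sum_range_succ, ih]
      conv_rhs => rw [epochStart, Finset.sum_range_add, Finset.sum_range_add]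
      rw [add_assoc]
  -- The epochs tile the rounds before `epochStart E`; adding `T` further rounds covers the first
  -- `T` in any case, and `f ≥ 0` absorbs the excess. This avoids locating the cut-off within the
  -- schedule.
  rw [h1, ← Finset.sum_range_add]
  exact Finset.sum_le_sum_of_subset_of_nonneg
    (Finset.range_subset_range.2 (Nat.le_add_left _ _)) fun _ _ _ => hf _

/-! ### Statistics along the schedule -/

theorem not_collides_of_injective {g : Fin M → Fin K} (hg : Function.Injective g) (m : Fin M) :
    ¬ Collides g m := fun ⟨_, h1, h2⟩ => h1 (hg h2)

theorem IsEpoch.pulls_eq {ρ : ℕ} {W : Fin M → Fin K → ℚ} {σ : Fin M → Memory M K}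
    (h : IsEpoch hMK ρ W σ) (hσ : ∀ m, (∃ j, (σ m).phase = .explore j) ∨ (σ m).phase = .exploit) :
    pulls σ = hungarian hMK W := by
  funext m
  unfold pulls Memory.pull
  rcases hσ m with ⟨j, hj⟩ | hj <;> simp only [hj, h.G]

theorem run_N_add (t n : ℕ) (m : Fin M) (k : Fin K) :
    (run hMK T₀ x (t + n) m).N k = (run hMK T₀ x t m).N k +
      ∑ j ∈ Finset.range n, weight hMK m (t + j) k (run hMK T₀ x (t + j) m) := by
  induction n with
  | zero => simp
  | succ n ih => rw [← add_assoc, run_succ_N, ih, Finset.sum_range_succ, add_assoc]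

/-- Successes and failures both only accumulate; the second inequality is the monotonicity of `N -
S`, written without subtraction. -/
theorem run_S_le_N (t : ℕ) (m : Fin M) (k : Fin K)
    (hcol : ∀ t m j, (run hMK T₀ x t m).phase = .explore j →
      ¬ Collides (pulls (run hMK T₀ x t)) m) (n : ℕ) :
    (run hMK T₀ x t m).S k ≤ (run hMK T₀ x (t + n) m).S k ∧
    (run hMK T₀ x (t + n) m).S k + (run hMK T₀ x t m).N k ≤
      (run hMK T₀ x t m).S k + (run hMK T₀ x (t + n) m).N k := by
  induction n with
  | zero => simp
  | succ n ih =>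
    rw [← add_assoc, run_succ_N, run_succ_S hMK T₀ x _ m k (hcol _ m)]
    have : weight hMK m (t + n) k (run hMK T₀ x (t + n) m) *
        (if x (t + n) m k = true then 1 else 0) ≤
        weight hMK m (t + n) k (run hMK T₀ x (t + n) m) := by
      split_ifs <;> simp
    omega

/-- Over `K` consecutive rounds the index `m + t + j` runs through all residues modulo `K`. -/
theorem sum_coveringArm (m : Fin M) (t : ℕ) (k : Fin K) :
    ∑ j ∈ Finset.range K, (if coveringArm hMK m (t + j) = k then 1 else 0) = 1 := by
  have hinj : Function.Injective fun j : Fin K => coveringArm hMK m (t + j) := by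
    intro a b h
    have h1 : (m.val + (t + a) % K) % K = (m.val + (t + b) % K) % K := congrArg Fin.val h
    rw [Nat.add_mod_mod, Nat.add_mod_mod] at h1
    have h2 : t + a ≡ t + b [MOD K] := Nat.ModEq.add_left_cancel' _ h1
    have h3 : (a : ℕ) ≡ b [MOD K] := Nat.ModEq.add_left_cancel' _ h2
    exact Fin.ext (Nat.ModEq.eq_of_lt_of_lt h3 a.isLt b.isLt)
  obtain ⟨j₀, hj₀⟩ := (Finite.injective_iff_surjective.1 hinj) k
  rw [Finset.sum_range, Finset.sum_eq_single j₀]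
  · simpa using hj₀
  · intro b _ hb
    rw [if_neg]
    intro h
    exact hb (hinj (h.trans hj₀.symm))
  · simp

section Counts

variable (hM : 1 ≤ M) (hE : IsEpochCount K T₀ E)
include hM hE

theorem not_collides_explore (t : ℕ) (m : Fin M) (j : ℕ)
    (h : (run hMK T₀ x t m).phase = .explore j) : ¬ Collides (pulls (run hMK T₀ x t)) m := by
  rcases round_cases hMK (T₀ := T₀) x E t with ⟨ρ, h1, i, h2, rfl⟩ | ⟨ρ, h1, i, h2, rfl⟩ | ⟨i, rfl⟩
  · have h3 := epoch_explore hMK x hM hE h1 h2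
    rw [h3.1.pulls_eq hMK fun m => Or.inl ⟨i, h3.2 m⟩]
    exact not_collides_of_injective (Function.Embedding.injective _) m
  · have h3 := (epoch_comm hMK x hM hE h1 h2).comm m
    rw [h] at h3
    exact h3.elim
  · have h3 := (run_exploit hMK x hM hE i).2 m
    rw [h] at h3
    cases h3

/-- One hint for every arm, and `K` pulls of the matched arm. -/
theorem run_N_explored {ρ : ℕ} (hρ : ρ < E) (m : Fin M) (k : Fin K) :
    (run hMK T₀ x (epochStart hMK T₀ x ρ + K) m).N k =
      (run hMK T₀ x (epochStart hMK T₀ x ρ) m).N k +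
        (1 + if k = hungarian hMK (shared hMK T₀ x ρ) m then K else 0) := by
  rw [run_N_add]
  congr 1
  have : ∀ j ∈ Finset.range K, weight hMK m (epochStart hMK T₀ x ρ + j) k
      (run hMK T₀ x (epochStart hMK T₀ x ρ + j) m) =
      (if coveringArm hMK m (epochStart hMK T₀ x ρ + j) = k then 1 else 0) +
        if k = hungarian hMK (shared hMK T₀ x ρ) m then 1 else 0 := by
    intro j hj
    have h3 := epoch_explore hMK x hM hE hρ (Finset.mem_range.1 hj)
    simp only [weight, h3.2 m, h3.1.G m]
    rw [add_comm]
  rw [Finset.sum_congr rfl this, Finset.sum_add_distrib, sum_coveringArm]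
  simp

theorem run_NS_comm {ρ : ℕ} (hρ : ρ < E) (m : Fin M) (k : Fin K) :
    (run hMK T₀ x (epochStart hMK T₀ x (ρ + 1)) m).N k =
      (run hMK T₀ x (epochStart hMK T₀ x ρ + K) m).N k ∧
    (run hMK T₀ x (epochStart hMK T₀ x (ρ + 1)) m).S k =
      (run hMK T₀ x (epochStart hMK T₀ x ρ + K) m).S k := by
  have key : ∀ j ≤ commLength hMK T₀ x (epochStart hMK T₀ x ρ),
      (run hMK T₀ x (epochStart hMK T₀ x ρ + K + j) m).N k =
        (run hMK T₀ x (epochStart hMK T₀ x ρ + K) m).N k ∧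
      (run hMK T₀ x (epochStart hMK T₀ x ρ + K + j) m).S k =
        (run hMK T₀ x (epochStart hMK T₀ x ρ + K) m).S k := by
    intro j
    induction j with
    | zero => intro _; exact ⟨rfl, rfl⟩
    | succ j ih =>
      intro hj
      obtain ⟨ih1, ih2⟩ := ih (by omega)
      have hc := (epoch_comm hMK x hM hE hρ (show j < _ by omega)).comm m
      rw [← add_assoc, run_succ_N,
        run_succ_S hMK T₀ x _ m k (not_collides_explore hMK x hM hE _ m),
        weight_of_isComm hMK hc, zero_mul, add_zero, add_zero]
      exact ⟨ih1, ih2⟩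
  exact key _ le_rfl

theorem le_run_N (ρ : ℕ) (hρ : ρ ≤ E) (m : Fin M) (k : Fin K) :
    ρ ≤ (run hMK T₀ x (epochStart hMK T₀ x ρ) m).N k := by
  induction ρ with
  | zero => exact Nat.zero_le _
  | succ ρ ih =>
    rw [(run_NS_comm hMK x hM hE hρ m k).1, run_N_explored hMK x hM hE hρ]
    have := ih (by omega)
    omega

theorem sum_run_N (ρ : ℕ) (hρ : ρ ≤ E) (m : Fin M) :
    ∑ k, (run hMK T₀ x (epochStart hMK T₀ x ρ) m).N k = 2 * K * ρ := by
  induction ρ with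
  | zero => simp [epochStart, run, Memory.init]
  | succ ρ ih =>
    simp only [(run_NS_comm hMK x hM hE hρ m _).1, run_N_explored hMK x hM hE hρ]
    rw [Finset.sum_add_distrib, Finset.sum_add_distrib, ih (by omega)]
    simp
    ring

end Counts

end HMA2B

namespace HMA2B

variable {M K : ℕ}

/-! ### Utilities -/

section Utility

variable {μ : Fin M → Fin K → ℝ} {gs : Fin M → Fin K}

theorem utility_of_injective {g : Fin M → Fin K} (hg : Function.Injective g) :
    utility μ g = ∑ m, μ m (g m) :=
  Finset.sum_congr rfl fun m _ => if_neg (not_collides_of_injective hg m)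

theorem utility_nonneg (hμ : ∀ m k, μ m k ∈ Set.Icc (0 : ℝ) 1) (g : Fin M → Fin K) :
    0 ≤ utility μ g := by
  refine Finset.sum_nonneg fun m _ => ?_
  split_ifs
  · exact le_rfl
  · exact (hμ _ _).1

theorem utility_le (hμ : ∀ m k, μ m k ∈ Set.Icc (0 : ℝ) 1) (g : Fin M → Fin K) :
    utility μ g ≤ M := by
  calc utility μ g ≤ ∑ _m : Fin M, (1 : ℝ) := by
        refine Finset.sum_le_sum fun m _ => ?_
        split_ifs
        · exact zero_le_one
        · exact (hμ _ _).2
    _ = M := by simp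

theorem regret_le (hμ : ∀ m k, μ m k ∈ Set.Icc (0 : ℝ) 1) (g : Fin M → Fin K) :
    utility μ gs - utility μ g ≤ M := by
  linarith [utility_le hμ gs, utility_nonneg hμ g]

theorem IsUniqueOptimal.regret_nonneg (hgs : IsUniqueOptimal μ gs) (g : Fin M → Fin K) :
    0 ≤ utility μ gs - utility μ g := by
  by_cases h : g = gs
  · rw [h, sub_self]
  · exact (sub_pos.2 (hgs g h)).le

theorem exists_free_arm (hMK : M < K) (g : Fin M → Fin K) : ∃ k, ∀ m, g m ≠ k := by
  by_contra! h
  have := Fintype.card_le_of_surjective g h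
  simp at this
  omega

/-- Since `K > M`, some arm is free. Moving a colliding agent there creates no collision and lowers
no agent's reward, which would contradict uniqueness. -/
theorem IsUniqueOptimal.injective (hMK : M < K) (hμ : ∀ m k, μ m k ∈ Set.Icc (0 : ℝ) 1)
    (hgs : IsUniqueOptimal μ gs) : Function.Injective gs := by
  intro a b hab
  by_contra hne
  obtain ⟨k, hk⟩ := exists_free_arm hMK gs
  have hg : Function.update gs a k ≠ gs := fun h => hk a (by rw [← h, Function.update_self])
  refine absurd (hgs _ hg) (not_lt.2 (Finset.sum_le_sum fun m _ => ?_))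
  by_cases hm : m = a
  · subst hm
    rw [if_pos ⟨b, Ne.symm hne, hab.symm⟩]
    split_ifs
    · exact le_rfl
    · exact (hμ _ _).1
  · by_cases hc : Collides gs m
    · rw [if_pos hc]
      split_ifs
      · exact le_rfl
      · exact (hμ _ _).1
    · rw [if_neg hc, if_neg, Function.update_of_ne hm]
      rintro ⟨m', h1, h2⟩
      rw [Function.update_of_ne hm] at h2
      by_cases hm' : m' = a
      · subst hm'
        rw [Function.update_self] at h2
        exact hk m h2.symm
      · rw [Function.update_of_ne hm'] at h2
        exact hc ⟨m', h1, h2⟩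

theorem minGap_le {g : Fin M → Fin K} (hg : g ≠ gs) :
    minGap μ gs ≤ utility μ gs - utility μ g :=
  csInf_le (Set.Finite.bddBelow (Set.toFinite _)) ⟨g, hg, rfl⟩

/-- Moving one agent of the optimal matching to a free arm changes a single term of the utility. -/
theorem minGap_le_one (hM : 1 ≤ M) (hMK : M < K) (hμ : ∀ m k, μ m k ∈ Set.Icc (0 : ℝ) 1)
    (hgs : IsUniqueOptimal μ gs) : minGap μ gs ≤ 1 := by
  obtain ⟨k, hk⟩ := exists_free_arm hMK gs
  have hinj := hgs.injective hMK hμ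
  set a : Fin M := ⟨0, hM⟩
  have hg : Function.update gs a k ≠ gs := fun h => hk a (by rw [← h, Function.update_self])
  refine (minGap_le hg).trans ?_
  have hinj' : Function.Injective (Function.update gs a k) := by
    intro m m' h
    by_cases h1 : m = a <;> by_cases h2 : m' = a
    · rw [h1, h2]
    · rw [h1, Function.update_self, Function.update_of_ne h2] at h
      exact absurd h.symm (hk _)
    · rw [h2, Function.update_self, Function.update_of_ne h1] at h
      exact absurd h (hk _)
    · rw [Function.update_of_ne h1, Function.update_of_ne h2] at h
      exact hinj h
  rw [utility_of_injective hinj, utility_of_injective hinj', ← Finset.sum_sub_distrib,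
    Finset.sum_eq_single a]
  · rw [Function.update_self]
    linarith [(hμ a (gs a)).2, (hμ a k).1]
  · intro m _ hm
    rw [Function.update_of_ne hm, sub_self]
  · simp

/-- The infimum is attained, being over a finite set; a free arm shows that this set is not empty.
-/
theorem minGap_pos (hM : 1 ≤ M) (hMK : M < K) (hgs : IsUniqueOptimal μ gs) :
    0 < minGap μ gs := by
  obtain ⟨k, hk⟩ := exists_free_arm hMK gs
  have hg : Function.update gs ⟨0, hM⟩ k ≠ gs :=
    fun h => hk ⟨0, hM⟩ (by rw [← h, Function.update_self])
  have hne : ((fun g => utility μ gs - utility μ g) '' {g | g ≠ gs}).Nonempty :=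
    ⟨_, _, hg, rfl⟩
  obtain ⟨g, h1, h2⟩ := hne.csInf_mem (Set.toFinite _)
  rw [minGap, ← h2]
  exact sub_pos.2 (hgs g h1)

/-- The regret of a communication round. -/
theorem IsSync.regret_le {G : Fin M ↪ Fin K} {σ : Fin M → Memory M K} (h : IsSync G σ)
    (hμ : ∀ m k, μ m k ∈ Set.Icc (0 : ℝ) 1) :
    utility μ gs - utility μ (pulls σ) ≤ 2 + (utility μ gs - utility μ G) := by
  obtain ⟨s, r, h1, h2⟩ := h.pulls_eq
  -- Compared with `G`, only the sender `s` and the agent `r` whose arm it pulls can lose, each at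
  -- most `1`.
  have key : ∀ m, (if Collides (G : Fin M → Fin K) m then 0 else μ m (G m)) ≤
      (if Collides (pulls σ) m then 0 else μ m (pulls σ m)) +
        ((if m = s then 1 else 0) + if m = r then 1 else 0) := by
    intro m
    rw [if_neg (not_collides_of_injective G.injective m)]
    have hnn : 0 ≤ if Collides (pulls σ) m then 0 else μ m (pulls σ m) := by
      split_ifs
      · exact le_rfl
      · exact (hμ _ _).1
    have hle := (hμ m (G m)).2
    by_cases hs : m = s
    · rw [if_pos hs]; split_ifs at * <;> linarith
    · by_cases hr : m = r
      · rw [if_pos hr, if_neg hs]; linarith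
      · rw [if_neg hs, if_neg hr, if_neg, h1 m hs]
        · linarith
        · rintro ⟨m', h3, h4⟩
          rw [h1 m hs] at h4
          by_cases hs' : m' = s
          · rw [hs', h2] at h4
            exact hr (G.injective h4).symm
          · rw [h1 m' hs'] at h4
            exact h3 (G.injective h4)
  have := Finset.sum_le_sum fun m (_ : m ∈ Finset.univ) => key m
  rw [Finset.sum_add_distrib, Finset.sum_add_distrib, Finset.sum_ite_eq', Finset.sum_ite_eq'] at this
  simp only [Finset.mem_univ, if_true] at this
  unfold utility
  linarith

theorem quantize_bounds (b : ℕ) (q : ℚ) :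
    (q : ℝ) ≤ quantize b q ∧ (quantize b q : ℝ) ≤ q + 1 / 2 ^ b := by
  have h1 : q ≤ quantize b q := by
    unfold quantize
    rw [le_div_iff₀ (by positivity)]
    exact Int.le_ceil _
  have h2 : quantize b q ≤ q + 1 / 2 ^ b := by
    unfold quantize
    rw [div_le_iff₀ (by positivity), add_mul, one_div, inv_mul_cancel₀ (by positivity)]
    exact (Int.ceil_lt_add_one _).le
  exact ⟨by exact_mod_cast h1, by simpa using (Rat.cast_le (K := ℝ)).2 h2⟩

/-- A matching of maximum weight for quantized estimates of the means is almost optimal. -/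
theorem regret_hungarian_le (hMK : M < K) (hμ : ∀ m k, μ m k ∈ Set.Icc (0 : ℝ) 1)
    (hgs : IsUniqueOptimal μ gs) (b : ℕ) (mean : Fin M → Fin K → ℚ) {ε : ℝ}
    (hε : ∀ m k, |(mean m k : ℝ) - μ m k| ≤ ε) :
    utility μ gs - utility μ (hungarian hMK fun m k => quantize b (mean m k)) ≤
      M * (1 / 2 ^ b) + 2 * M * ε := by
  set W : Fin M → Fin K → ℚ := fun m k => quantize b (mean m k) with hW
  have hinj := hgs.injective hMK hμ
  rw [utility_of_injective hinj, utility_of_injective (hungarian hMK W).injective]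
  have hopt : ∑ m, W m (gs m) ≤ ∑ m, W m (hungarian hMK W m) :=
    (exists_maxMatching hMK W).choose_spec ⟨gs, hinj⟩
  have hopt' : ∑ m, (W m (gs m) : ℝ) ≤ ∑ m, (W m (hungarian hMK W m) : ℝ) := by exact_mod_cast hopt
  -- Rounding up never underestimates, so on the optimal side only `ε` is lost. The rounding error
  -- enters once, on the side of the chosen matching.
  have h1 : ∑ m, μ m (gs m) ≤ ∑ m, ((W m (gs m) : ℝ) + ε) := by
    refine Finset.sum_le_sum fun m _ => ?_
    have := (abs_le.1 (hε m (gs m))).1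
    have := (quantize_bounds b (mean m (gs m))).1
    simp only [hW]; linarith
  have h2 : ∑ m, (W m (hungarian hMK W m) : ℝ) ≤
      ∑ m, (μ m (hungarian hMK W m) + (1 / 2 ^ b + ε)) := by
    refine Finset.sum_le_sum fun m _ => ?_
    have := (abs_le.1 (hε m (hungarian hMK W m))).2
    have := (quantize_bounds b (mean m (hungarian hMK W m))).2
    simp only [hW] at *; linarith
  rw [Finset.sum_add_distrib] at h1 h2
  simp only [Finset.sum_const, Finset.card_univ, Fintype.card_fin, nsmul_eq_mul] at h1 h2
  linarith

end Utility

end HMA2B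

namespace HMA2B

/-! ### Independence of the past -/

section Past

theorem measurable_past {Ω A : Type*} [MeasurableSpace Ω] [MeasurableSpace A] {X : ℕ → Ω → A}
    (hX : ∀ t, Measurable (X t)) (t : ℕ) : Measurable fun ω (i : Finset.range t) => X i ω :=
  measurable_pi_lambda _ fun i => hX i

variable {Ω A : Type*} [Nonempty A] {X : ℕ → Ω → A}

/-- A quantity determined by the first `t` rounds, as a function of these rounds only. -/
noncomputable def ofPast {β : Type*} (t : ℕ) (F : (ℕ → A) → β) (g : Finset.range t → A) : β :=
  F fun i => if h : i ∈ Finset.range t then g ⟨i, h⟩ else Classical.arbitrary A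

theorem ofPast_eq {β : Type*} {t : ℕ} {F : (ℕ → A) → β} (hF : DependsOn F (Set.Iio t))
    (ω : Ω) : ofPast t F (fun i => X i ω) = F (fun i => X i ω) := by
  refine hF fun i hi => ?_
  rw [dif_pos (Finset.mem_range.2 hi)]

variable [MeasurableSpace Ω] [MeasurableSpace A] [MeasurableSingletonClass A] [Finite A]
  {P : Measure Ω}

/-- The first `t` rounds have finitely many outcomes, so anything they determine is measurable,
whatever the algorithm does. -/
theorem measurable_of_dependsOn {β : Type*} [MeasurableSpace β] (hX : ∀ t, Measurable (X t))
    {t : ℕ} {F : (ℕ → A) → β} (hF : DependsOn F (Set.Iio t)) :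
    Measurable fun ω => F (fun i => X i ω) := by
  have : (fun ω => F (fun i => X i ω)) = ofPast t F ∘ fun ω (i : Finset.range t) => X i ω :=
    funext fun ω => (ofPast_eq hF ω).symm
  rw [this]
  exact (measurable_of_finite _).comp (measurable_past hX t)

theorem integrable_of_dependsOn [IsProbabilityMeasure P] (hX : ∀ t, Measurable (X t))
    {t : ℕ} {F : (ℕ → A) → ℝ} (hF : DependsOn F (Set.Iio t)) :
    Integrable (fun ω => F (fun i => X i ω)) P := by
  have : (fun ω => F (fun i => X i ω)) = ofPast t F ∘ fun ω (i : Finset.range t) => X i ω :=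
    funext fun ω => (ofPast_eq hF ω).symm
  rw [this]
  have hm := measurable_past hX t
  have : IsProbabilityMeasure (P.map fun ω (i : Finset.range t) => X i ω) :=
    Measure.isProbabilityMeasure_map hm.aemeasurable
  exact Integrable.comp_measurable Integrable.of_finite hm

theorem integral_mul_of_dependsOn (hX : ∀ t, Measurable (X t)) (hind : iIndepFun X P)
    {t : ℕ} {F : (ℕ → A) → ℝ} (hF : DependsOn F (Set.Iio t)) (g : A → ℝ) :
    ∫ ω, F (fun i => X i ω) * g (X t ω) ∂P =
      (∫ ω, F (fun i => X i ω) ∂P) * ∫ ω, g (X t ω) ∂P := by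
  have h := hind.indepFun_finset (Finset.range t) {t} (by simp) hX
  have h2 : IndepFun (fun ω => F (fun i => X i ω)) (fun ω => g (X t ω)) P := by
    have h3 := h.comp (φ := ofPast t F)
      (ψ := fun f : (({t} : Finset ℕ) → A) => g (f ⟨t, Finset.mem_singleton_self t⟩))
      (measurable_of_finite _) (measurable_of_finite _)
    have : (fun ω => F (fun i => X i ω)) = ofPast t F ∘ fun ω (i : Finset.range t) => X i ω :=
      funext fun ω => (ofPast_eq hF ω).symm
    rw [this]
    exact h3
  exact h2.integral_fun_mul_eq_mul_integral
    (measurable_of_dependsOn hX hF).aestronglyMeasurable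
    ((measurable_of_finite g).comp (hX t)).aestronglyMeasurable

end Past

/-! ### Concentration of the empirical means -/

variable {M K : ℕ} (hMK : M < K) (T₀ : ℝ)

theorem run_congr {x y : ℕ → Fin M → Fin K → Bool} {t : ℕ} (h : ∀ i < t, x i = y i) :
    run hMK T₀ x t = run hMK T₀ y t := by
  induction t with
  | zero => rfl
  | succ t ih =>
    funext m
    rw [run_succ, run_succ, ih fun i hi => h i (by omega), h t (by omega)]

theorem dependsOn_run {β : Type*} (t : ℕ) (f : (Fin M → Memory M K) → β) :
    DependsOn (fun x => f (run hMK T₀ x t)) (Set.Iio t) := by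
  intro x y h
  simp only [run_congr hMK T₀ (fun i hi => h i hi)]

variable {Ω : Type*} [MeasurableSpace Ω] {P : Measure Ω}
  {μ : Fin M → Fin K → ℝ} {X : ℕ → Ω → Fin M → Fin K → Bool}

/-- The factor by which the exponential supermartingale changes upon `w` simultaneous
observations of a reward `b` of mean `p`. -/
noncomputable def expFactor (l p : ℝ) (w : ℕ) (b : Bool) : ℝ :=
  Real.exp (l * (w * ((if b = true then 1 else 0) - p)) - l ^ 2 * w / 4)

/-- Hoeffding's lemma bounds the moment generating function by `exp (l² w² / 8)`. A pull and a hint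
may show the same reward, so the `w` observations are not independent; `w² ≤ 2 w` turns the exponent
into `l² w / 4`. -/
theorem integral_expFactor_le [IsProbabilityMeasure P] (hX : IsRewardProcess P μ X) (t : ℕ) (m : Fin M) (k : Fin K)
    (l : ℝ) {w : ℕ} (hw : w ≤ 2) : ∫ ω, expFactor l (μ m k) w (X t ω m k) ∂P ≤ 1 := by
  set Y : Ω → ℝ := fun ω => if X t ω m k = true then 1 else 0 with hY
  have hmk : Measurable fun ω => X t ω m k :=
    (measurable_of_finite fun a : Fin M → Fin K → Bool => a m k).comp (hX.measurable t)
  have hYm : Measurable Y :=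
    (measurable_of_finite fun b : Bool => if b = true then (1 : ℝ) else 0).comp hmk
  have hmean : P[Y] = μ m k := by
    have hs : MeasurableSet {ω | X t ω m k = true} := hmk (measurableSet_singleton true)
    have : Y = Set.indicator {ω | X t ω m k = true} 1 := by
      funext ω
      simp [hY, Set.indicator_apply]
    rw [this, integral_indicator_one hs, hX.law]
  have hsub := hasSubgaussianMGF_of_mem_Icc (μ := P) (X := Y) (a := 0) (b := 1) hYm.aemeasurable
    (Filter.Eventually.of_forall fun ω => by simp only [hY]; split_ifs <;> simp)
  have hmgf := hsub.mgf_le (l * w)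
  rw [hmean] at hmgf
  have h1 : ∀ ω, expFactor l (μ m k) w (X t ω m k) =
      Real.exp (l * w * (Y ω - μ m k)) * Real.exp (-(l ^ 2 * w / 4)) := by
    intro ω
    rw [← Real.exp_add]
    unfold expFactor
    congr 1
    simp only [hY]
    ring
  simp only [h1]
  rw [integral_mul_const]
  have h2 : (w : ℝ) ^ 2 ≤ 2 * w := by
    have : (w : ℝ) ≤ 2 := by exact_mod_cast hw
    nlinarith [(Nat.cast_nonneg w : (0 : ℝ) ≤ w)]
  calc _ ≤ Real.exp ((((‖(1 : ℝ) - 0‖₊ / 2) ^ 2 : NNReal) : ℝ) * (l * w) ^ 2 / 2) *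
        Real.exp (-(l ^ 2 * w / 4)) :=
      mul_le_mul_of_nonneg_right hmgf (Real.exp_pos _).le
    _ ≤ 1 := by
      rw [← Real.exp_add, Real.exp_le_one_iff]
      simp
      nlinarith [mul_le_mul_of_nonneg_left h2 (sq_nonneg l)]

/-- The exponential supermartingale of the observations of arm `k` by agent `m`. -/
noncomputable def expProcess (μ : Fin M → Fin K → ℝ) (m : Fin M) (k : Fin K) (l : ℝ)
    (σ : Fin M → Memory M K) : ℝ :=
  Real.exp (l * ((σ m).S k - μ m k * (σ m).N k) - l ^ 2 * (σ m).N k / 4)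

variable {T₀} {E : ℕ}

theorem expProcess_succ (hM : 1 ≤ M) (hE : IsEpochCount K T₀ E)
    (x : ℕ → Fin M → Fin K → Bool) (t : ℕ) (m : Fin M) (k : Fin K) (l : ℝ) :
    expProcess μ m k l (run hMK T₀ x (t + 1)) = expProcess μ m k l (run hMK T₀ x t) *
      expFactor l (μ m k) (weight hMK m t k (run hMK T₀ x t m)) (x t m k) := by
  unfold expProcess expFactor
  rw [← Real.exp_add, run_succ_N, run_succ_S hMK T₀ x t m k (not_collides_explore hMK x hM hE t m)]
  congr 1
  push_cast
  ring

/-- The weight is random but determined by the past. Splitting over its values `0, 1, 2` makes it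
constant, and the new reward is independent of the past. -/
theorem integral_mul_expFactor_le [IsProbabilityMeasure P] (hX : IsRewardProcess P μ X) (t : ℕ) (m : Fin M) (k : Fin K)
    (l : ℝ) {F : (ℕ → Fin M → Fin K → Bool) → ℝ} (hF : DependsOn F (Set.Iio t))
    (hF0 : ∀ x, 0 ≤ F x) :
    ∫ ω, F (fun i => X i ω) * expFactor l (μ m k)
        (weight hMK m t k (run hMK T₀ (fun i => X i ω) t m)) (X t ω m k) ∂P ≤
      ∫ ω, F (fun i => X i ω) ∂P := by
  set W : (ℕ → Fin M → Fin K → Bool) → ℕ := fun x => weight hMK m t k (run hMK T₀ x t m) with hW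
  set Fv : ℕ → (ℕ → Fin M → Fin K → Bool) → ℝ := fun v x => if W x = v then F x else 0 with hFv
  have hWdep : DependsOn W (Set.Iio t) := dependsOn_run hMK T₀ t fun σ => weight hMK m t k (σ m)
  have hFvdep : ∀ v, DependsOn (Fv v) (Set.Iio t) := by
    intro v x y h
    simp only [hFv, hF h, hWdep h]
  have hsum : ∀ (x : ℕ → Fin M → Fin K → Bool) (g : ℕ → ℝ),
      F x * g (W x) = ∑ v ∈ Finset.range 3, Fv v x * g v := by
    intro x g
    have hle : W x ≤ 2 := weight_le_two hMK m t k _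
    rw [Finset.sum_eq_single (W x)]
    · simp [hFv]
    · intro v _ hv
      simp [hFv, Ne.symm hv]
    · intro h
      exact absurd (Finset.mem_range.2 (by omega)) h
  have hint : ∀ v, Integrable (fun ω => Fv v (fun i => X i ω) *
      expFactor l (μ m k) v (X t ω m k)) P := by
    intro v
    refine integrable_of_dependsOn (A := Fin M → Fin K → Bool) hX.measurable (t := t + 1)
      (F := fun x => Fv v x * expFactor l (μ m k) v (x t m k)) ?_
    intro x y h
    simp only [hFvdep v (fun i hi => h i (Set.mem_Iio.2 (lt_trans (Set.mem_Iio.1 hi) t.lt_succ_self))),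
      h t (Set.mem_Iio.2 t.lt_succ_self)]
  calc _ = ∑ v ∈ Finset.range 3, ∫ ω, Fv v (fun i => X i ω) *
          expFactor l (μ m k) v (X t ω m k) ∂P := by
        rw [← integral_finsetSum _ fun v _ => hint v]
        refine integral_congr_ae (Filter.Eventually.of_forall fun ω => ?_)
        exact hsum (fun i => X i ω) fun v => expFactor l (μ m k) v (X t ω m k)
    _ ≤ ∑ v ∈ Finset.range 3, ∫ ω, Fv v (fun i => X i ω) ∂P := by
        refine Finset.sum_le_sum fun v hv => ?_
        rw [integral_mul_of_dependsOn hX.measurable hX.indep (hFvdep v)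
          fun a => expFactor l (μ m k) v (a m k)]
        refine mul_le_of_le_one_right (integral_nonneg fun ω => ?_)
          (integral_expFactor_le hX t m k l (by have := Finset.mem_range.1 hv; omega))
        simp only [hFv, Pi.zero_apply]
        split_ifs
        · exact hF0 _
        · exact le_rfl
    _ = _ := by
        rw [← integral_finsetSum _ fun v _ => integrable_of_dependsOn hX.measurable (hFvdep v)]
        refine integral_congr_ae (Filter.Eventually.of_forall fun ω => ?_)
        simpa using (hsum (fun i => X i ω) fun _ => 1).symm

/-- A maximal inequality. -/
theorem measure_exists_le [IsProbabilityMeasure P] (hM : 1 ≤ M) (hE : IsEpochCount K T₀ E) (hX : IsRewardProcess P μ X)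
    (m : Fin M) (k : Fin K) (l : ℝ) (bad : (Fin M → Memory M K) → Prop) {c : ℝ} (hc : 0 < c)
    (hbad : ∀ σ, bad σ → c ≤ expProcess μ m k l σ) :
    P.real {ω | ∃ t, bad (run hMK T₀ (fun i => X i ω) t)} ≤ 1 / c := by
  set B : ℕ → (ℕ → Fin M → Fin K → Bool) → Prop := fun t x => ∃ i ≤ t, bad (run hMK T₀ x i) with hB
  have hBdep : ∀ t, DependsOn (B t) (Set.Iio t) := by
    intro t x y h
    simp only [hB]
    congr 1
    funext i
    by_cases hi : i ≤ t
    · rw [run_congr hMK T₀ (fun j hj => h j (Set.mem_Iio.2 (by omega)))]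
    · simp [hi]
  -- The process is frozen at the value `c` once a bad state has occurred. Since it is at least `c`
  -- at that moment, freezing only lowers it, and the expectation stays at most `1`.
  set H : ℕ → (ℕ → Fin M → Fin K → Bool) → ℝ := fun t x =>
    if B t x then c else expProcess μ m k l (run hMK T₀ x t) with hH
  have hHdep : ∀ t, DependsOn (H t) (Set.Iio t) := by
    intro t x y h
    simp only [hH, hBdep t h, run_congr hMK T₀ (fun i hi => h i hi)]
  have hint : ∀ t, Integrable (fun ω => H t (fun i => X i ω)) P := fun t =>
    integrable_of_dependsOn hX.measurable (hHdep t)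
  have hpos : ∀ σ, 0 ≤ expProcess μ m k l σ := fun σ => (Real.exp_pos _).le
  have hle : ∀ t, ∫ ω, H t (fun i => X i ω) ∂P ≤ 1 := by
    intro t
    induction t with
    | zero =>
      calc ∫ ω, H 0 (fun i => X i ω) ∂P ≤ ∫ _ω, (1 : ℝ) ∂P := by
            refine integral_mono (hint 0) (integrable_const _) fun ω => ?_
            have h1 : expProcess μ m k l (run hMK T₀ (fun i => X i ω) 0) = 1 := by
              simp [expProcess, run, Memory.init]
            simp only [hH]
            split_ifs with h
            · obtain ⟨i, hi, h2⟩ := h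
              rw [Nat.le_zero.1 hi] at h2
              rw [← h1]; exact hbad _ h2
            · exact h1.le
        _ = 1 := by simp
    | succ t ih =>
      set F : (ℕ → Fin M → Fin K → Bool) → ℝ := fun x =>
        if B t x then 0 else expProcess μ m k l (run hMK T₀ x t) with hFdef
      set F' : (ℕ → Fin M → Fin K → Bool) → ℝ := fun x => if B t x then c else 0 with hF'def
      have hFdep : DependsOn F (Set.Iio t) := by
        intro x y h
        simp only [hFdef, hBdep t h, run_congr hMK T₀ (fun i hi => h i hi)]
      have hF'dep : DependsOn F' (Set.Iio t) := by
        intro x y h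
        simp only [hF'def, hBdep t h]
      have hF0 : ∀ x, 0 ≤ F x := by
        intro x
        simp only [hFdef]
        split_ifs
        · exact le_rfl
        · exact hpos _
      have hHF : ∀ x, H t x = F x + F' x := by
        intro x
        simp only [hH, hFdef, hF'def]
        split_ifs <;> simp
      have hstep : ∀ x, H (t + 1) x ≤ F x * expFactor l (μ m k)
          (weight hMK m t k (run hMK T₀ x t m)) (x t m k) + F' x := by
        intro x
        simp only [hH, hFdef, hF'def]
        by_cases h1 : B t x
        · have h2 : B (t + 1) x := by
            obtain ⟨i, hi, h3⟩ := h1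
            exact ⟨i, by omega, h3⟩
          rw [if_pos h1, if_pos h1, if_pos h2]; simp
        · rw [if_neg h1, if_neg h1, ← expProcess_succ hMK hM hE, add_zero]
          split_ifs with h2
          · obtain ⟨i, hi, h3⟩ := h2
            have : i = t + 1 := by
              by_contra h4
              exact h1 ⟨i, by omega, h3⟩
            rw [this] at h3
            exact hbad _ h3
          · exact le_rfl
      have hint1 : Integrable (fun ω => F (fun i => X i ω) * expFactor l (μ m k)
          (weight hMK m t k (run hMK T₀ (fun i => X i ω) t m)) (X t ω m k)) P := by
        refine integrable_of_dependsOn (A := Fin M → Fin K → Bool) hX.measurable (t := t + 1)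
          (F := fun x => F x * expFactor l (μ m k)
            (weight hMK m t k (run hMK T₀ x t m)) (x t m k)) ?_
        intro x y h
        have h' : ∀ i ∈ Set.Iio t, x i = y i := fun i hi =>
          h i (Set.mem_Iio.2 (lt_trans (Set.mem_Iio.1 hi) t.lt_succ_self))
        simp only [hFdep h', run_congr hMK T₀ (fun i hi => h' i hi),
          h t (Set.mem_Iio.2 t.lt_succ_self)]
      have hint2 : Integrable (fun ω => F' (fun i => X i ω)) P :=
        integrable_of_dependsOn hX.measurable hF'dep
      have hint3 : Integrable (fun ω => F (fun i => X i ω)) P :=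
        integrable_of_dependsOn hX.measurable hFdep
      calc ∫ ω, H (t + 1) (fun i => X i ω) ∂P
          ≤ ∫ ω, (F (fun i => X i ω) * expFactor l (μ m k)
            (weight hMK m t k (run hMK T₀ (fun i => X i ω) t m)) (X t ω m k) +
              F' (fun i => X i ω)) ∂P :=
            integral_mono (hint _) (hint1.add hint2) fun ω => hstep _
        _ = (∫ ω, F (fun i => X i ω) * expFactor l (μ m k)
            (weight hMK m t k (run hMK T₀ (fun i => X i ω) t m)) (X t ω m k) ∂P) +
              ∫ ω, F' (fun i => X i ω) ∂P := integral_add hint1 hint2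
        _ ≤ (∫ ω, F (fun i => X i ω) ∂P) + ∫ ω, F' (fun i => X i ω) ∂P :=
            add_le_add_left (integral_mul_expFactor_le hMK hX t m k l hFdep hF0) _
        _ = ∫ ω, H t (fun i => X i ω) ∂P := by
            rw [← integral_add hint3 hint2]
            exact integral_congr_ae (Filter.Eventually.of_forall fun ω => (hHF _).symm)
        _ ≤ 1 := ih
  -- Markov's inequality for the frozen process, which equals `c` on the event.
  have hfin : ∀ t, P {ω | B t (fun i => X i ω)} ≤ ENNReal.ofReal (1 / c) := by
    intro t
    have hms : MeasurableSet {ω | B t (fun i => X i ω)} :=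
      measurable_of_dependsOn hX.measurable (hBdep t) (measurableSet_singleton True) |>.congr
        (by ext; simp)
    have h1 : c * P.real {ω | B t (fun i => X i ω)} ≤ 1 := by
      calc c * P.real {ω | B t (fun i => X i ω)}
          = ∫ ω, Set.indicator {ω | B t (fun i => X i ω)} (fun _ => c) ω ∂P := by
            rw [integral_indicator_const _ hms, smul_eq_mul, mul_comm]
        _ ≤ ∫ ω, H t (fun i => X i ω) ∂P := by
            refine integral_mono ((integrable_const c).indicator hms) (hint t) fun ω => ?_
            simp only [hH, Set.indicator_apply, Set.mem_ofPred_eq]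
            split_ifs
            · exact le_rfl
            · exact hpos _
        _ ≤ 1 := hle t
    rw [← ofReal_measureReal]
    exact ENNReal.ofReal_le_ofReal (by rw [le_div_iff₀ hc]; linarith)
  have hunion : {ω | ∃ t, bad (run hMK T₀ (fun i => X i ω) t)} =
      ⋃ t, {ω | B t (fun i => X i ω)} := by
    ext ω
    simp only [Set.mem_ofPred_eq, Set.mem_iUnion, hB]
    exact ⟨fun ⟨t, h⟩ => ⟨t, t, le_rfl, h⟩, fun ⟨_, i, _, h⟩ => ⟨i, h⟩⟩
  have hmono : Monotone fun t => {ω | B t (fun i => X i ω)} := by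
    intro a b hab ω h
    obtain ⟨i, hi, h2⟩ := h
    exact ⟨i, hi.trans hab, h2⟩
  rw [hunion]
  refine ENNReal.toReal_le_of_le_ofReal (by positivity) ?_
  rw [hmono.measure_iUnion]
  exact iSup_le hfin

/-- Some empirical mean, taken over at least `r` observations, deviates by more than `ε`. -/
def Deviates (μ : Fin M → Fin K → ℝ) (r ε : ℝ) (σ : Fin M → Memory M K) (m : Fin M)
    (k : Fin K) : Prop :=
  r ≤ (σ m).N k ∧ ε * (σ m).N k < |((σ m).S k : ℝ) - μ m k * (σ m).N k|

/-- The event that some empirical mean deviates at some time. -/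
def deviation (μ : Fin M → Fin K → ℝ) (hMK : M < K) (T₀ : ℝ) (X : ℕ → Ω → Fin M → Fin K → Bool)
    (r ε : ℝ) : Set Ω :=
  {ω | ∃ t m k, Deviates μ r ε (run hMK T₀ (fun i => X i ω) t) m k}

theorem measurableSet_deviation (hX : IsRewardProcess P μ X) (r ε : ℝ) :
    MeasurableSet (deviation μ hMK T₀ X r ε) := by
  have : deviation μ hMK T₀ X r ε =
      ⋃ t, {ω | ∃ m k, Deviates μ r ε (run hMK T₀ (fun i => X i ω) t) m k} := by
    ext ω; simp [deviation]
  rw [this]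
  refine MeasurableSet.iUnion fun t => ?_
  exact (measurable_of_dependsOn hX.measurable
    (dependsOn_run hMK T₀ t fun σ => ∃ m k, Deviates μ r ε σ m k)
      (measurableSet_singleton True)).congr (by ext; simp)

/-- The choice `l = ± 2 ε` makes the exponent of the supermartingale at least `ε² N ≥ ε² r` on a
deviation. The factor `2 M K` is a union bound over agents, arms and signs. -/
theorem measure_deviation_le [IsProbabilityMeasure P] (hM : 1 ≤ M) (hE : IsEpochCount K T₀ E) (hX : IsRewardProcess P μ X)
    {r ε : ℝ} (hε : 0 ≤ ε) :
    P.real (deviation μ hMK T₀ X r ε) ≤ 2 * M * K * Real.exp (-(ε ^ 2 * r)) := by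
  have key : ∀ (m : Fin M) (k : Fin K) (l : ℝ), l ^ 2 = 4 * ε ^ 2 →
      P.real {ω | ∃ t, r ≤ (run hMK T₀ (fun i => X i ω) t m).N k ∧
        l ^ 2 / 2 * (run hMK T₀ (fun i => X i ω) t m).N k ≤
          l * ((run hMK T₀ (fun i => X i ω) t m).S k -
            μ m k * (run hMK T₀ (fun i => X i ω) t m).N k)} ≤ Real.exp (-(ε ^ 2 * r)) := by
    intro m k l hl
    rw [Real.exp_neg, ← one_div]
    refine measure_exists_le hMK hM hE hX m k l (fun σ => r ≤ (σ m).N k ∧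
        l ^ 2 / 2 * (σ m).N k ≤ l * ((σ m).S k - μ m k * (σ m).N k)) (Real.exp_pos _) ?_
    rintro σ ⟨h1, h2⟩
    unfold expProcess
    rw [Real.exp_le_exp]
    have := mul_le_mul_of_nonneg_left h1 (sq_nonneg ε)
    rw [hl] at h2 ⊢
    linarith
  set B : Fin M → Fin K → ℝ → Set Ω := fun m k l =>
    {ω | ∃ t, r ≤ (run hMK T₀ (fun i => X i ω) t m).N k ∧
        l ^ 2 / 2 * (run hMK T₀ (fun i => X i ω) t m).N k ≤
          l * ((run hMK T₀ (fun i => X i ω) t m).S k -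
            μ m k * (run hMK T₀ (fun i => X i ω) t m).N k)} with hB
  have hsub : deviation μ hMK T₀ X r ε ⊆
      ⋃ m ∈ Finset.univ, ⋃ k ∈ Finset.univ, (B m k (2 * ε) ∪ B m k (-(2 * ε))) := by
    rintro ω ⟨t, m, k, h1, h2⟩
    simp only [Finset.mem_univ, Set.iUnion_true, Set.mem_iUnion]
    refine ⟨m, k, ?_⟩
    rcases lt_abs.1 h2 with h3 | h3
    · exact Or.inl ⟨t, h1, by nlinarith⟩
    · exact Or.inr ⟨t, h1, by nlinarith⟩
  calc P.real (deviation μ hMK T₀ X r ε)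
      ≤ P.real (⋃ m ∈ Finset.univ, ⋃ k ∈ Finset.univ, (B m k (2 * ε) ∪ B m k (-(2 * ε)))) :=
        measureReal_mono hsub (measure_ne_top _ _)
    _ ≤ ∑ m : Fin M, P.real (⋃ k ∈ Finset.univ, (B m k (2 * ε) ∪ B m k (-(2 * ε)))) :=
        measureReal_biUnion_finset_le _ _
    _ ≤ ∑ m : Fin M, ∑ k : Fin K, P.real (B m k (2 * ε) ∪ B m k (-(2 * ε))) :=
        Finset.sum_le_sum fun m _ => measureReal_biUnion_finset_le _ _
    _ ≤ ∑ _m : Fin M, ∑ _k : Fin K, (Real.exp (-(ε ^ 2 * r)) + Real.exp (-(ε ^ 2 * r))) :=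
        Finset.sum_le_sum fun m _ => Finset.sum_le_sum fun k _ =>
          (measureReal_union_le _ _).trans
            (add_le_add (key m k _ (by ring)) (key m k _ (by ring)))
    _ = _ := by simp; ring

end HMA2B

namespace HMA2B

/-! ### Lengths of the bit strings -/

/-- A number with `j + 1` digits is at least `2 ^ j`, and `(j + 1)² ≤ 4 * 2 ^ j`. This weakening of
a logarithm to a square root suffices, and square roots of the changes can be bounded by telescoping
terms. -/
theorem natSize_sq_le (n : ℕ) : n.size ^ 2 ≤ 4 * n := by
  rcases Nat.eq_zero_or_pos n with rfl | hn
  · simp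
  · have h1 : 0 < n.size := Nat.size_pos.2 hn
    obtain ⟨j, hj⟩ : ∃ j, n.size = j + 1 := ⟨n.size - 1, by omega⟩
    have h2 : 2 ^ j ≤ n := Nat.lt_size.1 (by omega)
    have h3 : ∀ j : ℕ, (j + 1) ^ 2 ≤ 4 * 2 ^ j := by
      intro j
      induction j with
      | zero => norm_num
      | succ j ih =>
        rcases Nat.lt_or_ge j 2 with h | h
        · interval_cases j <;> norm_num
        · rw [pow_succ 2 j]; nlinarith
    rw [hj]
    exact (h3 j).trans (by omega)

theorem natSize_le_sqrt (n : ℕ) : (n.size : ℝ) ≤ 2 * Real.sqrt n := by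
  have h : ((n.size : ℝ)) ^ 2 ≤ 4 * n := by exact_mod_cast natSize_sq_le n
  calc (n.size : ℝ) ≤ Real.sqrt (4 * n) := Real.le_sqrt_of_sq_le h
    _ = 2 * Real.sqrt n := by
      rw [Real.sqrt_mul (by norm_num), show (4 : ℝ) = 2 ^ 2 by norm_num, Real.sqrt_sq (by norm_num)]

theorem two_rpow_half_logb {r : ℝ} (hr : 0 < r) :
    (2 : ℝ) ^ (1 + Real.logb 2 r / 2) = 2 * Real.sqrt r := by
  rw [Real.rpow_add (by norm_num), Real.rpow_one, div_eq_mul_inv, Real.rpow_mul (by norm_num),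
    Real.rpow_logb (by norm_num) (by norm_num) hr, Real.sqrt_eq_rpow]
  norm_num

theorem le_two_pow_quantBits {ρ : ℕ} (hρ : 1 ≤ ρ) : 2 * Real.sqrt ρ ≤ 2 ^ quantBits ρ := by
  have h : (0 : ℝ) < ρ := by exact_mod_cast hρ
  rw [← two_rpow_half_logb h, ← Real.rpow_natCast]
  exact Real.rpow_le_rpow_of_exponent_le (by norm_num) (Nat.le_ceil _)

theorem two_pow_quantBits_le {ρ : ℕ} (hρ : 1 ≤ ρ) : (2 : ℝ) ^ quantBits ρ ≤ 4 * Real.sqrt ρ := by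
  have h : (0 : ℝ) < ρ := by exact_mod_cast hρ
  have h1 : 0 ≤ Real.logb 2 ρ := Real.logb_nonneg (by norm_num) (by exact_mod_cast hρ)
  have h2 : (quantBits ρ : ℝ) ≤ (1 + Real.logb 2 ρ / 2) + 1 :=
    (Nat.ceil_lt_add_one (by positivity)).le
  calc (2 : ℝ) ^ quantBits ρ = (2 : ℝ) ^ (quantBits ρ : ℝ) := (Real.rpow_natCast _ _).symm
    _ ≤ (2 : ℝ) ^ ((1 + Real.logb 2 ρ / 2) + 1) :=
      Real.rpow_le_rpow_of_exponent_le (by norm_num) h2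
    _ = 4 * Real.sqrt ρ := by
      rw [Real.rpow_add (by norm_num), two_rpow_half_logb h, Real.rpow_one]; ring

/-- As `ρ + 1 ≤ 2 ρ`, the precision grows by at most one digit, so an old unit is at most two new
ones. -/
theorem quantBits_succ_le {ρ : ℕ} (hρ : 1 ≤ ρ) : quantBits (ρ + 1) ≤ quantBits ρ + 1 := by
  have h : (0 : ℝ) < ρ := by exact_mod_cast hρ
  have h1 : 0 ≤ Real.logb 2 ρ := Real.logb_nonneg (by norm_num) (by exact_mod_cast hρ)
  unfold quantBits
  rw [← Nat.ceil_add_one (by positivity)]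
  apply Nat.ceil_mono
  have : Real.logb 2 ((ρ + 1 : ℕ) : ℝ) ≤ Real.logb 2 (2 * ρ) := by
    refine Real.logb_le_logb_of_le (by norm_num) (by positivity) ?_
    have : (1 : ℝ) ≤ ρ := by exact_mod_cast hρ
    push_cast; linarith
  rw [Real.logb_mul (by norm_num) h.ne', Real.logb_self_eq_one (by norm_num)] at this
  linarith

theorem quantBits_one : quantBits 1 = 1 := by
  simp [quantBits]

/-- The numerator of the difference is `(S' - S) N - w S`, and both terms lie between `0` and `w N`.
-/
theorem abs_ratio_sub_le {S S' N w : ℝ} (hN : 0 < N) (hw : 0 ≤ w) (h0 : 0 ≤ S) (h1 : S ≤ N)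
    (h2 : S ≤ S') (h3 : S' ≤ S + w) : |S' / (N + w) - S / N| ≤ w / (N + w) := by
  have hN' : 0 < N + w := by linarith
  rw [div_sub_div _ _ hN'.ne' hN.ne', abs_div, abs_of_pos (mul_pos hN' hN),
    div_le_div_iff₀ (mul_pos hN' hN) hN']
  have : |S' * N - (N + w) * S| ≤ w * N := by
    rw [abs_le]
    constructor <;> nlinarith
  nlinarith

/-- Size of the transmitted differences. -/
theorem abs_floor_quantize_sub_le {ρ : ℕ} (hρ : 1 ≤ ρ) (p q : ℚ) :
    |((⌊(quantize (quantBits (ρ + 1)) p - quantize (quantBits ρ) q) *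
        2 ^ quantBits (ρ + 1)⌋ : ℤ) : ℝ)| ≤
      4 * Real.sqrt (ρ + 1) * |(p : ℝ) - q| + 3 := by
  set b := quantBits (ρ + 1)
  set b₀ := quantBits ρ
  obtain ⟨h1, h2⟩ := quantize_bounds b p
  obtain ⟨h3, h4⟩ := quantize_bounds b₀ q
  set y : ℚ := (quantize b p - quantize b₀ q) * 2 ^ b with hy
  have hb : (2 : ℝ) ^ b ≤ 2 * 2 ^ b₀ := by
    rw [← pow_succ']
    exact pow_le_pow_right₀ (by norm_num) (quantBits_succ_le hρ)
  have hb0 : (0 : ℝ) < 2 ^ b₀ := by positivity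
  have hb1 : (0 : ℝ) < 2 ^ b := by positivity
  have hb4 : (2 : ℝ) ^ b ≤ 4 * Real.sqrt (ρ + 1) := by
    have := two_pow_quantBits_le (ρ := ρ + 1) (by omega)
    push_cast at this
    exact this
  have h5 : (2 : ℝ) ^ b * (1 / 2 ^ b₀) ≤ 2 := by
    rw [mul_one_div, div_le_iff₀ hb0]; exact hb
  have h6 : (2 : ℝ) ^ b * (1 / 2 ^ b) = 1 := mul_one_div_cancel hb1.ne'
  have hyr : (y : ℝ) = ((quantize b p : ℝ) - quantize b₀ q) * 2 ^ b := by rw [hy]; push_cast; rfl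
  -- In new units the rounding errors are at most `1` for `p` and `2` for `q`, with opposite signs
  -- in the difference; the floor below adds one more.
  have h7 : |(y : ℝ)| ≤ 2 ^ b * |(p : ℝ) - q| + 2 := by
    rw [hyr, abs_le]
    have := le_abs_self ((p : ℝ) - q)
    have := neg_abs_le ((p : ℝ) - q)
    constructor <;> nlinarith
  have h8 : 2 ^ b * |(p : ℝ) - q| ≤ 4 * Real.sqrt (ρ + 1) * |(p : ℝ) - q| :=
    mul_le_mul_of_nonneg_right hb4 (abs_nonneg _)
  have h9 : ((⌊y⌋ : ℤ) : ℝ) ≤ y := by exact_mod_cast Int.floor_le y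
  have h10 : (y : ℝ) < ((⌊y⌋ : ℤ) : ℝ) + 1 := by exact_mod_cast Int.lt_floor_add_one y
  obtain ⟨h11, h12⟩ := abs_le.1 h7
  rw [abs_le]
  constructor <;> linarith

theorem length_bitString_le {d : ℤ} {y : ℝ} (hy : 0 ≤ y) (h : |(d : ℝ)| ≤ y + 3) :
    ((bitString d).length : ℝ) ≤ 11 + 4 * Real.sqrt y := by
  rw [length_bitString]
  have h1 := natSize_le_sqrt d.natAbs
  have h2 : ((d.natAbs : ℕ) : ℝ) = |(d : ℝ)| := by rw [Nat.cast_natAbs, Int.cast_abs]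
  rw [h2] at h1
  have h3 : Real.sqrt |(d : ℝ)| ≤ Real.sqrt y + Real.sqrt 3 :=
    by
    refine (Real.sqrt_le_sqrt h).trans (Real.sqrt_le_iff.2 ⟨by positivity, ?_⟩)
    nlinarith [Real.sq_sqrt hy, Real.sq_sqrt (show (0 : ℝ) ≤ 3 by norm_num),
      mul_nonneg (Real.sqrt_nonneg y) (Real.sqrt_nonneg 3)]
  -- This yields the constant `4 + 4 * (7 / 4) = 11`.
  have h4 : Real.sqrt 3 ≤ 7 / 4 := by
    rw [Real.sqrt_le_left (by norm_num)]; norm_num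
  push_cast
  linarith

variable {M K : ℕ} (hMK : M < K) {T₀ : ℝ} (x : ℕ → Fin M → Fin K → Bool) {E : ℕ}

section Lengths

variable (hM : 1 ≤ M) (hE : IsEpochCount K T₀ E)
include hM hE

theorem run_S_le (t : ℕ) (m : Fin M) (k : Fin K) :
    (run hMK T₀ x t m).S k ≤ (run hMK T₀ x t m).N k := by
  have := (run_S_le_N hMK (T₀ := T₀) x 0 m k (not_collides_explore hMK x hM hE) t).2
  simpa [run, Memory.init] using this

theorem abs_delta_le {ρ : ℕ} (hρ : ρ < E) (s : Fin M) (k : Fin K) {w : ℕ}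
    (hw : (run hMK T₀ x (epochStart hMK T₀ x ρ + K) s).N k =
      (run hMK T₀ x (epochStart hMK T₀ x ρ) s).N k + w) :
    |(((run hMK T₀ x (epochStart hMK T₀ x ρ + K) s).delta k : ℤ) : ℝ)| ≤
      4 * Real.sqrt (ρ + 1) * (w / (run hMK T₀ x (epochStart hMK T₀ x ρ + K) s).N k) + 3 := by
  rw [epoch_delta hMK x hM hE hρ]
  cases ρ with
  | zero =>
    -- In epoch `0` the old statistics are `0` rather than rounded means; with one binary digit the
    -- difference is at most `2`.
    simp only [zero_add, shared, Pi.zero_apply, sub_zero, quantBits_one]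
    have h0 : 0 ≤ (run hMK T₀ x (epochStart hMK T₀ x 0 + K) s).mean k := by
      unfold Memory.mean; positivity
    have h1 : (run hMK T₀ x (epochStart hMK T₀ x 0 + K) s).mean k ≤ 1 := by
      unfold Memory.mean
      exact div_le_one_of_le₀ (by exact_mod_cast run_S_le hMK x hM hE _ s k) (by positivity)
    generalize (run hMK T₀ x (epochStart hMK T₀ x 0 + K) s).mean k = q at h0 h1
    have h2 : ⌊quantize 1 q * 2 ^ 1⌋ = ⌈q * 2 ^ 1⌉ := by
      unfold quantize
      rw [div_mul_cancel₀ _ (by norm_num), Int.floor_intCast]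
    rw [h2]
    have h3 : (0 : ℤ) ≤ ⌈q * 2 ^ 1⌉ := Int.ceil_nonneg (by positivity)
    have h4 : ⌈q * 2 ^ 1⌉ ≤ 2 := by
      rw [Int.ceil_le]; push_cast; linarith
    have h5 : |((⌈q * 2 ^ 1⌉ : ℤ) : ℝ)| ≤ 3 := by
      rw [abs_of_nonneg (by exact_mod_cast h3)]
      have : ((⌈q * 2 ^ 1⌉ : ℤ) : ℝ) ≤ 2 := by exact_mod_cast h4
      linarith
    exact h5.trans (le_add_of_nonneg_left (by positivity))
  | succ ρ =>
    simp only [shared]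
    refine (abs_floor_quantize_sub_le (by omega) _ _).trans ?_
    have hN := le_run_N hMK x hM hE (ρ + 1) hρ.le s k
    obtain ⟨h1, h2⟩ := run_NS_comm hMK x hM hE (show ρ < E by omega) s k
    have hS := run_S_le_N hMK (T₀ := T₀) x (epochStart hMK T₀ x (ρ + 1)) s k
      (not_collides_explore hMK x hM hE) K
    have hSN := run_S_le hMK x hM hE (epochStart hMK T₀ x (ρ + 1)) s k
    unfold Memory.mean
    push_cast
    rw [← h1, ← h2, hw]
    rw [hw] at hS
    push_cast
    have := abs_ratio_sub_le
      (S := (run hMK T₀ x (epochStart hMK T₀ x (ρ + 1)) s).S k)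
      (S' := (run hMK T₀ x (epochStart hMK T₀ x (ρ + 1) + K) s).S k)
      (N := (run hMK T₀ x (epochStart hMK T₀ x (ρ + 1)) s).N k) (w := w)
      (by exact_mod_cast (by omega : 0 < _)) (by positivity) (by positivity)
      (by exact_mod_cast hSN) (by exact_mod_cast hS.1)
      (by exact_mod_cast (by omega : _ ≤ _))
    gcongr

/-- The strings of one sender in one epoch have total length `O(K)`, up to a telescoping term. -/
theorem sum_length_le {ρ : ℕ} (hρ : ρ < E) (s : Fin M) :
    ((∑ k, (bitString ((run hMK T₀ x (epochStart hMK T₀ x ρ + K) s).delta k)).length : ℕ) : ℝ) ≤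
      19 * K + 16 * Real.sqrt (Real.sqrt E) / Real.sqrt K *
        ((∑ k, Real.sqrt ((run hMK T₀ x (epochStart hMK T₀ x (ρ + 1)) s).N k)) -
          ∑ k, Real.sqrt ((run hMK T₀ x (epochStart hMK T₀ x ρ) s).N k)) := by
  have hK : (0 : ℝ) < K := by exact_mod_cast (by omega : 0 < K)
  have hEpos : (0 : ℝ) < E := by exact_mod_cast hE.1
  have hρE : ((ρ : ℝ) + 1) ≤ E := by exact_mod_cast hρ
  push_cast
  rw [← Finset.sum_sub_distrib, Finset.mul_sum]
  have hcard : (19 * K : ℝ) = ∑ _k : Fin K, (19 : ℝ) := by simp; ring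
  rw [hcard, ← Finset.sum_add_distrib]
  refine Finset.sum_le_sum fun k _ => ?_
  have hN1 := (run_NS_comm hMK x hM hE hρ s k).1
  have hN2 := run_N_explored hMK x hM hE hρ s k
  have hle := le_run_N hMK x hM hE ρ hρ.le s k
  have hd := abs_delta_le hMK x hM hE hρ s k hN2
  rw [hN1]
  set N' := (run hMK T₀ x (epochStart hMK T₀ x ρ + K) s).N k
  set N := (run hMK T₀ x (epochStart hMK T₀ x ρ) s).N k
  set w : ℕ := 1 + if k = hungarian hMK (shared hMK T₀ x ρ) s then K else 0 with hw
  have hN'pos : (0 : ℝ) < N' := by exact_mod_cast (by omega : 0 < N')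
  have hlen := length_bitString_le (by positivity) hd
  have hmono : Real.sqrt N ≤ Real.sqrt N' := Real.sqrt_le_sqrt (by exact_mod_cast (by omega : N ≤ N'))
  have hsplit : Real.sqrt (4 * Real.sqrt (ρ + 1) * (w / N')) =
      2 * Real.sqrt (Real.sqrt (ρ + 1)) * Real.sqrt (w / N') := by
    rw [Real.sqrt_mul (by positivity), Real.sqrt_mul (by norm_num),
      show (4 : ℝ) = 2 ^ 2 by norm_num, Real.sqrt_sq (by norm_num)]
  rw [hsplit] at hlen
  have he : Real.sqrt (Real.sqrt (ρ + 1)) ≤ Real.sqrt (Real.sqrt E) :=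
    Real.sqrt_le_sqrt (Real.sqrt_le_sqrt hρE)
  -- For the matched arm the string may be long, but `N' - N = w ≥ K` and `w ≤ 2 √N' (√N' - √N)`
  -- bound `√(w / N')` by an increment of `√N`.
  by_cases hk : k = hungarian hMK (shared hMK T₀ x ρ) s
  · have hw' : (w : ℝ) = 1 + K := by rw [hw, if_pos hk]; push_cast; rfl
    have hwN : (N' : ℝ) = N + w := by exact_mod_cast hN2
    have hKw : (K : ℝ) ≤ w := by linarith
    have hwpos : (0 : ℝ) < w := by linarith
    have h1 : Real.sqrt (w / N') ≤ 2 / Real.sqrt K * (Real.sqrt N' - Real.sqrt N) := by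
      have hsw : 0 < Real.sqrt w := Real.sqrt_pos.2 hwpos
      have hsN : 0 < Real.sqrt N' := Real.sqrt_pos.2 hN'pos
      have h2 : (w : ℝ) ≤ 2 * Real.sqrt N' * (Real.sqrt N' - Real.sqrt N) := by
        have e1 := Real.mul_self_sqrt hN'pos.le
        have e2 := Real.mul_self_sqrt (Nat.cast_nonneg N : (0 : ℝ) ≤ N)
        nlinarith [sq_nonneg (Real.sqrt N' - Real.sqrt N)]
      calc Real.sqrt (w / N') = Real.sqrt w / Real.sqrt N' := Real.sqrt_div hwpos.le _
        _ ≤ 2 / Real.sqrt w * (Real.sqrt N' - Real.sqrt N) := by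
          rw [div_mul_eq_mul_div, div_le_div_iff₀ hsN hsw, Real.mul_self_sqrt hwpos.le]
          linarith
        _ ≤ _ := by
          refine mul_le_mul_of_nonneg_right ?_ (sub_nonneg.2 hmono)
          exact div_le_div_of_nonneg_left (by norm_num) (Real.sqrt_pos.2 hK)
            (Real.sqrt_le_sqrt hKw)
    have h3 : Real.sqrt (Real.sqrt (ρ + 1)) * Real.sqrt (w / N') ≤
        Real.sqrt (Real.sqrt E) * (2 / Real.sqrt K * (Real.sqrt N' - Real.sqrt N)) :=
      mul_le_mul he h1 (Real.sqrt_nonneg _) (Real.sqrt_nonneg _)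
    have h4 : 16 * Real.sqrt (Real.sqrt E) / Real.sqrt K * (Real.sqrt N' - Real.sqrt N) =
        8 * (Real.sqrt (Real.sqrt E) * (2 / Real.sqrt K * (Real.sqrt N' - Real.sqrt N))) := by
      ring
    rw [h4]
    linarith
  -- For an arm that is only hinted, `N' ≥ ρ + 1` makes the square-root part at most `8`, and `11 +
  -- 8 = 19`.
  · have hw' : w = 1 := by rw [hw, if_neg hk]
    have hρN : (ρ : ℝ) + 1 ≤ N' := by exact_mod_cast (by omega : ρ + 1 ≤ N')
    have h1 : Real.sqrt (Real.sqrt (ρ + 1)) * Real.sqrt (w / N') ≤ 1 := by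
      rw [hw', ← Real.sqrt_mul (Real.sqrt_nonneg _), Real.sqrt_le_left zero_le_one, Nat.cast_one,
        mul_one_div, one_pow, div_le_one hN'pos]
      refine le_trans ?_ hρN
      rw [Real.sqrt_le_left (by positivity)]
      nlinarith [(Nat.cast_nonneg ρ : (0 : ℝ) ≤ ρ)]
    have h2 : 0 ≤ 16 * Real.sqrt (Real.sqrt E) / Real.sqrt K * (Real.sqrt N' - Real.sqrt N) :=
      mul_nonneg (by positivity) (sub_nonneg.2 hmono)
    linarith

/-- Cauchy-Schwarz, since the counts of one agent add up to `2 K E`. -/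
theorem sum_sqrt_run_N_le (s : Fin M) :
    ∑ k, Real.sqrt ((run hMK T₀ x (epochStart hMK T₀ x E) s).N k) ≤ K * Real.sqrt (2 * E) := by
  have h1 : (∑ k, Real.sqrt ((run hMK T₀ x (epochStart hMK T₀ x E) s).N k)) ^ 2 ≤
      K * ∑ k, ((run hMK T₀ x (epochStart hMK T₀ x E) s).N k : ℝ) := by
    have := sq_sum_le_card_mul_sum_sq (s := Finset.univ)
      (f := fun k : Fin K => Real.sqrt ((run hMK T₀ x (epochStart hMK T₀ x E) s).N k))
    simpa using this
  have h2 : ∑ k, ((run hMK T₀ x (epochStart hMK T₀ x E) s).N k : ℝ) = 2 * K * E := by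
    exact_mod_cast sum_run_N hMK x hM hE E le_rfl s
  rw [h2] at h1
  have h3 : (K * Real.sqrt (2 * E)) ^ 2 = K * (2 * K * (E : ℝ)) := by
    rw [mul_pow, Real.sq_sqrt (by positivity)]; ring
  exact le_of_sq_le_sq (h1.trans h3.ge) (by positivity)

/-- Total cost of the communication phases, when a communication round of epoch `ρ` costs at most
`2 + reg ρ`. -/
theorem sum_comm_le (reg : ℕ → ℝ) (h0 : ∀ ρ, 0 ≤ reg ρ) (h1 : ∀ ρ, reg ρ ≤ M)
    (hME : (M : ℝ) ^ 2 ≤ E) :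
    ∑ ρ ∈ Finset.range E, commLength hMK T₀ x (epochStart hMK T₀ x ρ) * (2 + reg ρ) ≤
      110 * (M : ℝ) ^ 2 * K * E + 19 * (M : ℝ) ^ 2 * K * ∑ ρ ∈ Finset.range E, reg ρ := by
  have hM' : (1 : ℝ) ≤ M := by exact_mod_cast hM
  have hMK' : (M : ℝ) ≤ K := by exact_mod_cast hMK.le
  have hK : (0 : ℝ) < K := by linarith
  set Ψ : Fin M → ℕ → ℝ := fun s ρ =>
    ∑ k, Real.sqrt ((run hMK T₀ x (epochStart hMK T₀ x ρ) s).N k) with hΨ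
  set e := Real.sqrt (Real.sqrt E) with he
  set q := Real.sqrt K with hq
  have hqpos : 0 < q := Real.sqrt_pos.2 hK
  have he0 : 0 ≤ e := Real.sqrt_nonneg _
  have hee : e ^ 2 = Real.sqrt E := Real.sq_sqrt (Real.sqrt_nonneg _)
  have heeee : e ^ 4 = E := by
    rw [show e ^ 4 = (e ^ 2) ^ 2 by ring, hee, Real.sq_sqrt (by positivity)]
  have hqq : q ^ 2 = K := Real.sq_sqrt hK.le
  -- The regret is kept in the main part of the length, where its sum over the epochs matters; in
  -- the telescoping part the crude bound `2 + reg ρ ≤ 3 M` is enough.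
  have hstep : ∀ ρ ∈ Finset.range E, (commLength hMK T₀ x (epochStart hMK T₀ x ρ) : ℝ) *
      (2 + reg ρ) ≤ 19 * (M : ℝ) ^ 2 * K * (2 + reg ρ) +
        3 * (M : ℝ) ^ 2 * (16 * e / q) * ∑ s, (Ψ s (ρ + 1) - Ψ s ρ) := by
    intro ρ hρ
    have hρ := Finset.mem_range.1 hρ
    have hmono : 0 ≤ ∑ s, (Ψ s (ρ + 1) - Ψ s ρ) := by
      refine Finset.sum_nonneg fun s _ => sub_nonneg.2 (Finset.sum_le_sum fun k _ =>
        Real.sqrt_le_sqrt ?_)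
      rw [(run_NS_comm hMK x hM hE hρ s k).1, run_N_explored hMK x hM hE hρ]
      push_cast
      have : (0 : ℝ) ≤ if k = hungarian hMK (shared hMK T₀ x ρ) s then (K : ℝ) else 0 := by
        split_ifs <;> positivity
      linarith
    have hlen : (commLength hMK T₀ x (epochStart hMK T₀ x ρ) : ℝ) ≤
        M * (19 * M * K + 16 * e / q * ∑ s, (Ψ s (ρ + 1) - Ψ s ρ)) := by
      unfold commLength
      rw [Nat.cast_mul]
      refine mul_le_mul (by exact_mod_cast Nat.sub_le _ _) ?_ (by positivity) (by positivity)
      rw [Nat.cast_sum]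
      refine (Finset.sum_le_sum fun s _ => sum_length_le hMK x hM hE hρ s).trans (le_of_eq ?_)
      change ∑ s : Fin M, (19 * (K : ℝ) + 16 * e / q * (Ψ s (ρ + 1) - Ψ s ρ)) = _
      rw [Finset.sum_add_distrib, Finset.sum_const, Finset.card_univ, Fintype.card_fin,
        nsmul_eq_mul, ← Finset.mul_sum]
      ring
    have hr : 0 ≤ 2 + reg ρ := by linarith [h0 ρ]
    calc _ ≤ M * (19 * M * K + 16 * e / q * ∑ s, (Ψ s (ρ + 1) - Ψ s ρ)) * (2 + reg ρ) :=
          mul_le_mul_of_nonneg_right hlen hr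
      _ = 19 * (M : ℝ) ^ 2 * K * (2 + reg ρ) +
          M * (16 * e / q * ∑ s, (Ψ s (ρ + 1) - Ψ s ρ)) * (2 + reg ρ) := by ring
      _ ≤ 19 * (M : ℝ) ^ 2 * K * (2 + reg ρ) +
          M * (16 * e / q * ∑ s, (Ψ s (ρ + 1) - Ψ s ρ)) * (3 * M) := by
          have : 2 + reg ρ ≤ 3 * M := by linarith [h1 ρ]
          gcongr
      _ = _ := by ring
  have htel : ∑ ρ ∈ Finset.range E, ∑ s, (Ψ s (ρ + 1) - Ψ s ρ) ≤ M * (K * Real.sqrt (2 * E)) := by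
    rw [Finset.sum_comm]
    calc _ ≤ ∑ _s : Fin M, (K * Real.sqrt (2 * E)) := by
          refine Finset.sum_le_sum fun s _ => ?_
          rw [Finset.sum_range_sub]
          have h2 : 0 ≤ Ψ s 0 := Finset.sum_nonneg fun _ _ => Real.sqrt_nonneg _
          linarith [sum_sqrt_run_N_le hMK x hM hE s]
      _ = _ := by simp
  have hs2 : Real.sqrt (2 * E) ≤ 1.5 * e ^ 2 := by
    rw [hee, Real.sqrt_mul (by norm_num)]
    have : Real.sqrt 2 ≤ 1.5 := by rw [Real.sqrt_le_left (by norm_num)]; norm_num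
    exact mul_le_mul_of_nonneg_right this (Real.sqrt_nonneg _)
  -- From `M ≤ K` and `M² ≤ E`. This pays for the additional factor `M` of the telescoping part,
  -- whose total becomes `3 * 16 * 1.5 = 72` times `M² K E`.
  have hMqe : (M : ℝ) ≤ q * e := by
    have h2 : (M : ℝ) ≤ e ^ 2 := by rw [hee]; exact Real.le_sqrt_of_sq_le hME
    refine le_of_sq_le_sq ?_ (by positivity)
    calc (M : ℝ) ^ 2 = M * M := sq _
      _ ≤ K * e ^ 2 := mul_le_mul hMK' h2 (by positivity) hK.le
      _ = _ := by rw [mul_pow, hqq]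
  have hextra : 3 * (M : ℝ) ^ 2 * (16 * e / q) * (M * (K * Real.sqrt (2 * E))) ≤
      72 * (M : ℝ) ^ 2 * K * E := by
    calc _ ≤ 3 * (M : ℝ) ^ 2 * (16 * e / q) * ((q * e) * (K * (1.5 * e ^ 2))) := by gcongr
      _ = 72 * (M : ℝ) ^ 2 * K * e ^ 4 := by field_simp; ring
      _ = _ := by rw [heeee]
  calc _ ≤ ∑ ρ ∈ Finset.range E, (19 * (M : ℝ) ^ 2 * K * (2 + reg ρ) +
        3 * (M : ℝ) ^ 2 * (16 * e / q) * ∑ s, (Ψ s (ρ + 1) - Ψ s ρ)) := Finset.sum_le_sum hstep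
    _ = 38 * (M : ℝ) ^ 2 * K * E + 19 * (M : ℝ) ^ 2 * K * ∑ ρ ∈ Finset.range E, reg ρ +
        3 * (M : ℝ) ^ 2 * (16 * e / q) *
          ∑ ρ ∈ Finset.range E, ∑ s, (Ψ s (ρ + 1) - Ψ s ρ) := by
        rw [Finset.sum_add_distrib, ← Finset.mul_sum, ← Finset.mul_sum, Finset.sum_add_distrib]
        simp
        ring
    _ ≤ 38 * (M : ℝ) ^ 2 * K * E + 19 * (M : ℝ) ^ 2 * K * ∑ ρ ∈ Finset.range E, reg ρ +
        3 * (M : ℝ) ^ 2 * (16 * e / q) * (M * (K * Real.sqrt (2 * E))) := by gcongr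
    _ ≤ _ := by linarith

end Lengths

end HMA2B

namespace HMA2B

variable {M K : ℕ} (hMK : M < K)

/-! ### Costs along the schedule -/

theorem not_isCommRound_of_explore {σ : Fin M → Memory M K} {j : ℕ}
    (h : ∀ m, (σ m).phase = .explore j) : ¬ IsCommRound σ := by
  rintro ⟨m, hm⟩
  rw [h m] at hm
  exact hm

theorem not_isCommRound_of_exploit {σ : Fin M → Memory M K}
    (h : ∀ m, (σ m).phase = .exploit) : ¬ IsCommRound σ := by
  rintro ⟨m, hm⟩
  rw [h m] at hm
  exact hm

theorem hintArm_of_isComm {m : Fin M} {t : ℕ} {s : Memory M K} (h : s.phase.IsComm) :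
    s.hintArm hMK m t = none := by
  unfold Memory.hintArm
  split
  · rename_i h2; rw [h2] at h; exact h.elim
  · rfl

section Pathwise

variable {T₀ : ℝ} (x : ℕ → Fin M → Fin K → Bool) {E : ℕ} (hM : 1 ≤ M) (hE : IsEpochCount K T₀ E)
  {μ : Fin M → Fin K → ℝ} {gs : Fin M → Fin K} (T : ℕ)
include hM hE

theorem sum_hints_le :
    ∑ t ∈ Finset.range T, ∑ m : Fin M,
      (if ((run hMK T₀ x t m).hintArm hMK m t).isSome = true then (1 : ℝ) else 0) ≤ M * K * E := by
  set f : ℕ → ℝ := fun t => ∑ m : Fin M,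
      (if ((run hMK T₀ x t m).hintArm hMK m t).isSome = true then (1 : ℝ) else 0) with hf
  have hf0 : ∀ t, 0 ≤ f t := fun t => Finset.sum_nonneg fun m _ => by split_ifs <;> simp
  have hfM : ∀ t, f t ≤ M := by
    intro t
    calc f t ≤ ∑ _m : Fin M, (1 : ℝ) :=
          Finset.sum_le_sum fun m _ => by split_ifs <;> simp
      _ = M := by simp
  refine (sum_rounds_le hMK (T₀ := T₀) x f hf0 E T).trans ?_
  have h2 : ∑ j ∈ Finset.range T, f (epochStart hMK T₀ x E + j) = 0 := by
    refine Finset.sum_eq_zero fun j _ => Finset.sum_eq_zero fun m _ => ?_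
    have h := (run_exploit hMK x hM hE j).2 m
    rw [if_neg]
    unfold Memory.hintArm
    simp [h]
  rw [h2, add_zero]
  calc _ ≤ ∑ _ρ ∈ Finset.range E, ((K : ℝ) * M) := by
        refine Finset.sum_le_sum fun ρ hρ => ?_
        have h3 : ∑ j ∈ Finset.range (commLength hMK T₀ x (epochStart hMK T₀ x ρ)),
            f (epochStart hMK T₀ x ρ + K + j) = 0 := by
          refine Finset.sum_eq_zero fun j hj => Finset.sum_eq_zero fun m _ => ?_
          rw [hintArm_of_isComm hMK ((epoch_comm hMK x hM hE (Finset.mem_range.1 hρ)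
            (Finset.mem_range.1 hj)).comm m)]
          simp
        rw [h3, add_zero]
        calc _ ≤ ∑ _j ∈ Finset.range K, (M : ℝ) := Finset.sum_le_sum fun j _ => hfM _
          _ = K * M := by simp
    _ = M * K * E := by simp; ring

theorem sum_exploration_le (hgs : IsUniqueOptimal μ gs) :
    ∑ t ∈ Finset.range T, (if IsCommRound (run hMK T₀ x t) then 0
      else utility μ gs - utility μ (pulls (run hMK T₀ x t))) ≤
    K * ∑ ρ ∈ Finset.range E, (utility μ gs - utility μ (hungarian hMK (shared hMK T₀ x ρ))) +
      T * (utility μ gs - utility μ (hungarian hMK (shared hMK T₀ x E))) := by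
  set f : ℕ → ℝ := fun t => if IsCommRound (run hMK T₀ x t) then 0
      else utility μ gs - utility μ (pulls (run hMK T₀ x t)) with hf
  have hf0 : ∀ t, 0 ≤ f t := by
    intro t
    simp only [hf]
    split_ifs
    · exact le_rfl
    · exact hgs.regret_nonneg _
  refine (sum_rounds_le hMK (T₀ := T₀) x f hf0 E T).trans (le_of_eq ?_)
  rw [Finset.mul_sum]
  congr 1
  · refine Finset.sum_congr rfl fun ρ hρ => ?_
    have hρ := Finset.mem_range.1 hρ
    have h1 : ∑ j ∈ Finset.range (commLength hMK T₀ x (epochStart hMK T₀ x ρ)),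
        f (epochStart hMK T₀ x ρ + K + j) = 0 := by
      refine Finset.sum_eq_zero fun j hj => if_pos ⟨⟨0, hM⟩, ?_⟩
      exact (epoch_comm hMK x hM hE hρ (Finset.mem_range.1 hj)).comm _
    have h2 : ∀ j ∈ Finset.range K, f (epochStart hMK T₀ x ρ + j) =
        utility μ gs - utility μ (hungarian hMK (shared hMK T₀ x ρ)) := by
      intro j hj
      have h3 := epoch_explore hMK x hM hE hρ (Finset.mem_range.1 hj)
      simp only [hf]
      rw [if_neg (not_isCommRound_of_explore h3.2),
        h3.1.pulls_eq hMK fun m => Or.inl ⟨j, h3.2 m⟩]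
    rw [h1, add_zero, Finset.sum_congr rfl h2, Finset.sum_const, Finset.card_range, nsmul_eq_mul]
  · have h2 : ∀ j ∈ Finset.range T, f (epochStart hMK T₀ x E + j) =
        utility μ gs - utility μ (hungarian hMK (shared hMK T₀ x E)) := by
      intro j _
      have h3 := run_exploit hMK x hM hE j
      simp only [hf]
      rw [if_neg (not_isCommRound_of_exploit h3.2), h3.1.pulls_eq hMK fun m => Or.inr (h3.2 m)]
    rw [Finset.sum_congr rfl h2, Finset.sum_const, Finset.card_range, nsmul_eq_mul]

theorem sum_communication_le (hμ : ∀ m k, μ m k ∈ Set.Icc (0 : ℝ) 1)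
    (hgs : IsUniqueOptimal μ gs) :
    ∑ t ∈ Finset.range T, (if IsCommRound (run hMK T₀ x t) then
      utility μ gs - utility μ (pulls (run hMK T₀ x t)) else 0) ≤
    ∑ ρ ∈ Finset.range E, commLength hMK T₀ x (epochStart hMK T₀ x ρ) *
      (2 + (utility μ gs - utility μ (hungarian hMK (shared hMK T₀ x ρ)))) := by
  set f : ℕ → ℝ := fun t => if IsCommRound (run hMK T₀ x t) then
      utility μ gs - utility μ (pulls (run hMK T₀ x t)) else 0 with hf
  have hf0 : ∀ t, 0 ≤ f t := by
    intro t
    simp only [hf]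
    split_ifs
    · exact hgs.regret_nonneg _
    · exact le_rfl
  refine (sum_rounds_le hMK (T₀ := T₀) x f hf0 E T).trans ?_
  have h2 : ∑ j ∈ Finset.range T, f (epochStart hMK T₀ x E + j) = 0 :=
    Finset.sum_eq_zero fun j _ =>
      if_neg (not_isCommRound_of_exploit (run_exploit hMK x hM hE j).2)
  rw [h2, add_zero]
  refine Finset.sum_le_sum fun ρ hρ => ?_
  have hρ := Finset.mem_range.1 hρ
  have h3 : ∑ j ∈ Finset.range K, f (epochStart hMK T₀ x ρ + j) = 0 :=
    Finset.sum_eq_zero fun j hj => if_neg (not_isCommRound_of_explore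
      (epoch_explore hMK x hM hE hρ (Finset.mem_range.1 hj)).2)
  rw [h3, zero_add]
  calc _ ≤ ∑ _j ∈ Finset.range (commLength hMK T₀ x (epochStart hMK T₀ x ρ)),
        (2 + (utility μ gs - utility μ (hungarian hMK (shared hMK T₀ x ρ)))) := by
        refine Finset.sum_le_sum fun j hj => ?_
        have hc := epoch_comm hMK x hM hE hρ (Finset.mem_range.1 hj)
        simp only [hf]
        rw [if_pos ⟨⟨0, hM⟩, hc.comm _⟩]
        exact hc.regret_le hμ
    _ = _ := by rw [Finset.sum_const, Finset.card_range, nsmul_eq_mul]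

/-- The first `K` rounds are exploration. -/
theorem sum_communication_eq_zero (hT : T ≤ K) :
    ∑ t ∈ Finset.range T, (if IsCommRound (run hMK T₀ x t) then
      utility μ gs - utility μ (pulls (run hMK T₀ x t)) else 0) = 0 := by
  refine Finset.sum_eq_zero fun t ht => if_neg ?_
  have h := epoch_explore hMK x hM hE hE.1 (lt_of_lt_of_le (Finset.mem_range.1 ht) hT)
  simp only [epochStart, zero_add] at h
  exact not_isCommRound_of_explore h.2

end Pathwise

/-! ### Regret of the shared matchings -/

variable {Ω : Type*} {T₀ : ℝ} {E : ℕ} {μ : Fin M → Fin K → ℝ}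
  {gs : Fin M → Fin K} {X : ℕ → Ω → Fin M → Fin K → Bool}

/-- The statistics of epoch `ρ` rest on at least `ρ` observations per arm, so outside the deviation
event they are `ε`-accurate up to rounding, which costs at most `1 / (2 √ρ)` per agent. -/
theorem regret_shared_le (hM : 1 ≤ M) (hE : IsEpochCount K T₀ E)
    (hμ : ∀ m k, μ m k ∈ Set.Icc (0 : ℝ) 1) (hgs : IsUniqueOptimal μ gs) {ρ : ℕ} (hρ : 1 ≤ ρ)
    (hρE : ρ ≤ E) {r ε : ℝ} (hr : r ≤ ρ) {ω : Ω} (hω : ω ∉ deviation μ hMK T₀ X r ε) :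
    utility μ gs - utility μ (hungarian hMK (shared hMK T₀ (fun i => X i ω) ρ)) ≤
      M / (2 * Real.sqrt ρ) + 2 * M * ε := by
  obtain ⟨ρ', rfl⟩ : ∃ ρ', ρ = ρ' + 1 := ⟨ρ - 1, by omega⟩
  set x : ℕ → Fin M → Fin K → Bool := fun i => X i ω
  have hmean : ∀ m k, |(((run hMK T₀ x (epochStart hMK T₀ x ρ' + K) m).mean k : ℚ) : ℝ) - μ m k| ≤
      ε := by
    intro m k
    have hN : ρ' + 1 ≤ (run hMK T₀ x (epochStart hMK T₀ x ρ' + K) m).N k := by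
      rw [← (run_NS_comm hMK x hM hE (show ρ' < E by omega) m k).1]
      exact le_run_N hMK x hM hE _ hρE m k
    have hN' : (((ρ' + 1 : ℕ)) : ℝ) ≤ (run hMK T₀ x (epochStart hMK T₀ x ρ' + K) m).N k := by
      exact_mod_cast hN
    have hpos : (0 : ℝ) < (run hMK T₀ x (epochStart hMK T₀ x ρ' + K) m).N k :=
      lt_of_lt_of_le (by positivity) hN'
    have h1 : ¬ Deviates μ r ε (run hMK T₀ x (epochStart hMK T₀ x ρ' + K)) m k :=
      fun h => hω ⟨_, m, k, h⟩
    unfold Deviates at h1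
    push Not at h1
    have h2 := h1 (hr.trans hN')
    unfold Memory.mean
    push_cast
    rw [show ((run hMK T₀ x (epochStart hMK T₀ x ρ' + K) m).S k : ℝ) /
        (run hMK T₀ x (epochStart hMK T₀ x ρ' + K) m).N k - μ m k =
        ((run hMK T₀ x (epochStart hMK T₀ x ρ' + K) m).S k -
          μ m k * (run hMK T₀ x (epochStart hMK T₀ x ρ' + K) m).N k) /
        (run hMK T₀ x (epochStart hMK T₀ x ρ' + K) m).N k by field_simp,
      abs_div, abs_of_pos hpos, div_le_iff₀ hpos]
    exact h2
  refine (regret_hungarian_le hMK hμ hgs (quantBits (ρ' + 1)) _ hmean).trans ?_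
  have hs : 0 < 2 * Real.sqrt ((ρ' + 1 : ℕ) : ℝ) := by positivity
  have : (M : ℝ) * (1 / 2 ^ quantBits (ρ' + 1)) ≤ M / (2 * Real.sqrt ((ρ' + 1 : ℕ) : ℝ)) := by
    rw [mul_one_div]
    exact div_le_div_of_nonneg_left (by positivity) hs (le_two_pow_quantBits (by omega))
  linarith

/-- A regret below the gap is zero. -/
theorem regret_shared_eq_zero (hM : 1 ≤ M) (hE : IsEpochCount K T₀ E)
    (hμ : ∀ m k, μ m k ∈ Set.Icc (0 : ℝ) 1) (hgs : IsUniqueOptimal μ gs) {ρ : ℕ} (hρ : 1 ≤ ρ)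
    (hρE : ρ ≤ E) {r ε : ℝ} (hr : r ≤ ρ)
    (hε : M / (2 * Real.sqrt ρ) + 2 * M * ε < minGap μ gs) {ω : Ω}
    (hω : ω ∉ deviation μ hMK T₀ X r ε) :
    utility μ gs - utility μ (hungarian hMK (shared hMK T₀ (fun i => X i ω) ρ)) = 0 := by
  have h := regret_shared_le hMK hM hE hμ hgs hρ hρE hr hω
  by_cases heq : (hungarian hMK (shared hMK T₀ (fun i => X i ω) ρ) : Fin M → Fin K) = gs
  · rw [heq, sub_self]
  · linarith [minGap_le (μ := μ) heq]

/-- As `f ≥ 0`, only the majorant has to be integrable. -/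
theorem integral_le_of_indicators [MeasurableSpace Ω] {P : Measure Ω} [IsProbabilityMeasure P]
    {f : Ω → ℝ} (hf : ∀ ω, 0 ≤ f ω) (a d d' : ℝ)
    (B : ℕ → Set Ω) (B' : Set Ω) (hB : ∀ ρ, MeasurableSet (B ρ)) (hB' : MeasurableSet B')
    (I : Finset ℕ)
    (h : ∀ ω, f ω ≤ a + d * ∑ ρ ∈ I, (B ρ).indicator 1 ω + d' * B'.indicator 1 ω) :
    ∫ ω, f ω ∂P ≤ a + d * ∑ ρ ∈ I, P.real (B ρ) + d' * P.real B' := by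
  have hi : ∀ {S : Set Ω}, MeasurableSet S → Integrable (S.indicator (1 : Ω → ℝ)) P :=
    fun hS => (integrable_const (1 : ℝ)).indicator hS
  have hsum : Integrable (fun ω => ∑ ρ ∈ I, (B ρ).indicator (1 : Ω → ℝ) ω) P :=
    integrable_finsetSum _ fun ρ _ => hi (hB ρ)
  have h1 : Integrable (fun ω => a + d * ∑ ρ ∈ I, (B ρ).indicator (1 : Ω → ℝ) ω) P :=
    (integrable_const a).add (hsum.const_mul d)
  have h2 : Integrable (fun ω => d' * B'.indicator (1 : Ω → ℝ) ω) P := (hi hB').const_mul d'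
  calc ∫ ω, f ω ∂P ≤ ∫ ω, (a + d * ∑ ρ ∈ I, (B ρ).indicator 1 ω + d' * B'.indicator 1 ω) ∂P :=
        integral_mono_of_nonneg (Filter.Eventually.of_forall hf) (h1.add h2)
          (Filter.Eventually.of_forall h)
    _ = _ := by
        rw [integral_add h1 h2, integral_add (integrable_const a) (hsum.const_mul d),
          integral_const_mul, integral_const_mul, integral_finsetSum _ fun ρ _ => hi (hB ρ),
          integral_indicator_one hB']
        simp only [integral_indicator_one (hB _), integral_const, probReal_univ, one_smul]

end HMA2B

/-! ### Elementary sums, and the expected regrets of exploration and communication. -/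

namespace HMA2B

variable {M K : ℕ} (hMK : M < K)

theorem isEpochCount_ceil {A : ℝ} (hA : 0 < A) (hK : 0 < K) : IsEpochCount K (A * K) ⌈A⌉₊ := by
  refine ⟨Nat.ceil_pos.2 hA, fun ρ => ?_⟩
  have hK' : (0 : ℝ) < K := by exact_mod_cast hK
  rw [Nat.lt_ceil, Nat.cast_mul, mul_lt_mul_iff_left₀ hK']

/-- A geometric series whose ratio is at most `1 / (1 + a)`. -/
theorem sum_exp_neg_le {a : ℝ} (ha : 0 < a) (n : ℕ) :
    ∑ ρ ∈ Finset.range n, Real.exp (-(a * ρ)) ≤ 1 + 1 / a := by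
  have h1 : Real.exp (-a) ≤ 1 / (1 + a) := by
    rw [Real.exp_neg, ← one_div]
    exact one_div_le_one_div_of_le (by linarith) (by linarith [Real.add_one_le_exp a])
  have h2 : ∀ ρ ∈ Finset.range n, Real.exp (-(a * ρ)) = Real.exp (-a) ^ ρ := by
    intro ρ _
    rw [← Real.exp_nat_mul]
    congr 1
    ring
  rw [Finset.sum_congr rfl h2]
  have h3 := mul_neg_geom_sum (Real.exp (-a)) n
  have h4 : 0 ≤ Real.exp (-a) ^ n := by positivity
  have h5 : a / (1 + a) ≤ 1 - Real.exp (-a) := by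
    have : a / (1 + a) = 1 - 1 / (1 + a) := by field_simp; ring
    linarith
  have h6 : 0 < a / (1 + a) := by positivity
  have h7 : 1 + 1 / a = 1 / (a / (1 + a)) := by field_simp; ring
  have h8 : 0 ≤ ∑ i ∈ Finset.range n, Real.exp (-a) ^ i :=
    Finset.sum_nonneg fun _ _ => by positivity
  rw [h7, le_div_iff₀ h6]
  nlinarith

/-- Each term is at most `2 (√(n + 1) - √n)`. -/
theorem sum_one_div_sqrt_le (n : ℕ) :
    ∑ ρ ∈ Finset.range n, 1 / Real.sqrt (ρ + 1) ≤ 2 * Real.sqrt n := by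
  induction n with
  | zero => simp
  | succ n ih =>
    rw [Finset.sum_range_succ]
    have hpos : 0 < Real.sqrt ((n : ℝ) + 1) := Real.sqrt_pos.2 (by positivity)
    have e1 := Real.mul_self_sqrt (show (0 : ℝ) ≤ (n : ℝ) + 1 by positivity)
    have e2 := Real.mul_self_sqrt (show (0 : ℝ) ≤ (n : ℝ) by positivity)
    have h : 1 / Real.sqrt ((n : ℝ) + 1) ≤ 2 * (Real.sqrt ((n : ℝ) + 1) - Real.sqrt n) := by
      rw [div_le_iff₀ hpos]
      nlinarith [sq_nonneg (Real.sqrt ((n : ℝ) + 1) - Real.sqrt n)]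
    push_cast
    linarith

theorem sq_mul_exp_neg_le {y : ℝ} (hy : 0 ≤ y) : y ^ 2 * Real.exp (-y) ≤ 2 := by
  have h := Real.quadratic_le_exp_of_nonneg hy
  rw [Real.exp_neg, ← div_eq_mul_inv, div_le_iff₀ (Real.exp_pos _)]
  nlinarith

variable {Ω : Type*} [MeasurableSpace Ω] {P : Measure Ω} [IsProbabilityMeasure P]
  {μ : Fin M → Fin K → ℝ} {gs : Fin M → Fin K} {X : ℕ → Ω → Fin M → Fin K → Bool}
  {T : ℕ} {Δ L A : ℝ}

theorem half_lt_log (hM : 1 ≤ M) (hT : 1 ≤ T) : 1 / 2 < Real.log (2 * M * T) := by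
  have h1 : (1 : ℝ) ≤ M := by exact_mod_cast hM
  have h2 : (1 : ℝ) ≤ T := by exact_mod_cast hT
  have h3 : Real.log 2 ≤ Real.log (2 * M * T) := by
    refine Real.log_le_log (by norm_num) ?_
    nlinarith [mul_le_mul h1 h2 zero_le_one (by linarith)]
  linarith [Real.log_two_gt_d9]

theorem explorationRegret_le (hM : 1 ≤ M) (hT : 1 ≤ T) (hμ : ∀ m k, μ m k ∈ Set.Icc (0 : ℝ) 1)
    (hgs : IsUniqueOptimal μ gs) (hX : IsRewardProcess P μ X) (hΔ : Δ = minGap μ gs)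
    (hL : L = Real.log (2 * M * T)) (hA : A = 9 * (M : ℝ) ^ 2 * L / Δ ^ 2) :
    explorationRegret P hMK (A * K) T μ gs X ≤ 108 * ((M : ℝ) ^ 3 * (K : ℝ) ^ 2 / Δ ^ 2) := by
  have hM' : (1 : ℝ) ≤ M := by exact_mod_cast hM
  have hT' : (1 : ℝ) ≤ T := by exact_mod_cast hT
  have hMK' : (M : ℝ) ≤ K := by exact_mod_cast hMK.le
  have hK' : (1 : ℝ) ≤ K := hM'.trans hMK'
  have hΔ0 : 0 < Δ := hΔ ▸ minGap_pos hM hMK hgs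
  have hΔ1 : Δ ≤ 1 := hΔ ▸ minGap_le_one hM hMK hμ hgs
  have hL0 : 1 / 2 < L := hL ▸ half_lt_log hM hT
  -- This is `ε²` for `ε = Δ / (3 M)`: estimation costs `2 M ε = 2 Δ / 3`, which leaves `Δ / 3` for
  -- rounding. Moreover `A = L / a`, so that `exp (-a A) = 1 / (2 M T)`.
  set a : ℝ := Δ ^ 2 / (9 * (M : ℝ) ^ 2) with ha
  have ha0 : 0 < a := by positivity
  have ha1 : 9 ≤ 1 / a := by
    rw [ha, one_div_div, le_div_iff₀ (by positivity)]
    nlinarith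
  have hA' : A = L / a := by rw [hA, ha]; field_simp
  have hA0 : 0 < A := by rw [hA']; positivity
  have hE := isEpochCount_ceil (K := K) hA0 (by omega)
  set E := ⌈A⌉₊ with hEdef
  have hAE : A ≤ E := Nat.le_ceil A
  set ε : ℝ := Δ / (3 * M) with hε
  have hεa : ε ^ 2 = a := by rw [hε, ha]; field_simp; norm_num
  have hε0 : 0 ≤ ε := by positivity
  have hMε : M * ε = Δ / 3 := by rw [hε]; field_simp
  have hsmall : ∀ ρ : ℕ, 1 / (4 * a) < ρ →
      M / (2 * Real.sqrt ρ) + 2 * M * ε < minGap μ gs := by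
    intro ρ hρ
    rw [← hΔ]
    have h1 : 3 * M / (2 * Δ) < Real.sqrt ρ := by
      refine Real.lt_sqrt_of_sq_lt (lt_of_eq_of_lt ?_ hρ)
      rw [ha]; field_simp; norm_num
    have h0 : 0 < Real.sqrt ρ := lt_of_le_of_lt (by positivity) h1
    have h2 : M / (2 * Real.sqrt ρ) < Δ / 3 := by
      rw [div_lt_div_iff₀ (by positivity) (by norm_num)]
      rw [div_lt_iff₀ (by positivity)] at h1
      linarith
    linarith
  have hpos : ∀ ρ : ℕ, 1 / (4 * a) < ρ → 1 ≤ ρ := by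
    intro ρ hρ
    have : (0 : ℝ) < ρ := lt_trans (by positivity) hρ
    exact_mod_cast this
  set B : ℕ → Set Ω := fun ρ => deviation μ hMK (A * K) X ρ ε with hB
  set B' : Set Ω := deviation μ hMK (A * K) X A ε with hB'
  set reg : Ω → ℕ → ℝ := fun ω ρ =>
    utility μ gs - utility μ (hungarian hMK (shared hMK (A * K) (fun i => X i ω) ρ)) with hreg
  have hKa : 1 / (4 * a) < 2 * K / a := by
    rw [div_lt_div_iff₀ (by positivity) ha0]
    nlinarith
  have hregI : ∀ ω, ∀ ρ < E, 2 * K / a ≤ ρ → reg ω ρ ≤ M * (B ρ).indicator 1 ω := by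
    intro ω ρ hρ hρK
    by_cases hω : ω ∈ B ρ
    · rw [Set.indicator_of_mem hω, Pi.one_apply, mul_one]
      exact regret_le hμ _
    · rw [Set.indicator_of_notMem hω, mul_zero]
      exact (regret_shared_eq_zero hMK hM hE hμ hgs (hpos ρ (hKa.trans_le hρK)) hρ.le le_rfl
        (hsmall ρ (hKa.trans_le hρK)) hω).le
  have hregE : ∀ ω, reg ω E ≤ M * B'.indicator 1 ω := by
    intro ω
    have hlt : 1 / (4 * a) < E := by
      refine lt_of_lt_of_le ?_ hAE
      rw [hA', div_lt_div_iff₀ (by positivity) ha0]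
      nlinarith
    by_cases hω : ω ∈ B'
    · rw [Set.indicator_of_mem hω, Pi.one_apply, mul_one]
      exact regret_le hμ _
    · rw [Set.indicator_of_notMem hω, mul_zero]
      exact (regret_shared_eq_zero hMK hM hE hμ hgs (hpos E hlt) le_rfl hAE (hsmall E hlt) hω).le
  -- The epochs are cut at `2 K / a`: the early ones are paid in full, and in the late ones `a ρ / 2
  -- ≥ K`, so half of the exponent absorbs the factor `2 M K` of the union bound.
  set I : Finset ℕ := (Finset.range E).filter fun ρ : ℕ => 2 * K / a ≤ (ρ : ℝ) with hI
  set J : Finset ℕ := (Finset.range E).filter fun ρ : ℕ => ¬ 2 * K / a ≤ (ρ : ℝ) with hJ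
  have hJcard : (J.card : ℝ) ≤ 2 * K / a + 1 := by
    have hsub : J ⊆ Finset.range ⌈2 * K / a⌉₊ := by
      intro ρ hρ
      rw [hJ, Finset.mem_filter, not_le] at hρ
      exact Finset.mem_range.2 (Nat.lt_ceil.2 hρ.2)
    have h1 : J.card ≤ ⌈2 * K / a⌉₊ := by simpa using Finset.card_le_card hsub
    have h2 := (Nat.ceil_lt_add_one (show 0 ≤ 2 * K / a by positivity)).le
    exact le_trans (by exact_mod_cast h1) h2
  have hsumreg : ∀ ω, ∑ ρ ∈ Finset.range E, reg ω ρ ≤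
      M * (2 * K / a + 1) + M * ∑ ρ ∈ I, (B ρ).indicator 1 ω := by
    intro ω
    rw [← Finset.sum_filter_add_sum_filter_not _ fun ρ : ℕ => 2 * K / a ≤ (ρ : ℝ), add_comm]
    refine add_le_add ?_ ?_
    · calc ∑ ρ ∈ J, reg ω ρ ≤ ∑ _ρ ∈ J, (M : ℝ) := Finset.sum_le_sum fun ρ _ => regret_le hμ _
        _ = M * J.card := by rw [Finset.sum_const, nsmul_eq_mul, mul_comm]
        _ ≤ _ := by gcongr
    · rw [Finset.mul_sum]
      refine Finset.sum_le_sum fun ρ hρ => ?_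
      have hρ := Finset.mem_filter.1 hρ
      exact hregI ω ρ (Finset.mem_range.1 hρ.1) hρ.2
  have hint : explorationRegret P hMK (A * K) T μ gs X ≤
      K * (M * (2 * K / a + 1)) + K * M * ∑ ρ ∈ I, P.real (B ρ) + T * M * P.real B' := by
    unfold explorationRegret
    refine integral_le_of_indicators (fun ω => Finset.sum_nonneg fun t _ => ?_) _ _ _ B B'
      (fun ρ => measurableSet_deviation hMK hX _ _) (measurableSet_deviation hMK hX _ _) I
      fun ω => ?_
    · split_ifs
      · exact le_rfl
      · exact hgs.regret_nonneg _
    · refine (sum_exploration_le hMK _ hM hE T hgs).trans ?_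
      have h1 := mul_le_mul_of_nonneg_left (hsumreg ω) (Nat.cast_nonneg K : (0 : ℝ) ≤ K)
      have h2 := mul_le_mul_of_nonneg_left (hregE ω) (Nat.cast_nonneg T : (0 : ℝ) ≤ T)
      simp only [hreg] at h1 h2
      linarith
  have hPI : ∑ ρ ∈ I, P.real (B ρ) ≤ 4 * (1 + 1 / (a / 2)) := by
    calc ∑ ρ ∈ I, P.real (B ρ) ≤ ∑ ρ ∈ I, 4 * Real.exp (-(a / 2 * ρ)) := by
          refine Finset.sum_le_sum fun ρ hρ => ?_
          have hρ := (Finset.mem_filter.1 hρ).2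
          refine (measure_deviation_le hMK hM hE hX hε0).trans ?_
          rw [hεa, show -(a * ρ) = -(a / 2 * ρ) + -(a / 2 * ρ) by ring, Real.exp_add, ← mul_assoc]
          refine mul_le_mul_of_nonneg_right ?_ (Real.exp_pos _).le
          have h1 : Real.exp (-(a / 2 * ρ)) ≤ Real.exp (-K) := by
            rw [Real.exp_le_exp, neg_le_neg_iff]
            rw [div_le_iff₀ ha0] at hρ
            linarith
          have h2 := sq_mul_exp_neg_le (show (0 : ℝ) ≤ K by positivity)
          calc 2 * M * K * Real.exp (-(a / 2 * ρ)) ≤ 2 * K * K * Real.exp (-K) := by gcongr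
            _ ≤ 4 := by linarith
      _ ≤ ∑ ρ ∈ Finset.range E, 4 * Real.exp (-(a / 2 * ρ)) :=
          Finset.sum_le_sum_of_subset_of_nonneg (Finset.filter_subset _ _)
            fun _ _ _ => by positivity
      _ ≤ _ := by
          rw [← Finset.mul_sum]
          exact mul_le_mul_of_nonneg_left (sum_exp_neg_le (by positivity) E) (by norm_num)
  -- The length of exploration is chosen so that the failure probability at its end cancels the
  -- factor `T`.
  have hPB' : T * M * P.real B' ≤ K * M := by
    have h1 := measure_deviation_le hMK hM hE hX (r := A) hε0
    have h2 : Real.exp (-(ε ^ 2 * A)) = 1 / (2 * M * T) := by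
      rw [hεa, hA', mul_div_cancel₀ _ ha0.ne', Real.exp_neg, hL, Real.exp_log (by positivity),
        one_div]
    rw [h2] at h1
    calc T * M * P.real B' ≤ T * M * (2 * M * K * (1 / (2 * M * T))) := by gcongr
      _ = K * M := by field_simp
  have hfin : K * (M * (2 * K / a + 1)) + K * M * (4 * (1 + 1 / (a / 2))) + K * M ≤
      12 * (K * M * (K * (1 / a))) := by
    have h1 : 1 / (a / 2) = 2 * (1 / a) := by field_simp
    have h2 : 2 * K / a = 2 * (K * (1 / a)) := by ring
    rw [h1, h2]
    have h3 : 1 / a ≤ K * (1 / a) := le_mul_of_one_le_left (by positivity) hK'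
    have h4 : 2 * (K * (1 / a)) + 1 + 4 * (1 + 2 * (1 / a)) + 1 ≤ 12 * (K * (1 / a)) := by linarith
    have h5 := mul_le_mul_of_nonneg_left h4 (show (0 : ℝ) ≤ K * M by positivity)
    linarith
  calc _ ≤ _ := hint
    _ ≤ K * (M * (2 * K / a + 1)) + K * M * (4 * (1 + 1 / (a / 2))) + K * M := by gcongr
    _ ≤ 12 * (K * M * (K * (1 / a))) := hfin
    _ = _ := by rw [ha]; field_simp; norm_num

theorem communicationRegret_le (hM : 1 ≤ M) (hT : 1 ≤ T) (hμ : ∀ m k, μ m k ∈ Set.Icc (0 : ℝ) 1)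
    (hgs : IsUniqueOptimal μ gs) (hX : IsRewardProcess P μ X) (hΔ : Δ = minGap μ gs)
    (hL : L = Real.log (2 * M * T)) (hA : A = 9 * (M : ℝ) ^ 2 * L / Δ ^ 2) :
    communicationRegret P hMK (A * K) T μ gs X ≤ 500 * ((M : ℝ) ^ 2 * (A * K)) := by
  have hM' : (1 : ℝ) ≤ M := by exact_mod_cast hM
  have hT' : (1 : ℝ) ≤ T := by exact_mod_cast hT
  have hMK' : (M : ℝ) ≤ K := by exact_mod_cast hMK.le
  have hK' : (1 : ℝ) ≤ K := hM'.trans hMK'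
  have hΔ0 : 0 < Δ := hΔ ▸ minGap_pos hM hMK hgs
  have hΔ1 : Δ ≤ 1 := hΔ ▸ minGap_le_one hM hMK hμ hgs
  have hL0 : 1 / 2 < L := hL ▸ half_lt_log hM hT
  have hAL : 9 * (M : ℝ) ^ 2 * L ≤ A := by
    rw [hA, le_div_iff₀ (by positivity)]
    exact mul_le_of_le_one_right (by positivity) (pow_le_one₀ hΔ0.le hΔ1)
  have hMA : (M : ℝ) ^ 2 ≤ A := by nlinarith
  have hA1 : 1 ≤ A := by nlinarith
  have hA0 : 0 < A := by linarith
  have hE := isEpochCount_ceil (K := K) hA0 (by omega)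
  set E := ⌈A⌉₊ with hEdef
  have hAE : A ≤ E := Nat.le_ceil A
  have hEA : (E : ℝ) ≤ 2 * A := by linarith [(Nat.ceil_lt_add_one hA0.le)]
  unfold communicationRegret
  -- The union bound below involves `log K`, which `L` controls only when `K ≤ T`; otherwise there
  -- is no communication at all.
  by_cases hTK : T ≤ K
  · simp only [sum_communication_eq_zero hMK _ hM hE T hTK, integral_zero]
    positivity
  have hKT : (K : ℝ) ≤ T := by exact_mod_cast (not_le.1 hTK).le
  -- With `ε² r = l` the deviation probability `2 M K exp (-l)` is `1 / M`, which compensates the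
  -- worst-case regret `M` of a bad epoch.
  set l := Real.log (2 * (M : ℝ) ^ 2 * K) with hl
  have hl0 : 0 ≤ l := Real.log_nonneg (by nlinarith [one_le_pow₀ hM' (n := 2)])
  have hlL : l ≤ 2 * L := by
    have h1 : l ≤ Real.log ((2 * M * T) ^ 2) := by
      refine Real.log_le_log (by positivity) ?_
      have h2 : (K : ℝ) ≤ T ^ 2 := by nlinarith
      have h3 : 2 * (M : ℝ) ^ 2 * K ≤ 2 * (M : ℝ) ^ 2 * T ^ 2 := by gcongr
      nlinarith [sq_nonneg ((M : ℝ) * T)]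
    rw [Real.log_pow] at h1
    rw [hL]; exact_mod_cast h1
  -- The maximum with `1` avoids a division by zero in epoch `0`, whose regret is bounded trivially.
  set r : ℕ → ℝ := fun ρ => max ρ 1 with hr
  set ε : ℕ → ℝ := fun ρ => Real.sqrt (l / r ρ) with hε
  set B : ℕ → Set Ω := fun ρ => deviation μ hMK (A * K) X (r ρ) (ε ρ) with hB
  set reg : Ω → ℕ → ℝ := fun ω ρ =>
    utility μ gs - utility μ (hungarian hMK (shared hMK (A * K) (fun i => X i ω) ρ)) with hreg
  have hsE : 0 ≤ Real.sqrt E := Real.sqrt_nonneg _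
  -- From `9 M² L ≤ A ≤ E`; it makes the regret bounds `O(√E / √ρ)`, whose sum is `O(E)`.
  have hMLE : M * Real.sqrt L ≤ Real.sqrt E / 3 := by
    refine le_of_sq_le_sq ?_ (by positivity)
    rw [mul_pow, div_pow, Real.sq_sqrt (by linarith), Real.sq_sqrt (by positivity)]
    linarith
  have hregle : ∀ ω, ∀ ρ < E,
      reg ω ρ ≤ 3 * Real.sqrt E * (1 / Real.sqrt (ρ + 1)) + M * (B ρ).indicator 1 ω := by
    intro ω ρ hρ
    have hMsE : (M : ℝ) ≤ Real.sqrt E := Real.le_sqrt_of_sq_le (hMA.trans hAE)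
    by_cases hω : ω ∈ B ρ
    · rw [Set.indicator_of_mem hω, Pi.one_apply, mul_one]
      exact (regret_le hμ _).trans (le_add_of_nonneg_left (by positivity))
    · rw [Set.indicator_of_notMem hω, mul_zero, add_zero]
      rcases Nat.eq_zero_or_pos ρ with rfl | hρ0
      · refine (regret_le hμ _).trans ?_
        simp only [Nat.cast_zero, zero_add, Real.sqrt_one]
        linarith
      · have hρ' : (1 : ℝ) ≤ ρ := by exact_mod_cast hρ0
        have hrρ : r ρ = ρ := max_eq_left hρ'
        refine (regret_shared_le hMK hM hE hμ hgs hρ0 hρ.le hrρ.le hω).trans ?_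
        have hsρ : 0 < Real.sqrt ρ := Real.sqrt_pos.2 (by linarith)
        have h1 : ε ρ ≤ 3 / 2 * Real.sqrt L / Real.sqrt ρ := by
          simp only [hε, hrρ]
          rw [Real.sqrt_div hl0]
          refine div_le_div_of_nonneg_right ?_ hsρ.le
          rw [Real.sqrt_le_left (by positivity), mul_pow, Real.sq_sqrt (by linarith)]
          linarith
        have h2 : 1 / 2 ≤ Real.sqrt L := by
          apply Real.le_sqrt_of_sq_le
          linarith
        have h3 : 1 / Real.sqrt ρ ≤ 3 / 2 * (1 / Real.sqrt (ρ + 1)) := by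
          have hs1 : 0 < Real.sqrt ((ρ : ℝ) + 1) := Real.sqrt_pos.2 (by linarith)
          rw [mul_one_div, div_le_div_iff₀ hsρ hs1, one_mul,
            Real.sqrt_le_left (by positivity), mul_pow, Real.sq_sqrt (by linarith)]
          linarith
        calc M / (2 * Real.sqrt ρ) + 2 * M * ε ρ
            ≤ M / (2 * Real.sqrt ρ) + 2 * M * (3 / 2 * Real.sqrt L / Real.sqrt ρ) := by gcongr
          _ = M * (1 / 2 + 3 * Real.sqrt L) * (1 / Real.sqrt ρ) := by field_simp
          _ ≤ M * (4 * Real.sqrt L) * (3 / 2 * (1 / Real.sqrt (ρ + 1))) := by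
              gcongr
              linarith
          _ = 6 * (M * Real.sqrt L) * (1 / Real.sqrt (ρ + 1)) := by ring
          _ ≤ 6 * (Real.sqrt E / 3) * (1 / Real.sqrt (ρ + 1)) := by gcongr
          _ ≤ _ := by
              refine mul_le_mul_of_nonneg_right ?_ (by positivity)
              linarith
  have hsumreg : ∀ ω, ∑ ρ ∈ Finset.range E, reg ω ρ ≤
      6 * E + M * ∑ ρ ∈ Finset.range E, (B ρ).indicator 1 ω := by
    intro ω
    refine (Finset.sum_le_sum fun ρ hρ => hregle ω ρ (Finset.mem_range.1 hρ)).trans ?_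
    rw [Finset.sum_add_distrib, ← Finset.mul_sum, ← Finset.mul_sum]
    have h1 := mul_le_mul_of_nonneg_left (sum_one_div_sqrt_le E)
      (show 0 ≤ 3 * Real.sqrt E by positivity)
    have h2 := Real.mul_self_sqrt (show (0 : ℝ) ≤ E by positivity)
    nlinarith
  have hPB : ∀ ρ ∈ Finset.range E, P.real (B ρ) ≤ 1 / M := by
    intro ρ _
    have hrρ : 0 < r ρ := lt_of_lt_of_le one_pos (le_max_right _ _)
    have h1 := measure_deviation_le hMK hM hE hX (r := r ρ) (Real.sqrt_nonneg (l / r ρ))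
    rw [Real.sq_sqrt (by positivity), div_mul_cancel₀ _ hrρ.ne', Real.exp_neg, hl,
      Real.exp_log (by positivity)] at h1
    refine h1.trans (le_of_eq ?_)
    field_simp
  have hint := integral_le_of_indicators (P := P) (f := fun ω => ∑ t ∈ Finset.range T,
      (if IsCommRound (run hMK (A * K) (fun i => X i ω) t) then
        utility μ gs - utility μ (pulls (run hMK (A * K) (fun i => X i ω) t)) else 0))
      (fun ω => Finset.sum_nonneg fun t _ => by
        split_ifs
        · exact hgs.regret_nonneg _
        · exact le_rfl)
      -- `224 = 110 + 19 * 6`, from `sum_comm_le` and the bound `6 E` on the sum of the regrets in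
      -- the good case.
      (224 * (M : ℝ) ^ 2 * K * E) (19 * (M : ℝ) ^ 2 * K * M) 0 B ∅
      (fun ρ => measurableSet_deviation hMK hX _ _) MeasurableSet.empty (Finset.range E)
      (fun ω => by
        refine (sum_communication_le hMK _ hM hE T hμ hgs).trans ?_
        refine (sum_comm_le hMK _ hM hE (reg ω) (fun ρ => hgs.regret_nonneg _)
          (fun ρ => regret_le hμ _) (hMA.trans hAE)).trans ?_
        have h1 := mul_le_mul_of_nonneg_left (hsumreg ω)
          (show 0 ≤ 19 * (M : ℝ) ^ 2 * K by positivity)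
        linarith)
  refine hint.trans ?_
  have h1 := Finset.sum_le_sum hPB
  rw [Finset.sum_const, Finset.card_range, nsmul_eq_mul] at h1
  rw [zero_mul, add_zero]
  calc _ ≤ 224 * (M : ℝ) ^ 2 * K * E + 19 * (M : ℝ) ^ 2 * K * M * (E * (1 / M)) := by gcongr
    _ = 243 * ((M : ℝ) ^ 2 * K) * E := by field_simp; norm_num
    _ ≤ 243 * ((M : ℝ) ^ 2 * K) * (2 * A) := by gcongr
    _ ≤ _ := by nlinarith [show 0 ≤ (M : ℝ) ^ 2 * K * A by positivity]

end HMA2B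

namespace HMA2B

variable {M K : ℕ} (hMK : M < K) {Ω : Type*} [MeasurableSpace Ω] {P : Measure Ω}
  [IsProbabilityMeasure P] {μ : Fin M → Fin K → ℝ} {gs : Fin M → Fin K}
  {X : ℕ → Ω → Fin M → Fin K → Bool} {T : ℕ} {Δ L A : ℝ}

/-- Each of the `K ⌈A⌉` exploration rounds has `M` hints, and rounding up at most doubles `A`. -/
theorem hintComplexity_le (hM : 1 ≤ M) (hA : 1 ≤ A) :
    hintComplexity P hMK (A * K) T X ≤ 2 * (M * (A * K)) := by
  have hE := isEpochCount_ceil (K := K) (zero_lt_one.trans_le hA) (by omega)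
  have hEA : ((⌈A⌉₊ : ℕ) : ℝ) ≤ 2 * A := by linarith [Nat.ceil_lt_add_one (zero_le_one.trans hA)]
  calc hintComplexity P hMK (A * K) T X ≤ ∫ _ω, (M * K * (⌈A⌉₊ : ℕ) : ℝ) ∂P := by
        refine integral_mono_of_nonneg (Filter.Eventually.of_forall fun ω => ?_)
          (integrable_const _) (Filter.Eventually.of_forall fun ω => ?_)
        · exact Finset.sum_nonneg fun t _ => Finset.sum_nonneg fun m _ => by
            split_ifs <;> simp
        · exact sum_hints_le hMK _ hM hE T
    _ = M * K * (⌈A⌉₊ : ℕ) := by simp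
    _ ≤ M * K * (2 * A) := by gcongr
    _ = _ := by ring

end HMA2B

theorem mainTheorem4 :
    ∃ C : ℝ, 0 < C ∧
      ∀ (M K T : ℕ) (_hM : 1 ≤ M) (hMK : M < K) (_hT : 1 ≤ T)
        (μ : Fin M → Fin K → ℝ) (_hμ : ∀ m k, μ m k ∈ Set.Icc (0 : ℝ) 1)
        (gs : Fin M → Fin K) (_hgs : HMA2B.IsUniqueOptimal μ gs)
        (Ω : Type*) [MeasurableSpace Ω] (P : Measure Ω) [IsProbabilityMeasure P]
        (X : ℕ → Ω → Fin M → Fin K → Bool) (_hX : HMA2B.IsRewardProcess P μ X)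
        (Δ : ℝ) (_hΔ : Δ = HMA2B.minGap μ gs)
        (T₀ : ℝ) (_hT₀ : T₀ = HMA2B.stopTime M K T Δ),
        HMA2B.explorationRegret P hMK T₀ T μ gs X ≤ C * ((M : ℝ) ^ 3 * (K : ℝ) ^ 2 / Δ ^ 2) ∧
        HMA2B.hintComplexity P hMK T₀ T X ≤ C * (M * T₀) ∧
        HMA2B.communicationRegret P hMK T₀ T μ gs X ≤ C * ((M : ℝ) ^ 2 * T₀) := by
  -- The largest of the constants `108`, `2` and `500` of the three bounds.
  refine ⟨500, by norm_num, fun M K T hM hMK hT μ hμ gs hgs Ω _ P _ X hX Δ hΔ T₀ hT₀ => ?_⟩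
  have hM' : (1 : ℝ) ≤ M := by exact_mod_cast hM
  have hΔ0 : 0 < Δ := hΔ ▸ HMA2B.minGap_pos hM hMK hgs
  have hΔ1 : Δ ≤ 1 := hΔ ▸ HMA2B.minGap_le_one hM hMK hμ hgs
  set L := Real.log (2 * M * T) with hL
  have hL0 : 1 / 2 < L := HMA2B.half_lt_log hM hT
  set A : ℝ := 9 * (M : ℝ) ^ 2 * L / Δ ^ 2 with hA
  have hA1 : 1 ≤ A := by
    rw [hA, le_div_iff₀ (by positivity), one_mul]
    have h1 : Δ ^ 2 ≤ 1 := pow_le_one₀ hΔ0.le hΔ1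
    have h2 : (1 : ℝ) ≤ (M : ℝ) ^ 2 := one_le_pow₀ hM'
    nlinarith
  have hT₀A : T₀ = A * K := by
    rw [hT₀, HMA2B.stopTime, hA, hL]
    ring
  rw [hT₀A]
  refine ⟨?_, ?_, HMA2B.communicationRegret_le hMK hM hT hμ hgs hX hΔ hL hA⟩
  · exact (HMA2B.explorationRegret_le hMK hM hT hμ hgs hX hΔ hL hA).trans
      (mul_le_mul_of_nonneg_right (by norm_num) (by positivity))
  · exact (HMA2B.hintComplexity_le hMK hM hA1).trans
      (mul_le_mul_of_nonneg_right (by norm_num) (by positivity))
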